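/- **Theorem 2.** Let $\mathcal U,\mathcal X,\mathcal Y$ be finite alphabets, $P_{Y|X}$ a memoryless channel, $P_{UX}=P_U\times P_{X|U}$ a probability distribution on $\mathcal U\times\mathcal X$, and $R_1\ge R_2\ge 0$, $R=R_1-R_2$. Consider the following hierarchical (superposition) ensemble of codes of blocklength $n$, with $M=e^{n(R+o(1))}\ge 2$ bins of $M_2=e^{n(R_2+o(1))}\ge 1$ codewords each. The cloud centers $u_0,\dots,u_{M-1}$ are drawn independently and uniformly from the type class $\mathcal T(P_U)$; given them, the $M_2$ codewords of bin $\mathcal C_w$ are drawn independently and uniformly from the conditional type class $\mathcal T(P_{X|U}|u_w)$. Here $n\to\infty$ along blocklengths for which $P_{UX}$ is the joint type of some pair of sequences of length $n$ or, more generally, the type classes are those of joint types $P^{(n)}_{UX}$ of sequences of length $n$ with $P^{(n)}_{UX}\to P_{UX}$. A uniformly chosen codeword out of the $MM_2$ codewords is transmitted, and the decoder estimates the index of its bin by $w^*(y)\in\arg\max_w \frac1{M_2}\sum_{x\in\mathcal C_w}P(y|x)$, where $P(y|x)=\prod_t P_{Y|X}(y_t|x_t)$ and ties are resolved arbitrarily.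 Let $P_e^*$ be its probability of error, averaged over the ensemble. Then $P_e^*>0$, and $$\lim_{n\to\infty}-\frac{\ln P_e^*}{n}=\min_{Q_{Y|X_0U_0}}\Big\{D(Q_{Y|X_0U_0}\|P_{Y|X_0}|P_{U_0X_0})+\big[E_2(s_1(Q_{U_0X_0Y}),Q_Y)-R\big]_+\Big\},$$ where the minimum is attained and finite, $P_{U_0X_0}=P_{UX}$, $P_{Y|X_0}=P_{Y|X}$, $Q_{U_0X_0Y}=P_{U_0X_0}\times Q_{Y|X_0U_0}$, with marginals $Q_{U_0Y}$, $Q_{X_0Y}$, $Q_Y$, and $[t]_+=\max\{0,t\}$. The remaining quantities are as follows. Logarithms are natural, $\ln 0=-\infty$, $0\cdot\infty=0$; $D(V\|P_{Y|X}|P_{UX})=\sum_{u,x}P_{UX}(u,x)\sum_y V(y|u,x)\ln\frac{V(y|u,x)}{P_{Y|X}(y|x)}$; $I_Q(U;Y)$ and $I_Q(X;Y|U)$ are the mutual and conditional mutual information under $Q$; $f(Q_{XY})=\sum_{x,y}Q_{XY}(x,y)\ln P_{Y|X}(y|x)$; $\mathcal S(Q_{UY})$ is the set of conditional distributions $Q_{X|UY}$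 with $\sum_y Q_{UY}(u,y)Q_{X|UY}(x|u,y)=P_{UX}(u,x)$ for all $(u,x)$; and, with $Q_{UXY}=Q_{UY}\times Q_{X|UY}$, $$E_1(s,Q_{UY})=\min_{Q_{X|UY}\in\mathcal S(Q_{UY})}\big\{[I_Q(X;Y|U)-R_2]_+:\ f(Q_{XY})+[R_2-I_Q(X;Y|U)]_+\ge s\big\},$$ the minimum over the empty set being $+\infty$; $$E_2(s,Q_Y)=\min_{Q_{U|Y}}\big[I_Q(U;Y)+E_1(s,Q_{UY})\big],$$ over all $Q_{U|Y}$ with $\sum_y Q_Y(y)Q_{U|Y}(u|y)=P_U(u)$ for all $u$, where $Q_{UY}=Q_Y\times Q_{U|Y}$; $$s_0(Q_{U_0Y})=R_2+\max_{Q_{X|U_0Y}\in\mathcal S(Q_{U_0Y}):\ I_Q(X;Y|U_0)\le R_2}\big[f(Q_{XY})-I_Q(X;Y|U_0)\big],\qquad s_1(Q_{U_0X_0Y})=\max\{s_0(Q_{U_0Y}),f(Q_{X_0Y})\}.$$ -/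

import Mathlib

open Filter Topology

namespace BinDecoding

noncomputable section

/-! ### The random code and the optimal bin index decoder -/

/-- The type class `T(P)`: the sequences of length `n` whose empirical distribution is `P`. -/
def typeClass {A : Type*} [DecidableEq A] (n : ℕ) (P : A → ℝ) : Set (Fin n → A) :=
  {a | ∀ i : A, ((Finset.univ.filter (fun t => a t = i)).card : ℝ) = n * P i}

/-- The `U`-marginal `P_U` of `P_{UX}`. -/
def margU {U X : Type*} [Fintype X] (P : U × X → ℝ) (u : U) : ℝ := ∑ x, P (u, x)

/-- The conditional type class `T(P_{X|U} | u)`. The sequence `u` will always be of type `P_U`;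
then the conditional empirical distribution of `x` given `u` is `P_{X|U}` if and only if the
joint empirical distribution of `(u, x)` is `P_{UX} = P_U × P_{X|U}`. -/
def condTypeClass {U X : Type*} [DecidableEq U] [DecidableEq X] {n : ℕ}
    (P : U × X → ℝ) (u : Fin n → U) : Set (Fin n → X) :=
  {x | (fun t => (u t, x t)) ∈ typeClass n P}

/-- The probability mass function of the uniform distribution over a finite set `T`. -/
def uniformMass {A : Type*} (T : Set A) (a : A) : ℝ :=
  T.indicator (fun _ => (T.ncard : ℝ)⁻¹) a

/-- The probability of the cloud centers `u` and of the codebook `x` (`x w j` is the `j`-th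
codeword of bin `w`) in the hierarchical ensemble: the `u w` are independent and uniform over
`T(P_U)` and, given them, the `x w j` are independent, `x w j` being uniform over
`T(P_{X|U} | u w)`. -/
def codeProb {U X : Type*} [Fintype X] [DecidableEq U] [DecidableEq X] {n M M₂ : ℕ}
    (P : U × X → ℝ) (u : Fin M → Fin n → U) (x : Fin M → Fin M₂ → Fin n → X) : ℝ :=
  ∏ w, (uniformMass (typeClass n (margU P)) (u w) *
    ∏ j, uniformMass (condTypeClass P (u w)) (x w j))

/-- The memoryless channel `P(y | x) = ∏ₜ P_{Y|X}(yₜ | xₜ)`. -/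
def chan {X Y : Type*} (W : X → Y → ℝ) {n : ℕ} (x : Fin n → X) (y : Fin n → Y) : ℝ :=
  ∏ t, W (x t) (y t)

/-- The likelihood `P(y | C_w)` of the bin `w`. -/
def binLik {X Y : Type*} (W : X → Y → ℝ) {n M M₂ : ℕ}
    (x : Fin M → Fin M₂ → Fin n → X) (w : Fin M) (y : Fin n → Y) : ℝ :=
  (M₂ : ℝ)⁻¹ * ∑ j, chan W (x w j) y

/-- A bin index decoder (for every codebook) that maximizes `P(y | C_w)`; ties may be resolved
in any way. -/
def IsOptimalBinDecoder {X Y : Type*} (W : X → Y → ℝ) {n M M₂ : ℕ}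
    (dec : (Fin M → Fin M₂ → Fin n → X) → (Fin n → Y) → Fin M) : Prop :=
  ∀ x y w, binLik W x w y ≤ binLik W x (dec x y) y

/-- The error probability of a bin index decoder, averaged over the ensemble. The index of the
transmitted codeword `x w j` is uniform over the `M * M₂` pairs `(w, j)`. -/
def errorProb {U X Y : Type*} [Fintype U] [Fintype X] [Fintype Y] [DecidableEq U]
    [DecidableEq X] (P : U × X → ℝ) (W : X → Y → ℝ) {n M M₂ : ℕ}
    (dec : (Fin M → Fin M₂ → Fin n → X) → (Fin n → Y) → Fin M) : ℝ :=
  ∑ u : Fin M → Fin n → U, ∑ x : Fin M → Fin M₂ → Fin n → X, codeProb P u x *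
    (((M : ℝ) * (M₂ : ℝ))⁻¹ * ∑ w : Fin M, ∑ j : Fin M₂, ∑ y : Fin n → Y,
      chan W (x w j) y * (if dec x y = w then 0 else 1))

/-! ### Single-letter quantities

A joint distribution `Q_{UXY}` is a function `Q : U → X → Y → ℝ`. -/

/-- The mutual information `I(U;Y)` of a joint distribution `Q_{UY}`, in nats. -/
def mutualInfo {U Y : Type*} [Fintype U] [Fintype Y] (Q : U → Y → ℝ) : ℝ :=
  ∑ u, ∑ y, Q u y * Real.log (Q u y / ((∑ y', Q u y') * ∑ u', Q u' y))

/-- The conditional mutual information `I(X;Y|U)` of a joint distribution `Q_{UXY}`, in nats. -/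
def condMutualInfo {U X Y : Type*} [Fintype U] [Fintype X] [Fintype Y]
    (Q : U → X → Y → ℝ) : ℝ :=
  ∑ u, ∑ x, ∑ y, Q u x y *
    Real.log (Q u x y * (∑ x', ∑ y', Q u x' y') / ((∑ y', Q u x y') * ∑ x', Q u x' y))

/-- The marginal `Q_{XY}` of `Q_{UXY}`. -/
def margXY {U X Y : Type*} [Fintype U] (Q : U → X → Y → ℝ) (x : X) (y : Y) : ℝ :=
  ∑ u, Q u x y

/-- The marginal `Q_{UY}` of `Q_{UXY}`. -/
def margUY {U X Y : Type*} [Fintype X] (Q : U → X → Y → ℝ) (u : U) (y : Y) : ℝ :=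
  ∑ x, Q u x y

/-- The marginal `Q_Y` of `Q_{UXY}`. -/
def margY {U X Y : Type*} [Fintype U] [Fintype X] (Q : U → X → Y → ℝ) (y : Y) : ℝ :=
  ∑ u, ∑ x, Q u x y

open Classical in
/-- `f(Q_{XY}) = ∑ Q_{XY}(x,y) ln P_{Y|X}(y|x)`, with `ln 0 = -∞` and `0 · (-∞) = 0`. -/
def f {X Y : Type*} [Fintype X] [Fintype Y] (W : X → Y → ℝ) (Q : X → Y → ℝ) : EReal :=
  if ∃ x y, Q x y ≠ 0 ∧ W x y = 0 then ⊥
  else ((∑ x, ∑ y, Q x y * Real.log (W x y) : ℝ) : EReal)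

open Classical in
/-- The weighted divergence `D(V ‖ P_{Y|X} | P_{UX})`, equal to `+∞` if `V(·|u,x)` is not
absolutely continuous with respect to `P_{Y|X}(·|x)` for some `(u,x)` with `P_{UX}(u,x) ≠ 0`. -/
def condDiv {U X Y : Type*} [Fintype U] [Fintype X] [Fintype Y]
    (V : U → X → Y → ℝ) (W : X → Y → ℝ) (P : U × X → ℝ) : EReal :=
  if ∃ u x y, P (u, x) ≠ 0 ∧ V u x y ≠ 0 ∧ W x y = 0 then ⊤
  else ((∑ u, ∑ x, P (u, x) * ∑ y, V u x y * Real.log (V u x y / W x y) : ℝ) : EReal)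

/-- The set `S(Q_{UY})` of the conditional distributions `T = Q_{X|UY}` (`T u y x` stands for
`Q_{X|UY}(x|u,y)`) with `∑_y Q_{UY}(u,y) Q_{X|UY}(x|u,y) = P_{UX}(u,x)`. -/
def S {U X Y : Type*} [Fintype X] [Fintype Y]
    (P : U × X → ℝ) (QUY : U → Y → ℝ) : Set (U → Y → X → ℝ) :=
  {T | (∀ u y, T u y ∈ stdSimplex ℝ X) ∧ ∀ u x, ∑ y, QUY u y * T u y x = P (u, x)}

/-- The joint distribution `Q_{UXY} = Q_{UY} × Q_{X|UY}`. -/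
def jointOf {U X Y : Type*} (QUY : U → Y → ℝ) (T : U → Y → X → ℝ) : U → X → Y → ℝ :=
  fun u x y => QUY u y * T u y x

/-- `E₁(s, Q_{UY})`; the minimum over the empty set is `+∞`. -/
def E₁ {U X Y : Type*} [Fintype U] [Fintype X] [Fintype Y]
    (P : U × X → ℝ) (W : X → Y → ℝ) (R₂ : ℝ) (s : EReal) (QUY : U → Y → ℝ) : EReal :=
  ⨅ T ∈ {T ∈ S P QUY | s ≤ f W (margXY (jointOf QUY T)) +
      ((max 0 (R₂ - condMutualInfo (jointOf QUY T)) : ℝ) : EReal)},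
    ((max 0 (condMutualInfo (jointOf QUY T) - R₂) : ℝ) : EReal)

/-- `E₂(s, Q_Y)`; here `K y u` stands for `Q_{U|Y}(u|y)`. -/
def E₂ {U X Y : Type*} [Fintype U] [Fintype X] [Fintype Y]
    (P : U × X → ℝ) (W : X → Y → ℝ) (R₂ : ℝ) (s : EReal) (QY : Y → ℝ) : EReal :=
  ⨅ K ∈ {K : Y → U → ℝ | (∀ y, K y ∈ stdSimplex ℝ U) ∧ ∀ u, ∑ y, QY y * K y u = margU P u},
    ((mutualInfo (fun u y => QY y * K y u) : ℝ) : EReal) +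
      E₁ P W R₂ s (fun u y => QY y * K y u)

/-- `s₀(Q_{U₀Y})`. -/
def s₀ {U X Y : Type*} [Fintype U] [Fintype X] [Fintype Y]
    (P : U × X → ℝ) (W : X → Y → ℝ) (R₂ : ℝ) (QUY : U → Y → ℝ) : EReal :=
  (R₂ : EReal) + ⨆ T ∈ {T ∈ S P QUY | condMutualInfo (jointOf QUY T) ≤ R₂},
    (f W (margXY (jointOf QUY T)) - ((condMutualInfo (jointOf QUY T) : ℝ) : EReal))

/-- `s₁(Q_{U₀X₀Y})`. -/
def s₁ {U X Y : Type*} [Fintype U] [Fintype X] [Fintype Y]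
    (P : U × X → ℝ) (W : X → Y → ℝ) (R₂ : ℝ) (Q : U → X → Y → ℝ) : EReal :=
  max (s₀ P W R₂ (margUY Q)) (f W (margXY Q))

/-- The function of `V = Q_{Y|X₀U₀}` (`V u x y` stands for `Q_{Y|X₀U₀}(y|x,u)`) that is
minimized in the formula for the exponent; `Q_{U₀X₀Y} = P_{UX} × V`. -/
def objective {U X Y : Type*} [Fintype U] [Fintype X] [Fintype Y]
    (P : U × X → ℝ) (W : X → Y → ℝ) (R R₂ : ℝ) (V : U → X → Y → ℝ) : EReal :=
  condDiv V W P +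
    max 0 (E₂ P W R₂ (s₁ P W R₂ (fun u x y => P (u, x) * V u x y))
      (margY (fun u x y => P (u, x) * V u x y)) - (R : EReal))

end

end BinDecoding

namespace BinDecoding

noncomputable section

set_option linter.unusedSectionVars false

/-! ### Type classes -/

/-! Everything is governed by the joint type `Q` of a cloud center, a codeword of its bin and the
channel output. Counting type classes (`ncard_fiber_mul`, `log_ncard_typeClass`) gives, up to the
subexponential factor `exp` of a multiple of `slack`: a transmitted codeword and its output realize
`Q` with probability `exp (-n * divg W Q)`, and an independent bin contains a codeword of joint type
`Q` with a given output of type `margY Q` with probability `exp (-n * cost R₂ Q)`, where `cost` is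
`I(U;Y) + [I(X;Y|U) - R₂]₊`. Hence `Q` causes errors with exponent `typeExp = divg + [cost - R]₊`,
and the exponent of the ensemble is the minimum of `typeExp` over `admissible`.

Upper bound on the error (`errorProb_le`): the optimal decoder is no worse than the one that picks
the bin of a codeword of largest `cost`. For that decoder an error under `Q` needs another bin with
a codeword of cost at least `cost Q`, which has probability at most `min 1 (M * exp (-n * cost Q))`
up to `slack`. Sums of likelihoods over bins never have to be analysed.

Lower bound (`errorProb_ge`): whatever the decoder, only one bin per output is decoded correctly, so
the error mass is at least the likelihood of all bins rich in codewords of type `Q` except one. A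
second moment bound (`iidExp_count_ge`) makes bins rich often enough, and `iidExp_excess_ge` bounds
the mean number of rich bins beyond the first.

Single-letter part (`isLeast_objective`): `objective` and `typeExp` have the same minimum, although
their values for a given channel may differ. By `divg_eq`, for a fixed output marginal, `divg -
cost` is determined by the score `logLik + [R₂ - I(X;Y|U)]₊`. The threshold `s₁` dominates the score
of `Q` (`le_s₁`), so each competitor in `E₂` has larger `cost` or smaller `divg` than `Q`; in both
cases `le_objective` follows. Conversely `E₂` at that threshold is at most `cost Q` (`E₂_s₁_le`).

Finally, compactness (`eventually_le_typeExp`) and approximation by types (`exists_joint_type`) pass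
from blocklength `n` to the limit. -/

/-- The entropy `-∑ P ln P`, in nats. -/
def ent {A : Type*} [Fintype A] (P : A → ℝ) : ℝ := ∑ a, Real.negMulLog (P a)

/-- `n ^ n / n!` is a single term of the exponential series at `n`. -/
theorem log_factorial_lower (n : ℕ) : n * Real.log n - n ≤ Real.log (n.factorial : ℝ) := by
  rcases Nat.eq_zero_or_pos n with rfl | hn
  · simp
  have h1 : (n : ℝ) ^ n / n.factorial ≤ Real.exp n := by
    have := Real.sum_le_exp_of_nonneg (Nat.cast_nonneg (α := ℝ) n) (n + 1)
    refine le_trans ?_ this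
    exact Finset.single_le_sum (f := fun i => (n : ℝ) ^ i / i.factorial)
      (fun i _ => by positivity) (Finset.mem_range.2 (Nat.lt_succ_self n))
  have h2 := Real.log_le_log (by positivity) h1
  rw [Real.log_exp, Real.log_div (by positivity) (by positivity), Real.log_pow] at h2
  linarith

/-- Stirling up to a logarithmic error, which is enough for exponents. The form `(n + 1) log (n + 1)
- n` is the one that survives induction, since `(k + 2) log ((k + 2) / (k + 1)) ≥ 1`. -/
theorem log_factorial_upper (n : ℕ) :
    Real.log (n.factorial : ℝ) ≤ n * Real.log n - n + (Real.log (n + 1) + 1) := by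
  have key : Real.log (n.factorial : ℝ) ≤ (n + 1) * Real.log (n + 1) - n := by
    induction n with
    | zero => simp
    | succ k ih =>
      rw [Nat.factorial_succ]
      push_cast
      rw [Real.log_mul (by positivity) (by positivity)]
      have h := Real.one_sub_inv_le_log_of_pos (x := ((k : ℝ) + 2) / (k + 1)) (by positivity)
      rw [Real.log_div (by positivity) (by positivity), inv_div] at h
      have h3 : ((k : ℝ) + 2) * (1 - (k + 1) / (k + 2)) = 1 := by field_simp; ring
      have h4 : (k : ℝ) + 1 + 1 = k + 2 := by ring
      rw [h4]
      have h5 := mul_le_mul_of_nonneg_left h (by positivity : (0 : ℝ) ≤ (k : ℝ) + 2)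
      rw [h3] at h5
      linarith
  rcases Nat.eq_zero_or_pos n with rfl | hn
  · simp
  have hn' : (0 : ℝ) < n := by exact_mod_cast hn
  have h := Real.log_le_sub_one_of_pos (x := ((n : ℝ) + 1) / n) (by positivity)
  rw [Real.log_div (by positivity) (by positivity)] at h
  have h5 := mul_le_mul_of_nonneg_left h hn'.le
  have h3 : (n : ℝ) * (((n : ℝ) + 1) / n - 1) = 1 := by field_simp; ring
  rw [h3] at h5
  linarith

section Counting

variable {A B : Type*} [DecidableEq A] [DecidableEq B] {n : ℕ}

/-- The positions carrying a given letter are equally many in both sequences and can be matched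
letter by letter. This transitivity underlies all the counting below. -/
theorem exists_perm_of_mem_typeClass [Fintype A] {P : A → ℝ} {b b' : Fin n → A}
    (h : b ∈ typeClass n P) (h' : b' ∈ typeClass n P) :
    ∃ σ : Equiv.Perm (Fin n), b' ∘ σ = b := by
  have hc : ∀ c, Nonempty ({t // b t = c} ≃ {t // b' t = c}) := by
    intro c
    refine ⟨Fintype.equivOfCardEq ?_⟩
    rw [Fintype.card_subtype, Fintype.card_subtype]
    have h1 := (h c).trans (h' c).symm
    exact_mod_cast h1
  exact ⟨Equiv.ofFiberEquiv (fun c => (hc c).some), funext fun t => Equiv.ofFiberEquiv_map _ t⟩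

theorem comp_perm_mem_typeClass {P : A → ℝ} {a : Fin n → A} (h : a ∈ typeClass n P)
    (σ : Equiv.Perm (Fin n)) : a ∘ σ ∈ typeClass n P := by
  intro i
  rw [← h i]
  congr 1
  refine Finset.card_bij (fun t _ => σ t) ?_ ?_ ?_
  · intro t ht; simpa using ht
  · intro t _ s _ hts; exact σ.injective hts
  · intro t ht; exact ⟨σ.symm t, by simpa using ht, by simp⟩

theorem comp_mem_typeClass [Fintype A] {P : A → ℝ} {P' : B → ℝ} (φ : A → B)
    (hP : ∀ b, P' b = ∑ a with φ a = b, P a) {a : Fin n → A} (h : a ∈ typeClass n P) :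
    φ ∘ a ∈ typeClass n P' := by
  intro b
  rw [hP, Finset.mul_sum]
  simp_rw [← h _]
  rw [← Nat.cast_sum]
  congr 1
  rw [Finset.card_eq_sum_card_fiberwise (f := a) (t := Finset.univ.filter fun i => φ i = b)]
  · refine Finset.sum_congr rfl fun i hi => ?_
    congr 1
    ext t
    simp only [Finset.mem_filter, Finset.mem_univ, true_and, Function.comp] at hi ⊢
    constructor
    · exact fun h => h.2
    · rintro rfl; exact ⟨hi, rfl⟩
  · intro t ht
    simpa using ht

/-- All fibers of a symbolwise map between type classes have the same size. -/
theorem ncard_fiber_mul [Fintype A] [Fintype B] {P : A → ℝ} {P' : B → ℝ} (φ : A → B)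
    (hP : ∀ b, P' b = ∑ a with φ a = b, P a) {b : Fin n → B} (hb : b ∈ typeClass n P') :
    {a ∈ typeClass n P | φ ∘ a = b}.ncard * (typeClass n P').ncard = (typeClass n P).ncard := by
  classical
  -- A permutation of positions carrying one base sequence to another injects the fiber over the
  -- first into the fiber over the second; permutations in both directions give equality.
  have hconst : ∀ b' ∈ typeClass n P', {a ∈ typeClass n P | φ ∘ a = b'}.ncard
      = {a ∈ typeClass n P | φ ∘ a = b}.ncard := by
    intro b' hb'
    obtain ⟨σ, hσ⟩ := exists_perm_of_mem_typeClass hb' hb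
    obtain ⟨ρ, hρ⟩ := exists_perm_of_mem_typeClass hb hb'
    have key : ∀ (c c' : Fin n → B) (σ : Equiv.Perm (Fin n)), c ∘ σ = c' →
        {a ∈ typeClass n P | φ ∘ a = c}.ncard ≤ {a ∈ typeClass n P | φ ∘ a = c'}.ncard := by
      intro c c' σ h
      refine Set.ncard_le_ncard_of_injOn (fun a => a ∘ σ) ?_ ?_ (Set.toFinite _)
      · rintro a ⟨h1, h2⟩
        refine ⟨comp_perm_mem_typeClass h1 σ, ?_⟩
        rw [← h, ← h2]; rfl
      · intro a _ a' _ h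
        funext t
        simpa using congrFun h (σ.symm t)
    exact le_antisymm (key _ _ ρ hρ) (key _ _ σ hσ)
  have h1 := Finset.card_eq_sum_card_fiberwise (s := (typeClass n P).toFinset)
    (t := (typeClass n P').toFinset) (f := fun a => φ ∘ a)
    (fun a ha => by
      simp only [Set.coe_toFinset] at ha ⊢
      exact comp_mem_typeClass φ hP ha)
  rw [Set.ncard_eq_toFinset_card' (typeClass n P), h1,
    Finset.sum_congr rfl (g := fun _ => {a ∈ typeClass n P | φ ∘ a = b}.ncard), Finset.sum_const,
    Set.ncard_eq_toFinset_card' (typeClass n P'), smul_eq_mul, mul_comm]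
  intro b' hb'
  rw [← hconst b' (by simpa using hb'), Set.ncard_eq_toFinset_card']
  congr 1
  ext a
  simp

/-- Orbit counting: each fiber of `σ ↦ a ∘ σ` over the type class is a coset of the stabilizer of
`a`, which permutes positions within each letter. -/
theorem ncard_typeClass_mul [Fintype A] {P : A → ℝ} {a : Fin n → A} (ha : a ∈ typeClass n P) :
    (typeClass n P).ncard * ∏ i, (Finset.univ.filter (fun t => a t = i)).card.factorial
      = n.factorial := by
  classical
  have h1 := Finset.card_eq_sum_card_fiberwise (s := (Finset.univ : Finset (Equiv.Perm (Fin n))))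
    (t := (typeClass n P).toFinset) (f := fun σ : Equiv.Perm (Fin n) => a ∘ σ)
    (fun σ _ => by simpa using comp_perm_mem_typeClass ha σ)
  have h2 : ∀ b ∈ (typeClass n P).toFinset,
      (Finset.univ.filter fun σ : Equiv.Perm (Fin n) => a ∘ σ = b).card
        = ∏ i, (Finset.univ.filter (fun t => a t = i)).card.factorial := by
    intro b hb
    have hb' : b ∈ typeClass n P := by simpa using hb
    obtain ⟨ρ, hρ⟩ := exists_perm_of_mem_typeClass hb' ha
    have h3 := DomMulAct.stabilizer_card a
    rw [Fintype.card_subtype] at h3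
    rw [Finset.prod_congr rfl fun i _ => by rw [← Fintype.card_subtype], ← h3]
    refine Finset.card_bij (fun σ _ => σ * ρ⁻¹) ?_ ?_ ?_
    · intro σ hσ
      simp only [Finset.mem_filter, Finset.mem_univ, true_and] at hσ ⊢
      funext t
      have := congrFun (hσ.trans hρ.symm) (ρ⁻¹ t)
      simpa using this
    · intro σ _ σ' _ h
      exact mul_right_cancel h
    · intro σ hσ
      refine ⟨σ * ρ, ?_, by simp⟩
      simp only [Finset.mem_filter, Finset.mem_univ, true_and] at hσ ⊢
      rw [← hρ]
      funext t
      exact congrFun hσ (ρ t)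
  rw [Finset.sum_congr rfl h2, Finset.sum_const, smul_eq_mul, Finset.card_univ,
    Fintype.card_perm, Fintype.card_fin] at h1
  rw [Set.ncard_eq_toFinset_card', ← h1]

/-- The terms linear in the counts cancel because the counts sum to `n`. What is left is one
logarithmic error for each of the `card A` factorials and one for `n!`. -/
theorem log_ncard_typeClass [Fintype A] (hn : 0 < n) {P : A → ℝ} (hne : (typeClass n P).Nonempty) :
    |Real.log (typeClass n P).ncard - n * ent P| ≤
      (Fintype.card A + 1) * (Real.log (n + 1) + 1) := by
  obtain ⟨a, ha⟩ := hne
  have hn' : (0 : ℝ) < n := by exact_mod_cast hn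
  set m : A → ℕ := fun i => (Finset.univ.filter (fun t => a t = i)).card with hm
  have hmP : ∀ i, (m i : ℝ) = n * P i := ha
  have hsum : ∑ i, (m i : ℝ) = n := by
    have := Finset.card_eq_sum_card_fiberwise (s := (Finset.univ : Finset (Fin n)))
      (t := Finset.univ) (f := a) (fun _ _ => by simp)
    rw [Finset.card_univ, Fintype.card_fin] at this
    exact_mod_cast this.symm
  have hmn : ∀ i, m i ≤ n := fun i => by
    simpa using Finset.card_le_univ (Finset.univ.filter (fun t => a t = i))
  have hmul := ncard_typeClass_mul ha
  have hpos : 0 < (typeClass n P).ncard := (Set.ncard_pos (Set.toFinite _)).2 ⟨a, ha⟩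
  have hlog : Real.log (typeClass n P).ncard + ∑ i, Real.log ((m i).factorial : ℝ)
      = Real.log (n.factorial : ℝ) := by
    rw [← hmul]
    push_cast
    rw [Real.log_mul (by positivity) (by positivity), Real.log_prod (fun i _ => by positivity)]
  have hent : n * ent P = n * Real.log n - ∑ i, (m i : ℝ) * Real.log (m i) := by
    have : ∀ i, n * Real.negMulLog (P i) = (m i : ℝ) * Real.log n - m i * Real.log (m i) := by
      intro i
      rw [hmP, Real.negMulLog]
      rcases eq_or_ne (P i) 0 with h | h
      · simp [h]
      · rw [Real.log_mul hn'.ne' h]; ring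
    rw [ent, Finset.mul_sum, Finset.sum_congr rfl fun i _ => this i, Finset.sum_sub_distrib,
      ← Finset.sum_mul, hsum]
  set L := Real.log ((n : ℝ) + 1) + 1 with hL
  have hL0 : 0 ≤ L := by
    have := Real.log_nonneg (by linarith : (1 : ℝ) ≤ n + 1)
    linarith
  have hlow : ∑ i, ((m i : ℝ) * Real.log (m i) - m i) ≤ ∑ i, Real.log ((m i).factorial : ℝ) :=
    Finset.sum_le_sum fun i _ => log_factorial_lower _
  have hup : ∑ i, Real.log ((m i).factorial : ℝ) ≤
      ∑ i, ((m i : ℝ) * Real.log (m i) - m i + L) := by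
    refine Finset.sum_le_sum fun i _ => (log_factorial_upper _).trans ?_
    have : Real.log ((m i : ℝ) + 1) ≤ Real.log ((n : ℝ) + 1) :=
      Real.log_le_log (by positivity) (by have : (m i : ℝ) ≤ n := by exact_mod_cast hmn i
                                          linarith)
    linarith
  rw [Finset.sum_sub_distrib, hsum] at hlow
  rw [Finset.sum_add_distrib, Finset.sum_sub_distrib, hsum, Finset.sum_const, Finset.card_univ,
    nsmul_eq_mul] at hup
  have f1 := log_factorial_lower n
  have f2 := log_factorial_upper n
  have hc : 0 ≤ (Fintype.card A : ℝ) * L := by positivity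
  rw [hent, abs_le]
  constructor <;> linarith

end Counting

/-! ### Expectations over independent samples -/

/-- The expectation of `G` over `k` independent samples from the mass function `μ`. -/
def iidExp {Ω : Type*} [Fintype Ω] (μ : Ω → ℝ) (k : ℕ) (G : (Fin k → Ω) → ℝ) : ℝ :=
  ∑ ω : Fin k → Ω, (∏ i, μ (ω i)) * G ω

section Iid

variable {Ω : Type*} [Fintype Ω] {μ : Ω → ℝ} {k : ℕ}

theorem iidExp_prod (h : Fin k → Ω → ℝ) :
    iidExp μ k (fun ω => ∏ i, h i (ω i)) = ∏ i, ∑ a, μ a * h i a := by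
  classical
  rw [Finset.prod_univ_sum, Fintype.piFinset_univ]
  exact Finset.sum_congr rfl fun ω _ => by rw [Finset.prod_mul_distrib]

theorem iidExp_one (hμ : ∑ a, μ a = 1) : iidExp μ k (fun _ => 1) = 1 := by
  have := iidExp_prod (μ := μ) (k := k) (fun _ _ => 1)
  simpa [hμ] using this

theorem iidExp_eval (hμ : ∑ a, μ a = 1) (i : Fin k) (g : Ω → ℝ) :
    iidExp μ k (fun ω => g (ω i)) = ∑ a, μ a * g a := by
  classical
  have := iidExp_prod (μ := μ) (k := k) (fun j a => if j = i then g a else 1)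
  rw [Finset.prod_eq_single i (by intro j _ hj; simp [hj, hμ]) (by simp)] at this
  simpa using this

theorem iidExp_eval_mul (hμ : ∑ a, μ a = 1) {i j : Fin k} (hij : i ≠ j) (g h : Ω → ℝ) :
    iidExp μ k (fun ω => g (ω i) * h (ω j)) = (∑ a, μ a * g a) * ∑ a, μ a * h a := by
  classical
  have := iidExp_prod (μ := μ) (k := k)
    (fun l a => if l = i then g a else if l = j then h a else 1)
  rw [← Finset.mul_prod_erase _ _ (Finset.mem_univ i),
    ← Finset.mul_prod_erase (Finset.univ.erase i) _ (Finset.mem_erase.2 ⟨hij.symm, Finset.mem_univ j⟩),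
    Finset.prod_eq_one] at this
  · simp only [if_true, hij.symm, if_false, mul_one] at this
    rw [← this]
    refine (Finset.sum_congr rfl fun ω _ => ?_).symm
    congr 1
    beta_reduce
    rw [← Finset.mul_prod_erase _ _ (Finset.mem_univ i),
      ← Finset.mul_prod_erase (Finset.univ.erase i) _
        (Finset.mem_erase.2 ⟨hij.symm, Finset.mem_univ j⟩), Finset.prod_eq_one]
    · simp [hij.symm]
    · intro l hl
      simp only [Finset.mem_erase, Finset.mem_univ, and_true] at hl
      simp [hl.1, hl.2]
  · intro l hl
    simp only [Finset.mem_erase, Finset.mem_univ, and_true] at hl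
    simp [hl.1, hl.2, hμ]

theorem iidExp_mono (hμ : ∀ a, 0 ≤ μ a) {G H : (Fin k → Ω) → ℝ} (h : ∀ ω, G ω ≤ H ω) :
    iidExp μ k G ≤ iidExp μ k H :=
  Finset.sum_le_sum fun ω _ =>
    mul_le_mul_of_nonneg_left (h ω) (Finset.prod_nonneg fun _ _ => hμ _)

theorem iidExp_add (G H : (Fin k → Ω) → ℝ) :
    iidExp μ k (fun ω => G ω + H ω) = iidExp μ k G + iidExp μ k H := by
  simp only [iidExp, mul_add, Finset.sum_add_distrib]

theorem iidExp_sub (G H : (Fin k → Ω) → ℝ) :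
    iidExp μ k (fun ω => G ω - H ω) = iidExp μ k G - iidExp μ k H := by
  simp only [iidExp, mul_sub, Finset.sum_sub_distrib]

theorem iidExp_const_mul (c : ℝ) (G : (Fin k → Ω) → ℝ) :
    iidExp μ k (fun ω => c * G ω) = c * iidExp μ k G := by
  simp only [iidExp, Finset.mul_sum, mul_left_comm]

theorem iidExp_sum {ι : Type*} (s : Finset ι) (G : ι → (Fin k → Ω) → ℝ) :
    iidExp μ k (fun ω => ∑ i ∈ s, G i ω) = ∑ i ∈ s, iidExp μ k (G i) := by
  simp only [iidExp, Finset.mul_sum]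
  exact Finset.sum_comm

/-- The number of successes in `k` independent trials is at least `max 1 (m / 2)`, where `m` is
its mean, with probability at least `min 1 m / 8`. -/
theorem iidExp_count_ge (hμ0 : ∀ a, 0 ≤ μ a) (hμ : ∑ a, μ a = 1) {J : Ω → ℝ}
    (hJ : ∀ a, J a = 0 ∨ J a = 1) {m : ℝ} (hm : m = k * ∑ a, μ a * J a) :
    min 1 m / 8 ≤ iidExp μ k
      (fun ω => if max 1 (m / 2) ≤ ∑ i, J (ω i) then 1 else 0) := by
  classical
  set p := ∑ a, μ a * J a with hp
  have hp0 : 0 ≤ p := Finset.sum_nonneg fun a _ => mul_nonneg (hμ0 a)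
    (by rcases hJ a with h | h <;> simp [h])
  have hm0 : 0 ≤ m := by rw [hm]; positivity
  set EB := iidExp μ k (fun ω => if max 1 (m / 2) ≤ ∑ i, J (ω i) then 1 else 0) with hEB
  have hEN : iidExp μ k (fun ω => ∑ i, J (ω i)) = m := by
    rw [iidExp_sum, Finset.sum_congr rfl fun i _ => iidExp_eval hμ i J]
    simp [hm, hp]
  have hEN2 : iidExp μ k (fun ω => (∑ i, J (ω i)) * ∑ i, J (ω i)) ≤ m + m ^ 2 := by
    simp_rw [Finset.sum_mul_sum]
    rw [iidExp_sum]
    have h1 : ∀ i ∈ (Finset.univ : Finset (Fin k)),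
        iidExp μ k (fun ω => ∑ j, J (ω i) * J (ω j)) ≤ p + k * p ^ 2 := by
      intro i _
      rw [iidExp_sum]
      have h2 : ∀ j ∈ (Finset.univ : Finset (Fin k)), iidExp μ k (fun ω => J (ω i) * J (ω j))
          ≤ (if j = i then p else 0) + p ^ 2 := by
        intro j _
        by_cases hji : j = i
        · subst hji
          have : (fun ω : Fin k → Ω => J (ω j) * J (ω j)) = fun ω => J (ω j) := by
            funext ω; rcases hJ (ω j) with h | h <;> simp [h]
          rw [this, iidExp_eval hμ]
          simp only [if_true]
          nlinarith [sq_nonneg p]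
        · rw [iidExp_eval_mul hμ (Ne.symm hji)]
          simp [hji, sq, ← hp]
      refine (Finset.sum_le_sum h2).trans ?_
      simp [Finset.sum_add_distrib]
    refine (Finset.sum_le_sum h1).trans ?_
    simp only [Finset.sum_const, Finset.card_univ, Fintype.card_fin, nsmul_eq_mul]
    rw [hm]
    apply le_of_eq; ring
  -- A linearized Paley–Zygmund inequality: on the good event `N ≤ N² / (4(1+m)) + (1+m)` by
  -- completing the square, and off it `N ≤ m / 2`. The weight `1 / (4(1+m))` turns `E N² ≤ m + m²`
  -- into exactly `m / 4`.
  have hpt : iidExp μ k (fun ω => ∑ i, J (ω i)) ≤ iidExp μ k (fun ω => m / 2 * 1 +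
      ((1 / (4 * (1 + m))) * ((∑ i, J (ω i)) * ∑ i, J (ω i)) +
        (1 + m) * if max 1 (m / 2) ≤ ∑ i, J (ω i) then 1 else 0)) := by
    refine iidExp_mono hμ0 fun ω => ?_
    obtain ⟨N, hN⟩ : ∃ N : ℕ, ∑ i, J (ω i) = N := by
      refine ⟨∑ i, if J (ω i) = 1 then 1 else 0, ?_⟩
      push_cast
      refine Finset.sum_congr rfl fun i _ => ?_
      rcases hJ (ω i) with h | h <;> simp [h]
    rw [hN]
    have hN0 : (0 : ℝ) ≤ N := Nat.cast_nonneg N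
    split_ifs with h
    · have h3 : (N : ℝ) ≤ (1 / (4 * (1 + m))) * (N * N) + (1 + m) * 1 := by
        have : (1 / (4 * (1 + m))) * (N * N) + (1 + m) * 1 - N
            = (1 / (4 * (1 + m))) * (N - 2 * (1 + m)) ^ 2 := by field_simp; ring
        have h4 : 0 ≤ (1 / (4 * (1 + m))) * ((N : ℝ) - 2 * (1 + m)) ^ 2 := by positivity
        linarith
      linarith
    -- `N` is an integer, so `N > m / 2 ≥ 0` would already force `N ≥ 1` and put the sample in the
    -- good event.
    · have h5 : (N : ℝ) ≤ m / 2 := by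
        by_contra hc
        push Not at hc
        apply h
        refine max_le ?_ hc.le
        have : 0 < N := by
          have : (0 : ℝ) < N := by linarith
          exact_mod_cast this
        exact_mod_cast this
      have : 0 ≤ (1 / (4 * (1 + m))) * ((N : ℝ) * N) := by positivity
      linarith
  rw [iidExp_add, iidExp_add, iidExp_const_mul, iidExp_const_mul, iidExp_const_mul, hEN,
    iidExp_one hμ, ← hEB] at hpt
  have h6 : (1 / (4 * (1 + m))) * iidExp μ k (fun ω => (∑ i, J (ω i)) * ∑ i, J (ω i)) ≤ m / 4 := by
    refine (mul_le_mul_of_nonneg_left hEN2 (by positivity)).trans (le_of_eq ?_)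
    field_simp
  have h7 : m / 4 ≤ (1 + m) * EB := by linarith
  have h8 : min 1 m / 8 * (1 + m) ≤ m / 4 := by
    rcases le_total 1 m with h | h
    · rw [min_eq_left h]; linarith
    · rw [min_eq_right h]; nlinarith
  have : min 1 m / 8 * (1 + m) ≤ EB * (1 + m) := by linarith
  exact le_of_mul_le_mul_right this (by positivity)

/-- The binomial expansion cut after the cubic term. In the induction the defect is `M(M-1)(M-2) b⁴
/ 6`, which is nonnegative since the product vanishes at `M = 0, 1, 2`. -/
theorem one_sub_pow_ge {b : ℝ} (h1 : b ≤ 1) (M : ℕ) :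
    1 - M * b + M * (M - 1) / 2 * b ^ 2 - M * (M - 1) * (M - 2) / 6 * b ^ 3 ≤ (1 - b) ^ M := by
  induction M with
  | zero => simp
  | succ M ih =>
    rw [pow_succ]
    refine le_trans ?_ (mul_le_mul_of_nonneg_right ih (by linarith))
    push_cast
    have h2 : (0 : ℝ) ≤ M * (M - 1) * (M - 2) := by
      rcases M with _ | _ | _ | M
      · simp
      · simp
      · norm_num
      · push_cast
        have : (0 : ℝ) ≤ M := Nat.cast_nonneg M
        have h3 : (M : ℝ) + 1 + 1 + 1 - 1 = M + 2 := by ring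
        have h4 : (M : ℝ) + 1 + 1 + 1 - 2 = M + 1 := by ring
        rw [h3, h4]; positivity
    have h5 : 0 ≤ (M * (M - 1) * (M - 2) : ℝ) * b ^ 4 := by positivity
    nlinarith [h5]

/-- The expected number of successes beyond the first one in `k` independent trials. -/
theorem iidExp_excess_ge (hμ0 : ∀ a, 0 ≤ μ a) (hμ : ∑ a, μ a = 1) {J : Ω → ℝ}
    (hJ : ∀ a, J a = 0 ∨ J a = 1) (hk : 2 ≤ k) {x : ℝ} (hx : x = k * ∑ a, μ a * J a) :
    x * min 1 x / 12 ≤ iidExp μ k (fun ω => max 0 (∑ i, J (ω i) - 1)) := by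
  set b := ∑ a, μ a * J a with hb
  have hJ0 : ∀ a, 0 ≤ J a := fun a => by rcases hJ a with h | h <;> simp [h]
  have hJ1 : ∀ a, J a ≤ 1 := fun a => by rcases hJ a with h | h <;> simp [h]
  have hb0 : 0 ≤ b := Finset.sum_nonneg fun a _ => mul_nonneg (hμ0 a) (hJ0 a)
  have hb1 : b ≤ 1 := by
    rw [← hμ]
    exact Finset.sum_le_sum fun a _ => mul_le_of_le_one_right (hμ0 a) (hJ1 a)
  -- The product is the indicator of no success at all, the only case in which `N - 1` is negative.
  -- It makes the expectation explicit: `x - 1 + (1 - b) ^ k`.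
  have hpt : (fun ω : Fin k → Ω => max 0 (∑ i, J (ω i) - 1)) =
      fun ω => (∑ i, J (ω i) - 1) + ∏ i, (1 - J (ω i)) := by
    funext ω
    by_cases h : ∀ i, J (ω i) = 0
    · simp [h]
    · push Not at h
      obtain ⟨i, hi⟩ := h
      have hi1 : J (ω i) = 1 := (hJ _).resolve_left hi
      rw [Finset.prod_eq_zero (Finset.mem_univ i) (by rw [hi1, sub_self]), add_zero,
        max_eq_right]
      have := Finset.single_le_sum (f := fun i => J (ω i)) (fun i _ => hJ0 _) (Finset.mem_univ i)
      simp only [hi1] at this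
      linarith
  have hE : iidExp μ k (fun ω => max 0 (∑ i, J (ω i) - 1)) = x - 1 + (1 - b) ^ k := by
    rw [hpt, iidExp_add, iidExp_sub, iidExp_sum, iidExp_one hμ,
      Finset.sum_congr rfl fun i _ => iidExp_eval hμ i J,
      iidExp_prod (fun _ a => 1 - J a)]
    simp only [mul_sub, mul_one, Finset.sum_sub_distrib, hμ, Finset.prod_const, Finset.sum_const,
      Finset.card_univ, Fintype.card_fin, nsmul_eq_mul, ← hb, hx]
  rw [hE]
  have hx0 : 0 ≤ x := by rw [hx]; positivity
  have hk' : (2 : ℝ) ≤ k := by exact_mod_cast hk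
  -- For `x ≥ 2`, `x - 1` alone suffices. For `x ≤ 2`, `(k - 2) b ≤ 2`, so the cubic term eats at
  -- most two thirds of the quadratic one, leaving `k(k-1)b²/6`; this is at least `x²/12` because `k
  -- ≥ 2`.
  rcases le_total 2 x with h | h
  · have h2 : 0 ≤ (1 - b) ^ k := pow_nonneg (by linarith) _
    rw [min_eq_left (by linarith)]
    linarith
  · have h3 := one_sub_pow_ge hb1 k
    have h4 : x * min 1 x ≤ x * x := mul_le_mul_of_nonneg_left (min_le_right _ _) hx0
    have h5 : ((k : ℝ) - 2) * b ≤ 2 := by nlinarith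
    have h6 : 0 ≤ (k * (k - 1) : ℝ) * b ^ 2 * (2 - (k - 2) * b) :=
      mul_nonneg (mul_nonneg (mul_nonneg (by linarith) (by linarith)) (sq_nonneg b)) (by linarith)
    have h7 : (k : ℝ) * k ≤ 2 * (k * (k - 1)) := by nlinarith
    have h8 := mul_le_mul_of_nonneg_right h7 (sq_nonneg b)
    have h9 : x * x = k * k * b ^ 2 := by rw [hx]; ring
    nlinarith [h3, h4, h6, h8, h9]

end Iid

/-! ### Joint types and the ensemble -/

open Classical in
/-- The indicator of a proposition, as a real number. -/
def ind (p : Prop) : ℝ := if p then 1 else 0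

theorem ind_of {p : Prop} (h : p) : ind p = 1 := if_pos h
theorem ind_not {p : Prop} (h : ¬p) : ind p = 0 := if_neg h
theorem ind_eq (p : Prop) : ind p = 0 ∨ ind p = 1 := by
  by_cases h : p
  · exact Or.inr (ind_of h)
  · exact Or.inl (ind_not h)
theorem ind_nonneg (p : Prop) : 0 ≤ ind p := by rcases ind_eq p with h | h <;> simp [h]
theorem ind_le_one (p : Prop) : ind p ≤ 1 := by rcases ind_eq p with h | h <;> simp [h]
theorem ind_mono {p q : Prop} (h : p → q) : ind p ≤ ind q := by
  by_cases hp : p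
  · rw [ind_of hp, ind_of (h hp)]
  · rw [ind_not hp]; exact ind_nonneg q

section UniformMass

variable {A : Type*} [Fintype A] {T : Set A}

theorem uniformMass_nonneg (T : Set A) (a : A) : 0 ≤ uniformMass T a :=
  Set.indicator_nonneg (fun _ _ => by positivity) a

theorem mem_of_uniformMass_ne_zero {a : A} (h : uniformMass T a ≠ 0) : a ∈ T := by
  by_contra hc
  exact h (Set.indicator_of_notMem hc _)

theorem sum_uniformMass_mul_ind (p : A → Prop) :
    ∑ a, uniformMass T a * ind (p a) = {a ∈ T | p a}.ncard / T.ncard := by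
  classical
  have h : ∀ a, uniformMass T a * ind (p a)
      = if a ∈ ({a ∈ T | p a} : Set A).toFinset then (T.ncard : ℝ)⁻¹ else 0 := by
    intro a
    rw [uniformMass, Set.indicator_apply, ind]
    by_cases h1 : a ∈ T <;> by_cases h2 : p a <;> simp [h1, h2]
  rw [Finset.sum_congr rfl fun a _ => h a, Finset.sum_ite_mem, Finset.univ_inter,
    Finset.sum_const, nsmul_eq_mul, Set.ncard_eq_toFinset_card' {a ∈ T | p a}, div_eq_mul_inv]

theorem sum_uniformMass (hT : T.Nonempty) : ∑ a, uniformMass T a = 1 := by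
  have h := sum_uniformMass_mul_ind (T := T) (fun _ => True)
  simp only [ind_of trivial, mul_one, and_true, Set.ofPred_mem_eq] at h
  rw [h, div_self]
  exact_mod_cast ((Set.ncard_pos (Set.toFinite _)).2 hT).ne'

end UniformMass

variable {U X Y : Type*}

/-- A joint distribution as a function on the product. -/
def unc (Q : U → X → Y → ℝ) (p : U × X × Y) : ℝ := Q p.1 p.2.1 p.2.2

/-- The marginal `Q_{UX}`. -/
def mUX [Fintype Y] (Q : U → X → Y → ℝ) (p : U × X) : ℝ := ∑ y, Q p.1 p.2 y

/-- The marginal `Q_{UY}` as a function on the product. -/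
def mUY [Fintype X] (Q : U → X → Y → ℝ) (p : U × Y) : ℝ := margUY Q p.1 p.2

/-- The sequence of symbol triples. -/
def seq₃ {n : ℕ} (u : Fin n → U) (x : Fin n → X) (y : Fin n → Y) : Fin n → U × X × Y :=
  fun t => (u t, x t, y t)

/-- The sequence of symbol pairs. -/
def seq₂ {n : ℕ} (u : Fin n → U) (y : Fin n → Y) : Fin n → U × Y := fun t => (u t, y t)

/-! ### Marginals as sums over the fibers of symbolwise projections. -/

section Marginals

variable [Fintype U] [Fintype X] [Fintype Y] [DecidableEq U] [DecidableEq X] [DecidableEq Y]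

theorem sum_fiber_UY (Q : U → X → Y → ℝ) (b : U × Y) :
    mUY Q b = ∑ a : U × X × Y with (a.1, a.2.2) = b, unc Q a := by
  obtain ⟨u, y⟩ := b
  rw [Finset.sum_filter, Fintype.sum_prod_type, Finset.sum_eq_single u]
  · rw [Fintype.sum_prod_type]
    simp [mUY, margUY, unc]
  · intro v _ hv
    simp [hv]
  · simp

theorem sum_fiber_UX (Q : U → X → Y → ℝ) (b : U × X) :
    mUX Q b = ∑ a : U × X × Y with (a.1, a.2.1) = b, unc Q a := by
  obtain ⟨u, x⟩ := b
  rw [Finset.sum_filter, Fintype.sum_prod_type, Finset.sum_eq_single u]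
  · rw [Fintype.sum_prod_type, Finset.sum_eq_single x]
    · simp [mUX, unc]
    · intro v _ hv
      simp [hv]
    · simp
  · intro v _ hv
    simp [hv]
  · simp

theorem sum_fiber_fst (P : U × X → ℝ) (b : U) :
    margU P b = ∑ a : U × X with a.1 = b, P a := by
  rw [Finset.sum_filter, Fintype.sum_prod_type, Finset.sum_eq_single b]
  · simp [margU]
  · intro v _ hv
    simp [hv]
  · simp

theorem sum_fiber_Y (Q : U → X → Y → ℝ) (b : Y) :
    margY Q b = ∑ a : U × Y with a.2 = b, mUY Q a := by
  rw [Finset.sum_filter, Fintype.sum_prod_type]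
  simp [margY, mUY, margUY]

theorem margU_mUX_eq (Q : U → X → Y → ℝ) (b : U) :
    margU (mUX Q) b = ∑ a : U × Y with a.1 = b, mUY Q a := by
  rw [Finset.sum_filter, Fintype.sum_prod_type, Finset.sum_eq_single b]
  · simp only [margU, mUX, mUY, margUY, if_true]
    exact Finset.sum_comm
  · intro v _ hv
    simp [hv]
  · simp

end Marginals

/-! ### Exact probabilities of joint types in the ensemble. -/

section Counting

variable [Fintype U] [Fintype X] [Fintype Y] [DecidableEq U] [DecidableEq X] [DecidableEq Y]
  {n M₂ : ℕ} {Q : U → X → Y → ℝ} {P : U × X → ℝ}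

theorem seq₂_mem_of_seq₃_mem {u : Fin n → U} {x : Fin n → X} {y : Fin n → Y}
    (h : seq₃ u x y ∈ typeClass n (unc Q)) : seq₂ u y ∈ typeClass n (mUY Q) :=
  comp_mem_typeClass (fun a : U × X × Y => (a.1, a.2.2)) (sum_fiber_UY Q) h

theorem seqUX_mem_of_seq₃_mem {u : Fin n → U} {x : Fin n → X} {y : Fin n → Y}
    (h : seq₃ u x y ∈ typeClass n (unc Q)) : x ∈ condTypeClass (mUX Q) u :=
  comp_mem_typeClass (fun a : U × X × Y => (a.1, a.2.1)) (sum_fiber_UX Q) h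

theorem mem_margY_of_seq₂_mem {u : Fin n → U} {y : Fin n → Y}
    (h : seq₂ u y ∈ typeClass n (mUY Q)) : y ∈ typeClass n (margY Q) :=
  comp_mem_typeClass (fun a : U × Y => a.2) (sum_fiber_Y Q) h

theorem mem_margU_of_seq₂_mem {u : Fin n → U} {y : Fin n → Y}
    (h : seq₂ u y ∈ typeClass n (mUY Q)) : u ∈ typeClass n (margU (mUX Q)) :=
  comp_mem_typeClass (fun a : U × Y => a.1) (margU_mUX_eq Q) h

theorem ncard_pos_of_mem {A : Type*} [Finite A] {T : Set A} {a : A} (h : a ∈ T) :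
    (0 : ℝ) < T.ncard := by
  exact_mod_cast (Set.ncard_pos (Set.toFinite _)).2 ⟨a, h⟩

/-- The size of a conditional type class. -/
theorem ncard_condTypeClass {u : Fin n → U} (hu : u ∈ typeClass n (margU P)) :
    ((condTypeClass P u).ncard : ℝ) * (typeClass n (margU P)).ncard = (typeClass n P).ncard := by
  have h := ncard_fiber_mul (fun a : U × X => a.1) (sum_fiber_fst P) hu
  rw [← h]
  push_cast
  congr 2
  refine Set.ncard_congr (fun x _ t => (u t, x t)) ?_ ?_ ?_
  · intro x hx
    exact ⟨hx, rfl⟩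
  · intro x x' _ _ h
    funext t
    exact congrArg Prod.snd (congrFun h t)
  · rintro a ⟨ha, rfl⟩
    exact ⟨fun t => (a t).2, ha, rfl⟩

theorem condTypeClass_nonempty (hP : (typeClass n P).Nonempty) {u : Fin n → U}
    (hu : u ∈ typeClass n (margU P)) : (condTypeClass P u).Nonempty := by
  have h := ncard_condTypeClass hu
  have h0 : (0 : ℝ) < (typeClass n P).ncard := ncard_pos_of_mem hP.some_mem
  rw [← h] at h0
  have : (condTypeClass P u).ncard ≠ 0 := fun hc => by simp [hc] at h0
  exact Set.nonempty_of_ncard_ne_zero this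

theorem margU_nonempty (hP : (typeClass n P).Nonempty) : (typeClass n (margU P)).Nonempty :=
  ⟨_, comp_mem_typeClass (fun a : U × X => a.1) (sum_fiber_fst P) hP.some_mem⟩

/-- The probability that a cloud center has a given joint type with `y`. -/
theorem sum_uniformMass_center {y : Fin n → Y} (hy : y ∈ typeClass n (margY Q)) :
    ∑ u, uniformMass (typeClass n (margU (mUX Q))) u * ind (seq₂ u y ∈ typeClass n (mUY Q))
      = (typeClass n (mUY Q)).ncard /
        ((typeClass n (margY Q)).ncard * (typeClass n (margU (mUX Q))).ncard) := by
  rw [sum_uniformMass_mul_ind]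
  have h := ncard_fiber_mul (fun a : U × Y => a.2) (sum_fiber_Y Q) hy
  have h0 : (0 : ℝ) < (typeClass n (margY Q)).ncard := ncard_pos_of_mem hy
  rw [← h, ← div_div]
  push_cast
  rw [mul_div_cancel_right₀ _ h0.ne']
  congr 2
  refine Set.ncard_congr (fun u _ => seq₂ u y) ?_ ?_ ?_
  · intro u hu
    exact ⟨hu.2, rfl⟩
  · intro x x' _ _ h
    funext t
    exact congrArg Prod.fst (congrFun h t)
  · rintro a ⟨ha, rfl⟩
    exact ⟨fun t => (a t).1, ⟨mem_margU_of_seq₂_mem ha, ha⟩, rfl⟩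

/-- The probability that a codeword has a given joint type with its cloud center and `y`. -/
theorem sum_uniformMass_codeword {u : Fin n → U} {y : Fin n → Y}
    (hu : seq₂ u y ∈ typeClass n (mUY Q)) :
    ∑ x, uniformMass (condTypeClass (mUX Q) u) x * ind (seq₃ u x y ∈ typeClass n (unc Q))
      = (typeClass n (unc Q)).ncard * (typeClass n (margU (mUX Q))).ncard /
        ((typeClass n (mUY Q)).ncard * (typeClass n (mUX Q)).ncard) := by
  rw [sum_uniformMass_mul_ind]
  have h := ncard_fiber_mul (fun a : U × X × Y => (a.1, a.2.2)) (sum_fiber_UY Q) hu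
  have h1 := ncard_condTypeClass (mem_margU_of_seq₂_mem hu)
  have h0 : (0 : ℝ) < (typeClass n (mUY Q)).ncard := ncard_pos_of_mem hu
  have h2 : (0 : ℝ) < (typeClass n (margU (mUX Q))).ncard :=
    ncard_pos_of_mem (mem_margU_of_seq₂_mem hu)
  have h3 : {x ∈ condTypeClass (mUX Q) u | seq₃ u x y ∈ typeClass n (unc Q)}.ncard
      = {a ∈ typeClass n (unc Q) | (fun a : U × X × Y => (a.1, a.2.2)) ∘ a = seq₂ u y}.ncard := by
    refine Set.ncard_congr (fun x _ => seq₃ u x y) ?_ ?_ ?_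
    · intro x hx
      exact ⟨hx.2, rfl⟩
    · intro x x' _ _ h
      funext t
      exact congrArg (fun a => a.2.1) (congrFun h t)
    · rintro a ⟨ha, hb⟩
      have hau : seq₃ u (fun t => (a t).2.1) y = a := by
        funext t
        have h4 := congrFun hb t
        simp only [Function.comp, seq₂, Prod.mk.injEq] at h4
        simp only [seq₃, ← h4.1, ← h4.2]
      refine ⟨fun t => (a t).2.1, ⟨seqUX_mem_of_seq₃_mem (y := y) ?_, ?_⟩, hau⟩
      · rw [hau]; exact ha
      · rw [hau]; exact ha
  rw [h3, ← h, ← h1]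
  push_cast
  by_cases h5 : ((condTypeClass (mUX Q) u).ncard : ℝ) = 0
  · simp [h5]
  · field_simp

/-- The distribution of a bin: of its cloud center and its codewords. -/
def binMass (n M₂ : ℕ) (P : U × X → ℝ) (ω : (Fin n → U) × (Fin M₂ → Fin n → X)) : ℝ :=
  uniformMass (typeClass n (margU P)) ω.1 * ∏ j, uniformMass (condTypeClass P ω.1) (ω.2 j)

theorem binMass_nonneg (ω : (Fin n → U) × (Fin M₂ → Fin n → X)) : 0 ≤ binMass n M₂ P ω :=
  mul_nonneg (uniformMass_nonneg _ _) (Finset.prod_nonneg fun _ _ => uniformMass_nonneg _ _)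

theorem sum_binMass_mul (G : (Fin n → U) × (Fin M₂ → Fin n → X) → ℝ) :
    ∑ ω, binMass n M₂ P ω * G ω = ∑ u, uniformMass (typeClass n (margU P)) u *
      iidExp (uniformMass (condTypeClass P u)) M₂ (fun x => G (u, x)) := by
  rw [Fintype.sum_prod_type]
  refine Finset.sum_congr rfl fun u _ => ?_
  rw [iidExp, Finset.mul_sum]
  exact Finset.sum_congr rfl fun x _ => by rw [binMass, mul_assoc]

theorem sum_binMass_center (hP : (typeClass n P).Nonempty) (g : (Fin n → U) → ℝ) :
    ∑ ω, binMass n M₂ P ω * g ω.1 = ∑ u, uniformMass (typeClass n (margU P)) u * g u := by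
  rw [sum_binMass_mul]
  refine Finset.sum_congr rfl fun u _ => ?_
  by_cases hu : uniformMass (typeClass n (margU P)) u = 0
  · simp [hu]
  have h1 := iidExp_one (k := M₂)
    (sum_uniformMass (condTypeClass_nonempty hP (mem_of_uniformMass_ne_zero hu)))
  have h2 := iidExp_const_mul (μ := uniformMass (condTypeClass P u)) (k := M₂) (g u) (fun _ => 1)
  rw [h1] at h2
  simp only [mul_one] at h2
  rw [h2]

theorem sum_binMass (hP : (typeClass n P).Nonempty) : ∑ ω, binMass n M₂ P ω = 1 := by
  have h := sum_binMass_center (M₂ := M₂) hP (fun _ => 1)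
  simp only [mul_one] at h
  rw [h, sum_uniformMass (margU_nonempty hP)]

theorem sum_binMass_codeword (hP : (typeClass n P).Nonempty) (j : Fin M₂)
    (g : (Fin n → U) → (Fin n → X) → ℝ) :
    ∑ ω, binMass n M₂ P ω * g ω.1 (ω.2 j) = ∑ u, uniformMass (typeClass n (margU P)) u *
      ∑ x, uniformMass (condTypeClass P u) x * g u x := by
  rw [sum_binMass_mul]
  refine Finset.sum_congr rfl fun u _ => ?_
  by_cases hu : uniformMass (typeClass n (margU P)) u = 0
  · simp [hu]
  rw [iidExp_eval
    (sum_uniformMass (condTypeClass_nonempty hP (mem_of_uniformMass_ne_zero hu))) j (g u)]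

theorem sum_binMass_center_type (hP : (typeClass n (mUX Q)).Nonempty) {y : Fin n → Y}
    (hy : y ∈ typeClass n (margY Q)) :
    ∑ ω, binMass n M₂ (mUX Q) ω * ind (seq₂ ω.1 y ∈ typeClass n (mUY Q))
      = (typeClass n (mUY Q)).ncard /
        ((typeClass n (margY Q)).ncard * (typeClass n (margU (mUX Q))).ncard) := by
  rw [sum_binMass_center hP fun u => ind (seq₂ u y ∈ typeClass n (mUY Q)),
    sum_uniformMass_center hy]

/-- The codeword can have joint type `Q` only if its center has joint type `mUY Q` with `y`; the
conditional probability is the same for all such centers, so the two probabilities multiply and the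
sizes of the intermediate classes cancel. -/
theorem sum_binMass_codeword_type (hQ : (typeClass n (unc Q)).Nonempty) {y : Fin n → Y}
    (hy : y ∈ typeClass n (margY Q)) (j : Fin M₂) :
    ∑ ω, binMass n M₂ (mUX Q) ω * ind (seq₃ ω.1 (ω.2 j) y ∈ typeClass n (unc Q))
      = (typeClass n (unc Q)).ncard /
        ((typeClass n (margY Q)).ncard * (typeClass n (mUX Q)).ncard) := by
  obtain ⟨a, ha⟩ := hQ
  have hux : (fun t => ((a t).1, (a t).2.1)) ∈ typeClass n (mUX Q) :=
    comp_mem_typeClass (fun a : U × X × Y => (a.1, a.2.1)) (sum_fiber_UX Q) ha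
  have huy : seq₂ (fun t => (a t).1) (fun t => (a t).2.2) ∈ typeClass n (mUY Q) :=
    comp_mem_typeClass (fun a : U × X × Y => (a.1, a.2.2)) (sum_fiber_UY Q) ha
  have h1 : (0 : ℝ) < (typeClass n (mUY Q)).ncard := ncard_pos_of_mem huy
  have h2 : (0 : ℝ) < (typeClass n (margU (mUX Q))).ncard :=
    ncard_pos_of_mem (mem_margU_of_seq₂_mem huy)
  rw [sum_binMass_codeword ⟨_, hux⟩ j fun u x => ind (seq₃ u x y ∈ typeClass n (unc Q))]
  have h3 : ∀ u, uniformMass (typeClass n (margU (mUX Q))) u *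
      ∑ x, uniformMass (condTypeClass (mUX Q) u) x * ind (seq₃ u x y ∈ typeClass n (unc Q))
      = (uniformMass (typeClass n (margU (mUX Q))) u * ind (seq₂ u y ∈ typeClass n (mUY Q))) *
        ((typeClass n (unc Q)).ncard * (typeClass n (margU (mUX Q))).ncard /
        ((typeClass n (mUY Q)).ncard * (typeClass n (mUX Q)).ncard)) := by
    intro u
    by_cases hu : seq₂ u y ∈ typeClass n (mUY Q)
    · rw [sum_uniformMass_codeword hu, ind_of hu, mul_one]
    · rw [ind_not hu, mul_zero, zero_mul, Finset.sum_eq_zero, mul_zero]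
      intro x _
      rw [ind_not fun h => hu (seq₂_mem_of_seq₃_mem h), mul_zero]
  rw [Finset.sum_congr rfl fun u _ => h3 u, ← Finset.sum_mul, sum_uniformMass_center hy]
  field_simp

/-- The error probability as an expectation over independent bins. -/
theorem errorProb_eq_iidExp (P : U × X → ℝ) (W : X → Y → ℝ) {M : ℕ}
    (dec : (Fin M → Fin M₂ → Fin n → X) → (Fin n → Y) → Fin M) :
    errorProb P W dec = iidExp (binMass n M₂ P) M (fun ω => ((M : ℝ) * (M₂ : ℝ))⁻¹ *
      ∑ w : Fin M, ∑ j : Fin M₂, ∑ y : Fin n → Y, chan W ((ω w).2 j) y *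
        (if dec (fun w => (ω w).2) y = w then 0 else 1)) := by
  rw [errorProb, iidExp, ← (Equiv.arrowProdEquivProdArrow (Fin M) (fun _ => Fin n → U)
    (fun _ => Fin M₂ → Fin n → X)).symm.sum_comp, Fintype.sum_prod_type]
  rfl

end Counting

/-! ### The exponent of the ensemble as a function of joint types -/

section Exponents

variable {U X Y : Type*} [Fintype U] [Fintype X] [Fintype Y]

/-- `I(U;Y)` in terms of entropies. -/
def iU (Q : U → X → Y → ℝ) : ℝ := ent (margU (mUX Q)) + ent (margY Q) - ent (mUY Q)

/-- `I(X;Y|U)` in terms of entropies. -/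
def iX (Q : U → X → Y → ℝ) : ℝ := ent (mUX Q) + ent (mUY Q) - ent (unc Q) - ent (margU (mUX Q))

/-- The normalized log-likelihood of a joint type. -/
def logLik (W : X → Y → ℝ) (Q : U → X → Y → ℝ) : ℝ := ∑ p : U × X × Y, unc Q p * Real.log (W p.2.1 p.2.2)

/-- The divergence of a joint type from the channel. -/
def divg (W : X → Y → ℝ) (Q : U → X → Y → ℝ) : ℝ := ent (mUX Q) - ent (unc Q) - logLik W Q

/-- The exponent of the probability that a bin contains a codeword of a given joint type with
its cloud center and the channel output. -/
def cost (R₂ : ℝ) (Q : U → X → Y → ℝ) : ℝ := iU Q + max 0 (iX Q - R₂)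

/-- The exponent of the errors caused by a joint type. -/
def typeExp (W : X → Y → ℝ) (R R₂ : ℝ) (Q : U → X → Y → ℝ) : ℝ :=
  divg W Q + max 0 (cost R₂ Q - R)

/-- Joint distributions that are absolutely continuous with respect to the channel. -/
def Supp (W : X → Y → ℝ) (Q : U → X → Y → ℝ) : Prop := ∀ u x y, W x y = 0 → Q u x y = 0

end Exponents

/-! ### Exponential estimates of type class sizes, and the likelihood as a function of the joint
type. -/

section Bounds

variable {U X Y : Type*} [Fintype U] [Fintype X] [Fintype Y]
  [DecidableEq U] [DecidableEq X] [DecidableEq Y]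
  {n M₂ : ℕ} {Q : U → X → Y → ℝ} {P : U × X → ℝ} {W : X → Y → ℝ}

/-- The logarithm of the polynomial factors. -/
def slack (U X Y : Type*) [Fintype U] [Fintype X] [Fintype Y] (n : ℕ) : ℝ :=
  ((Fintype.card U + 1) * (Fintype.card X + 1) * (Fintype.card Y + 1)) * (Real.log (n + 1) + 1)

theorem log_add_one_nonneg (n : ℕ) : 0 ≤ Real.log ((n : ℝ) + 1) :=
  Real.log_nonneg (by linarith [Nat.cast_nonneg (α := ℝ) n])

theorem card_mul_le_slack {A : Type*} [Fintype A] (h : Fintype.card A + 1 ≤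
    (Fintype.card U + 1) * (Fintype.card X + 1) * (Fintype.card Y + 1)) (n : ℕ) :
    (Fintype.card A + 1) * (Real.log (n + 1) + 1) ≤ slack U X Y n := by
  refine mul_le_mul_of_nonneg_right (by exact_mod_cast h) ?_
  linarith [log_add_one_nonneg n]

theorem slack_nonneg (n : ℕ) : 0 ≤ slack U X Y n := by
  have := log_add_one_nonneg n
  unfold slack
  positivity

/-- One `slack` serves for every marginal alphabet, so that the errors in ratios of class sizes just
add up. -/
theorem ncard_bounds {A : Type*} [Fintype A] [DecidableEq A] (hn : 0 < n) {P : A → ℝ}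
    (hne : (typeClass n P).Nonempty) (h : Fintype.card A + 1 ≤
    (Fintype.card U + 1) * (Fintype.card X + 1) * (Fintype.card Y + 1)) :
    Real.exp (n * ent P - slack U X Y n) ≤ (typeClass n P).ncard ∧
      ((typeClass n P).ncard : ℝ) ≤ Real.exp (n * ent P + slack U X Y n) := by
  have h1 := abs_le.1 ((log_ncard_typeClass hn hne).trans (card_mul_le_slack h n))
  have h0 : (0 : ℝ) < (typeClass n P).ncard := ncard_pos_of_mem hne.some_mem
  constructor
  · rw [← Real.le_log_iff_exp_le h0]; linarith
  · rw [← Real.log_le_iff_le_exp h0]; linarith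

theorem card_prod₃_le : Fintype.card (U × X × Y) + 1 ≤
    (Fintype.card U + 1) * (Fintype.card X + 1) * (Fintype.card Y + 1) := by
  simp only [Fintype.card_prod]; ring_nf; omega

theorem card_UX_le : Fintype.card (U × X) + 1 ≤
    (Fintype.card U + 1) * (Fintype.card X + 1) * (Fintype.card Y + 1) := by
  simp only [Fintype.card_prod]; ring_nf; omega

theorem card_UY_le : Fintype.card (U × Y) + 1 ≤
    (Fintype.card U + 1) * (Fintype.card X + 1) * (Fintype.card Y + 1) := by
  simp only [Fintype.card_prod]; ring_nf; omega

theorem card_U_le : Fintype.card U + 1 ≤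
    (Fintype.card U + 1) * (Fintype.card X + 1) * (Fintype.card Y + 1) := by
  ring_nf; omega

theorem card_Y_le : Fintype.card Y + 1 ≤
    (Fintype.card U + 1) * (Fintype.card X + 1) * (Fintype.card Y + 1) := by
  ring_nf; omega

theorem mUX_nonempty (hQ : (typeClass n (unc Q)).Nonempty) : (typeClass n (mUX Q)).Nonempty :=
  ⟨_, comp_mem_typeClass (fun a : U × X × Y => (a.1, a.2.1)) (sum_fiber_UX Q) hQ.some_mem⟩

theorem mUY_nonempty (hQ : (typeClass n (unc Q)).Nonempty) : (typeClass n (mUY Q)).Nonempty :=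
  ⟨_, comp_mem_typeClass (fun a : U × X × Y => (a.1, a.2.2)) (sum_fiber_UY Q) hQ.some_mem⟩

theorem margY_nonempty (hQ : (typeClass n (unc Q)).Nonempty) :
    (typeClass n (margY Q)).Nonempty :=
  ⟨_, comp_mem_typeClass (fun a : U × Y => a.2) (sum_fiber_Y Q) (mUY_nonempty hQ).some_mem⟩

theorem le_exp_mul {a b c A B C : ℝ} (ha : a ≤ Real.exp A) (hb : Real.exp B ≤ b)
    (hc : Real.exp C ≤ c) : a ≤ Real.exp (A - B - C) * (b * c) := by
  have h1 : Real.exp (A - B - C) * (Real.exp B * Real.exp C) = Real.exp A := by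
    rw [← Real.exp_add, ← Real.exp_add]; ring_nf
  calc a ≤ Real.exp A := ha
    _ = Real.exp (A - B - C) * (Real.exp B * Real.exp C) := h1.symm
    _ ≤ _ := mul_le_mul_of_nonneg_left
      (mul_le_mul hb hc (Real.exp_pos C).le ((Real.exp_pos B).le.trans hb)) (Real.exp_pos _).le

theorem exp_mul_le {b c d A B C : ℝ} (ha : Real.exp A ≤ d) (hb0 : 0 ≤ b) (hb : b ≤ Real.exp B)
    (hc : c ≤ Real.exp C) : Real.exp (A - B - C) * (b * c) ≤ d := by
  have h1 : Real.exp (A - B - C) * (Real.exp B * Real.exp C) = Real.exp A := by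
    rw [← Real.exp_add, ← Real.exp_add]; ring_nf
  calc Real.exp (A - B - C) * (b * c) ≤ Real.exp (A - B - C) * (Real.exp B * Real.exp C) :=
        mul_le_mul_of_nonneg_left ((mul_le_mul_of_nonneg_left hc hb0).trans
          (mul_le_mul_of_nonneg_right hb (Real.exp_pos C).le)) (Real.exp_pos _).le
    _ = _ := h1
    _ ≤ d := ha

/-- The ratio counts the outputs of joint type `Q` with a given center and codeword; times the
common likelihood `exp (n * logLik W Q)` it yields the exponent `divg`. -/
theorem ratio_le (hn : 0 < n) (hQ : (typeClass n (unc Q)).Nonempty) :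
    ((typeClass n (unc Q)).ncard : ℝ) / (typeClass n (mUX Q)).ncard ≤
      Real.exp (n * (ent (unc Q) - ent (mUX Q)) + 2 * slack U X Y n) := by
  have h1 := (ncard_bounds hn hQ card_prod₃_le (X := X) (U := U) (Y := Y)).2
  have h2 := (ncard_bounds hn (mUX_nonempty hQ) card_UX_le (X := X) (U := U) (Y := Y)).1
  rw [div_le_iff₀ (ncard_pos_of_mem (mUX_nonempty hQ).some_mem)]
  have h3 := le_exp_mul h1 h2 (c := 1) (C := 0) (by simp)
  rw [mul_one] at h3
  refine h3.trans (le_of_eq ?_)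
  congr 2; ring

theorem ratio_ge (hn : 0 < n) (hQ : (typeClass n (unc Q)).Nonempty) :
    Real.exp (n * (ent (unc Q) - ent (mUX Q)) - 2 * slack U X Y n) ≤
      ((typeClass n (unc Q)).ncard : ℝ) / (typeClass n (mUX Q)).ncard := by
  have h1 := (ncard_bounds hn hQ card_prod₃_le (X := X) (U := U) (Y := Y)).1
  have h2 := (ncard_bounds hn (mUX_nonempty hQ) card_UX_le (X := X) (U := U) (Y := Y)).2
  rw [le_div_iff₀ (ncard_pos_of_mem (mUX_nonempty hQ).some_mem)]
  have h3 := exp_mul_le h1 (Nat.cast_nonneg _) h2 (c := 1) (C := 0) (by simp)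
  rw [mul_one] at h3
  refine (le_of_eq ?_).trans h3
  congr 2; ring

/-- The exponent of the probability in `sum_uniformMass_center`. -/
theorem center_le (hn : 0 < n) (hQ : (typeClass n (unc Q)).Nonempty) :
    ((typeClass n (mUY Q)).ncard : ℝ) /
      ((typeClass n (margY Q)).ncard * (typeClass n (margU (mUX Q))).ncard) ≤
      Real.exp (-(n * iU Q) + 3 * slack U X Y n) := by
  have hU := margU_nonempty (mUX_nonempty hQ)
  have h1 := (ncard_bounds hn (mUY_nonempty hQ) card_UY_le (X := X) (U := U) (Y := Y)).2
  have h2 := (ncard_bounds hn (margY_nonempty hQ) card_Y_le (X := X) (U := U) (Y := Y)).1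
  have h3 := (ncard_bounds hn hU card_U_le (X := X) (U := U) (Y := Y)).1
  rw [div_le_iff₀ (mul_pos (ncard_pos_of_mem (margY_nonempty hQ).some_mem)
    (ncard_pos_of_mem hU.some_mem))]
  refine (le_exp_mul h1 h2 h3).trans (le_of_eq ?_)
  congr 2; rw [iU]; ring

theorem center_ge (hn : 0 < n) (hQ : (typeClass n (unc Q)).Nonempty) :
    Real.exp (-(n * iU Q) - 3 * slack U X Y n) ≤ ((typeClass n (mUY Q)).ncard : ℝ) /
      ((typeClass n (margY Q)).ncard * (typeClass n (margU (mUX Q))).ncard) := by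
  have hU := margU_nonempty (mUX_nonempty hQ)
  have h1 := (ncard_bounds hn (mUY_nonempty hQ) card_UY_le (X := X) (U := U) (Y := Y)).1
  have h2 := (ncard_bounds hn (margY_nonempty hQ) card_Y_le (X := X) (U := U) (Y := Y)).2
  have h3 := (ncard_bounds hn hU card_U_le (X := X) (U := U) (Y := Y)).2
  rw [le_div_iff₀ (mul_pos (ncard_pos_of_mem (margY_nonempty hQ).some_mem)
    (ncard_pos_of_mem hU.some_mem))]
  refine (le_of_eq ?_).trans (exp_mul_le h1 (Nat.cast_nonneg _) h2 h3)
  congr 2; rw [iU]; ring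

/-- The exponent of the probability in `sum_binMass_codeword_type`; `iU + iX` is `I(U,X;Y)`. -/
theorem joint_le (hn : 0 < n) (hQ : (typeClass n (unc Q)).Nonempty) :
    ((typeClass n (unc Q)).ncard : ℝ) /
      ((typeClass n (margY Q)).ncard * (typeClass n (mUX Q)).ncard) ≤
      Real.exp (-(n * (iU Q + iX Q)) + 3 * slack U X Y n) := by
  have h1 := (ncard_bounds hn hQ card_prod₃_le (X := X) (U := U) (Y := Y)).2
  have h2 := (ncard_bounds hn (margY_nonempty hQ) card_Y_le (X := X) (U := U) (Y := Y)).1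
  have h3 := (ncard_bounds hn (mUX_nonempty hQ) card_UX_le (X := X) (U := U) (Y := Y)).1
  rw [div_le_iff₀ (mul_pos (ncard_pos_of_mem (margY_nonempty hQ).some_mem)
    (ncard_pos_of_mem (mUX_nonempty hQ).some_mem))]
  refine (le_exp_mul h1 h2 h3).trans (le_of_eq ?_)
  congr 2; rw [iU, iX]; ring

theorem joint_ge (hn : 0 < n) (hQ : (typeClass n (unc Q)).Nonempty) :
    Real.exp (-(n * (iU Q + iX Q)) - 3 * slack U X Y n) ≤ ((typeClass n (unc Q)).ncard : ℝ) /
      ((typeClass n (margY Q)).ncard * (typeClass n (mUX Q)).ncard) := by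
  have h1 := (ncard_bounds hn hQ card_prod₃_le (X := X) (U := U) (Y := Y)).1
  have h2 := (ncard_bounds hn (margY_nonempty hQ) card_Y_le (X := X) (U := U) (Y := Y)).2
  have h3 := (ncard_bounds hn (mUX_nonempty hQ) card_UX_le (X := X) (U := U) (Y := Y)).2
  rw [le_div_iff₀ (mul_pos (ncard_pos_of_mem (margY_nonempty hQ).some_mem)
    (ncard_pos_of_mem (mUX_nonempty hQ).some_mem))]
  refine (le_of_eq ?_).trans (exp_mul_le h1 (Nat.cast_nonneg _) h2 h3)
  congr 2; rw [iU, iX]; ring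

theorem sum_comp_of_mem_typeClass {A : Type*} [Fintype A] [DecidableEq A] {P : A → ℝ}
    {a : Fin n → A} (ha : a ∈ typeClass n P) (g : A → ℝ) :
    ∑ t, g (a t) = n * ∑ i, P i * g i := by
  rw [Finset.sum_comp g a, Finset.mul_sum]
  have h : ∀ i, n * (P i * g i) = (Finset.univ.filter (fun t => a t = i)).card • g i := by
    intro i
    rw [nsmul_eq_mul, ha i, mul_assoc]
  rw [Finset.sum_congr rfl fun i _ => h i]
  refine Finset.sum_subset (Finset.subset_univ _) fun i _ hi => ?_
  have : Finset.univ.filter (fun t => a t = i) = ∅ := by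
    ext t
    simp only [Finset.mem_image, Finset.mem_univ, true_and, not_exists] at hi
    simpa using hi t
  simp [this]

theorem chan_nonneg (hW : ∀ x y, 0 ≤ W x y) (x : Fin n → X) (y : Fin n → Y) : 0 ≤ chan W x y :=
  Finset.prod_nonneg fun _ _ => hW _ _

theorem supp_of_chan_ne_zero (hn : 0 < n) {u : Fin n → U} {x : Fin n → X} {y : Fin n → Y}
    (h : seq₃ u x y ∈ typeClass n (unc Q)) (hc : chan W x y ≠ 0) : Supp W Q := by
  intro i j k hW
  have h1 := h (i, j, k)
  have h2 : Finset.univ.filter (fun t => seq₃ u x y t = (i, j, k)) = ∅ := by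
    ext t
    simp only [Finset.mem_filter, Finset.mem_univ, true_and, Finset.notMem_empty, iff_false]
    intro ht
    simp only [seq₃, Prod.mk.injEq] at ht
    refine hc (Finset.prod_eq_zero (Finset.mem_univ t) ?_)
    rw [ht.2.1, ht.2.2, hW]
  rw [h2] at h1
  have hn' : (n : ℝ) ≠ 0 := by exact_mod_cast hn.ne'
  simpa [hn', unc] using h1

/-- `Supp` rules out zero transition probabilities along the sequences, where `Real.log 0 = 0` would
falsify the exponential form. -/
theorem chan_eq_exp (hW : ∀ x y, 0 ≤ W x y) {u : Fin n → U} {x : Fin n → X}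
    {y : Fin n → Y} (h : seq₃ u x y ∈ typeClass n (unc Q)) (hs : Supp W Q) :
    chan W x y = Real.exp (n * logLik W Q) := by
  have h1 : ∀ t, 0 < W (x t) (y t) := by
    intro t
    refine lt_of_le_of_ne (hW _ _) fun h0 => ?_
    have h2 := h (u t, x t, y t)
    simp only [unc, hs _ _ _ h0.symm, mul_zero, Nat.cast_eq_zero, Finset.card_eq_zero] at h2
    have : t ∈ Finset.univ.filter (fun s => seq₃ u x y s = (u t, x t, y t)) := by simp [seq₃]
    rw [h2] at this
    simp at this
  have h2 := sum_comp_of_mem_typeClass h (fun p => Real.log (W p.2.1 p.2.2))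
  rw [logLik, ← h2, Real.exp_sum, chan]
  exact Finset.prod_congr rfl fun t _ => (Real.exp_log (h1 t)).symm

/-- The joint type of three sequences. -/
def emp₃ (u : Fin n → U) (x : Fin n → X) (y : Fin n → Y) (i : U) (j : X) (k : Y) : ℝ :=
  (Finset.univ.filter (fun t => seq₃ u x y t = (i, j, k))).card / n

theorem seq₃_mem_iff (hn : 0 < n) {u : Fin n → U} {x : Fin n → X} {y : Fin n → Y} :
    seq₃ u x y ∈ typeClass n (unc Q) ↔ emp₃ u x y = Q := by
  have hn' : (n : ℝ) ≠ 0 := by exact_mod_cast hn.ne'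
  constructor
  · intro h
    funext i j k
    rw [emp₃, h (i, j, k), mul_div_cancel_left₀ _ hn', unc]
  · rintro rfl ⟨i, j, k⟩
    rw [unc, emp₃, mul_div_cancel₀ _ hn']

theorem mUX_eq_of_mem (hn : 0 < n) {u : Fin n → U} {x : Fin n → X} {y : Fin n → Y}
    (h : seq₃ u x y ∈ typeClass n (unc Q)) (hx : x ∈ condTypeClass P u) : mUX Q = P := by
  have hn' : (n : ℝ) ≠ 0 := by exact_mod_cast hn.ne'
  funext p
  exact mul_left_cancel₀ hn' ((seqUX_mem_of_seq₃_mem h p).symm.trans (hx p))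

variable (U X Y n) in
/-- The joint types of sequences of length `n`. -/
def jointTypes : Finset (U → X → Y → ℝ) := by
  classical
  exact Finset.univ.image fun a : (Fin n → U) × (Fin n → X) × (Fin n → Y) => emp₃ a.1 a.2.1 a.2.2

theorem emp₃_mem_jointTypes (u : Fin n → U) (x : Fin n → X) (y : Fin n → Y) :
    emp₃ u x y ∈ jointTypes U X Y n := by
  classical
  exact Finset.mem_image.2 ⟨(u, x, y), Finset.mem_univ _, rfl⟩

/-- A joint type is determined by its counts, each in `{0, …, n}`. -/
theorem card_jointTypes_le : ((jointTypes U X Y n).card : ℝ) ≤ Real.exp (slack U X Y n) := by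
  classical
  have h1 : jointTypes U X Y n ⊆ Finset.univ.image
      (fun (c : U × X × Y → Fin (n + 1)) (i : U) (j : X) (k : Y) => ((c (i, j, k) : ℕ) : ℝ) / n) := by
    intro Q hQ
    obtain ⟨⟨u, x, y⟩, -, rfl⟩ := Finset.mem_image.1 hQ
    refine Finset.mem_image.2 ⟨fun p => ⟨(Finset.univ.filter (fun t => seq₃ u x y t = p)).card,
      ?_⟩, Finset.mem_univ _, rfl⟩
    have := Finset.card_le_univ (Finset.univ.filter (fun t => seq₃ u x y t = p))
    rw [Fintype.card_fin] at this
    omega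
  have h2 := (Finset.card_le_card h1).trans Finset.card_image_le
  rw [Finset.card_univ, Fintype.card_fun, Fintype.card_fin] at h2
  have h3 : ((jointTypes U X Y n).card : ℝ) ≤ ((n : ℝ) + 1) ^ Fintype.card (U × X × Y) := by
    exact_mod_cast h2
  refine h3.trans ?_
  have hn : (0 : ℝ) < (n : ℝ) + 1 := by positivity
  rw [← Real.exp_log hn, ← Real.exp_nat_mul, Real.exp_le_exp]
  refine le_trans ?_ (card_mul_le_slack (U := U) (X := X) (Y := Y) card_prod₃_le n)
  have := log_add_one_nonneg n
  refine mul_le_mul ?_ ?_ this (by positivity) <;> linarith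

end Bounds

/-! ### The upper bound on the error probability -/

/-- The sample at `w` is independent of the others, so its mean factors out before the union bound
is taken; this is what allows the truncation at `1` inside the product. -/
theorem iidExp_union_le {Ω : Type*} [Fintype Ω] {μ : Ω → ℝ} {k : ℕ} (hμ0 : ∀ a, 0 ≤ μ a)
    (hμ : ∑ a, μ a = 1) {g : Ω → ℝ} (hg : ∀ a, 0 ≤ g a) (A : Ω → Prop) (w : Fin k) :
    iidExp μ k (fun ω => g (ω w) * ind (∃ w', w' ≠ w ∧ A (ω w'))) ≤
      (∑ a, μ a * g a) * min 1 (k * ∑ a, μ a * ind (A a)) := by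
  classical
  have hG : 0 ≤ ∑ a, μ a * g a := Finset.sum_nonneg fun a _ => mul_nonneg (hμ0 a) (hg a)
  have hH : 0 ≤ ∑ a, μ a * ind (A a) :=
    Finset.sum_nonneg fun a _ => mul_nonneg (hμ0 a) (ind_nonneg _)
  rw [mul_min_of_nonneg _ _ hG]
  refine le_min ?_ ?_
  · rw [mul_one, ← iidExp_eval hμ w g]
    exact iidExp_mono hμ0 fun ω => mul_le_of_le_one_right (hg _) (ind_le_one _)
  · have h1 : iidExp μ k (fun ω => g (ω w) * ind (∃ w', w' ≠ w ∧ A (ω w'))) ≤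
        iidExp μ k (fun ω => ∑ w' ∈ Finset.univ.erase w, g (ω w) * ind (A (ω w'))) := by
      refine iidExp_mono hμ0 fun ω => ?_
      rw [← Finset.mul_sum]
      refine mul_le_mul_of_nonneg_left ?_ (hg _)
      by_cases h : ∃ w', w' ≠ w ∧ A (ω w')
      · obtain ⟨w', hw', hA⟩ := h
        refine (ind_le_one _).trans ?_
        have := Finset.single_le_sum (f := fun w' => ind (A (ω w'))) (s := Finset.univ.erase w)
          (fun _ _ => ind_nonneg _) (Finset.mem_erase.2 ⟨hw', Finset.mem_univ w'⟩)
        simpa only [ind_of hA] using this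
      · rw [ind_not h]
        exact Finset.sum_nonneg fun _ _ => ind_nonneg _
    refine h1.trans ?_
    rw [iidExp_sum, Finset.sum_congr rfl fun w' hw' =>
      iidExp_eval_mul hμ (Finset.ne_of_mem_erase hw').symm g (fun a => ind (A a)),
      Finset.sum_const, nsmul_eq_mul, mul_left_comm]
    refine mul_le_mul_of_nonneg_left ?_ hG
    refine mul_le_mul_of_nonneg_right ?_ hH
    have := Finset.card_le_univ (Finset.univ.erase w)
    rw [Fintype.card_fin] at this
    exact_mod_cast this

section Upper

variable {U X Y : Type*} [Fintype U] [Fintype X] [Fintype Y]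
  [DecidableEq U] [DecidableEq X] [DecidableEq Y]
  {n M M₂ : ℕ} {Q : U → X → Y → ℝ} {P : U × X → ℝ} {W : X → Y → ℝ}

/-- The optimal decoder is not worse than a decoder that maximizes a score of the codewords. -/
theorem sum_error_le_of_optimal (hW : ∀ x y, 0 ≤ W x y) (hM₂ : 1 ≤ M₂)
    {dec : (Fin M → Fin M₂ → Fin n → X) → (Fin n → Y) → Fin M}
    (hdec : IsOptimalBinDecoder W dec) (x : Fin M → Fin M₂ → Fin n → X) (y : Fin n → Y)
    (φ : Fin M → Fin M₂ → ℝ) :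
    ∑ w, ∑ j, chan W (x w j) y * (if dec x y = w then 0 else 1) ≤
      ∑ w, ∑ j, chan W (x w j) y * ind (∃ w', w' ≠ w ∧ ∃ j', φ w j ≤ φ w' j') := by
  have hM₂' : (0 : ℝ) < M₂ := by exact_mod_cast hM₂
  have hlik : ∀ w, ∑ j, chan W (x w j) y = M₂ * binLik W x w y := fun w => by
    rw [binLik, mul_inv_cancel_left₀ hM₂'.ne']
  -- Deciding for `v` loses all the likelihood except that of bin `v`; hence a maximum likelihood
  -- bin minimizes the error for each codebook and output.
  have hsplit : ∀ v : Fin M, ∑ w, ∑ j, chan W (x w j) y * (if v = w then (0 : ℝ) else 1) =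
      ∑ w, M₂ * binLik W x w y - M₂ * binLik W x v y := by
    intro v
    rw [← Finset.add_sum_erase _ (fun w => M₂ * binLik W x w y) (Finset.mem_univ v),
      ← Finset.add_sum_erase _ _ (Finset.mem_univ v)]
    simp only [if_true, mul_zero, Finset.sum_const_zero, zero_add, add_sub_cancel_left]
    refine Finset.sum_congr rfl fun w hw => ?_
    rw [← hlik]
    simp [(Finset.ne_of_mem_erase hw).symm]
  -- The comparison decoder picks the bin `v` of a codeword of maximal score. When `w ≠ v` was sent,
  -- that codeword is itself the required competitor.
  obtain ⟨⟨v, l⟩, -, hmax⟩ := Finset.exists_max_image (Finset.univ : Finset (Fin M × Fin M₂))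
    (fun p => φ p.1 p.2) ⟨(dec x y, ⟨0, hM₂⟩), Finset.mem_univ _⟩
  have h1 : ∑ w, ∑ j, chan W (x w j) y * (if dec x y = w then (0 : ℝ) else 1) ≤
      ∑ w, ∑ j, chan W (x w j) y * (if v = w then (0 : ℝ) else 1) := by
    rw [hsplit, hsplit]
    have := mul_le_mul_of_nonneg_left (hdec x y v) hM₂'.le
    linarith
  refine h1.trans (Finset.sum_le_sum fun w _ => Finset.sum_le_sum fun j _ =>
    mul_le_mul_of_nonneg_left ?_ (chan_nonneg hW _ _))
  split_ifs with h
  · exact ind_nonneg _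
  · rw [ind_of ⟨v, h, l, hmax (w, j) (Finset.mem_univ _)⟩]

/-- Two bounds, one for each branch of `cost`: the center alone must have the right joint type with
`y`, which is all that is used if `I(X;Y|U) ≤ r₂`; otherwise a union bound over the `M₂` codewords
is better. -/
theorem sum_binMass_exists_type_le (hn : 0 < n) (hP : (typeClass n P).Nonempty) {r₂ : ℝ}
    (hr₂ : (M₂ : ℝ) = Real.exp (n * r₂)) (y : Fin n → Y) (Q : U → X → Y → ℝ) :
    ∑ ω, binMass n M₂ P ω * ind (∃ j, seq₃ ω.1 (ω.2 j) y ∈ typeClass n (unc Q)) ≤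
      Real.exp (-(n * cost r₂ Q) + 3 * slack U X Y n) := by
  by_cases h : ∃ ω, binMass n M₂ P ω ≠ 0 ∧ ∃ j, seq₃ ω.1 (ω.2 j) y ∈ typeClass n (unc Q)
  · obtain ⟨ω, hω, j, hj⟩ := h
    have hx : ω.2 j ∈ condTypeClass P ω.1 :=
      mem_of_uniformMass_ne_zero (Finset.prod_ne_zero_iff.1 (right_ne_zero_of_mul hω) j
        (Finset.mem_univ j))
    obtain rfl := mUX_eq_of_mem hn hj hx
    have hQ : (typeClass n (unc Q)).Nonempty := ⟨_, hj⟩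
    have hy : y ∈ typeClass n (margY Q) := mem_margY_of_seq₂_mem (seq₂_mem_of_seq₃_mem hj)
    have hn' : (0 : ℝ) ≤ n := Nat.cast_nonneg n
    rcases le_total (iX Q - r₂) 0 with hc | hc
    · rw [cost, max_eq_left hc, add_zero]
      refine le_trans ?_ (center_le hn hQ)
      rw [← sum_binMass_center_type (M₂ := M₂) hP hy]
      refine Finset.sum_le_sum fun ω _ => mul_le_mul_of_nonneg_left (ind_mono ?_) (binMass_nonneg _)
      rintro ⟨j, hj⟩
      exact seq₂_mem_of_seq₃_mem hj
    · rw [cost, max_eq_right hc]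
      have h1 : ∑ ω, binMass n M₂ (mUX Q) ω * ind (∃ j, seq₃ ω.1 (ω.2 j) y ∈ typeClass n (unc Q))
          ≤ ∑ j, ∑ ω, binMass n M₂ (mUX Q) ω *
            ind (seq₃ ω.1 (ω.2 j) y ∈ typeClass n (unc Q)) := by
        rw [Finset.sum_comm]
        refine Finset.sum_le_sum fun ω _ => ?_
        rw [← Finset.mul_sum]
        refine mul_le_mul_of_nonneg_left ?_ (binMass_nonneg _)
        by_cases h : ∃ j, seq₃ ω.1 (ω.2 j) y ∈ typeClass n (unc Q)
        · obtain ⟨j, hj⟩ := h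
          refine (ind_le_one _).trans ?_
          have := Finset.single_le_sum
            (f := fun j => ind (seq₃ ω.1 (ω.2 j) y ∈ typeClass n (unc Q)))
            (fun _ _ => ind_nonneg _) (Finset.mem_univ j)
          simpa only [ind_of hj] using this
        · rw [ind_not h]
          exact Finset.sum_nonneg fun _ _ => ind_nonneg _
      refine h1.trans ?_
      rw [Finset.sum_congr rfl fun j _ => sum_binMass_codeword_type hQ hy j, Finset.sum_const,
        Finset.card_univ, Fintype.card_fin, nsmul_eq_mul, hr₂]
      refine (mul_le_mul_of_nonneg_left (joint_le hn hQ) (Real.exp_pos _).le).trans (le_of_eq ?_)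
      rw [← Real.exp_add]
      congr 1; ring
  · rw [Finset.sum_eq_zero]
    · exact (Real.exp_pos _).le
    · intro ω _
      by_cases hω : binMass n M₂ P ω = 0
      · rw [hω, zero_mul]
      · rw [ind_not fun hj => h ⟨ω, hω, hj⟩, mul_zero]

/-- A union bound over the joint types of large cost, which are too few to change the exponent. -/
theorem sum_binMass_exists_cost_le (hn : 0 < n) (hP : (typeClass n P).Nonempty) {r₂ : ℝ}
    (hr₂ : (M₂ : ℝ) = Real.exp (n * r₂)) (y : Fin n → Y) (c : ℝ) :
    ∑ ω, binMass n M₂ P ω * ind (∃ j, c ≤ cost r₂ (emp₃ ω.1 (ω.2 j) y)) ≤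
      Real.exp (-(n * c) + 4 * slack U X Y n) := by
  classical
  set 𝒯 := (jointTypes U X Y n).filter fun Q => c ≤ cost r₂ Q with h𝒯
  have h1 : ∑ ω, binMass n M₂ P ω * ind (∃ j, c ≤ cost r₂ (emp₃ ω.1 (ω.2 j) y)) ≤
      ∑ Q ∈ 𝒯, ∑ ω, binMass n M₂ P ω *
        ind (∃ j, seq₃ ω.1 (ω.2 j) y ∈ typeClass n (unc Q)) := by
    rw [Finset.sum_comm]
    refine Finset.sum_le_sum fun ω _ => ?_
    rw [← Finset.mul_sum]
    refine mul_le_mul_of_nonneg_left ?_ (binMass_nonneg _)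
    by_cases h : ∃ j, c ≤ cost r₂ (emp₃ ω.1 (ω.2 j) y)
    · obtain ⟨j, hj⟩ := h
      refine (ind_le_one _).trans ?_
      have hm : emp₃ ω.1 (ω.2 j) y ∈ 𝒯 := Finset.mem_filter.2 ⟨emp₃_mem_jointTypes _ _ _, hj⟩
      have := Finset.single_le_sum
        (f := fun Q => ind (∃ j, seq₃ ω.1 (ω.2 j) y ∈ typeClass n (unc Q)))
        (fun _ _ => ind_nonneg _) hm
      refine le_trans (le_of_eq ?_) this
      rw [ind_of ⟨j, (seq₃_mem_iff hn).2 rfl⟩]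
    · rw [ind_not h]
      exact Finset.sum_nonneg fun _ _ => ind_nonneg _
  refine h1.trans ?_
  have h2 : ∀ Q ∈ 𝒯, ∑ ω, binMass n M₂ P ω *
      ind (∃ j, seq₃ ω.1 (ω.2 j) y ∈ typeClass n (unc Q)) ≤
      Real.exp (-(n * c) + 3 * slack U X Y n) := by
    intro Q hQ
    refine (sum_binMass_exists_type_le hn hP hr₂ y Q).trans (Real.exp_le_exp.2 ?_)
    have := mul_le_mul_of_nonneg_left (Finset.mem_filter.1 hQ).2 (Nat.cast_nonneg (α := ℝ) n)
    linarith
  refine (Finset.sum_le_card_nsmul _ _ _ h2).trans ?_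
  rw [nsmul_eq_mul]
  have h3 : (𝒯.card : ℝ) ≤ Real.exp (slack U X Y n) :=
    le_trans (by exact_mod_cast Finset.card_filter_le _ _) card_jointTypes_le
  refine (mul_le_mul_of_nonneg_right h3 (Real.exp_pos _).le).trans (le_of_eq ?_)
  rw [← Real.exp_add]
  congr 1; ring

/-- The contribution of a joint type of the transmitted codeword to the error probability. -/
theorem sum_type_error_le (hn : 0 < n) (hW : ∀ x y, 0 ≤ W x y) (hP : (typeClass n P).Nonempty)
    {r r₂ e : ℝ} (hr : (M : ℝ) = Real.exp (n * r)) (hr₂ : (M₂ : ℝ) = Real.exp (n * r₂))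
    (he : ∀ Q : U → X → Y → ℝ, (typeClass n (unc Q)).Nonempty → mUX Q = P → Supp W Q →
      e ≤ typeExp W r r₂ Q) (Q : U → X → Y → ℝ) (w : Fin M) (j : Fin M₂) :
    ∑ y : Fin n → Y, iidExp (binMass n M₂ P) M (fun ω =>
      (chan W ((ω w).2 j) y * ind (seq₃ (ω w).1 ((ω w).2 j) y ∈ typeClass n (unc Q))) *
        ind (∃ w', w' ≠ w ∧ ∃ j', cost r₂ Q ≤ cost r₂ (emp₃ (ω w').1 ((ω w').2 j') y))) ≤
      Real.exp (-(n * e) + 6 * slack U X Y n) := by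
  set δ := slack U X Y n with hδ
  have hδ0 : 0 ≤ δ := slack_nonneg n
  set m := min 1 (M * Real.exp (-(n * cost r₂ Q) + 4 * δ)) with hm
  have hm0 : 0 ≤ m := le_min zero_le_one (by positivity)
  have h1 : ∀ y : Fin n → Y, iidExp (binMass n M₂ P) M (fun ω =>
      (chan W ((ω w).2 j) y * ind (seq₃ (ω w).1 ((ω w).2 j) y ∈ typeClass n (unc Q))) *
        ind (∃ w', w' ≠ w ∧ ∃ j', cost r₂ Q ≤ cost r₂ (emp₃ (ω w').1 ((ω w').2 j') y))) ≤
      (∑ ω, binMass n M₂ P ω *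
        (chan W (ω.2 j) y * ind (seq₃ ω.1 (ω.2 j) y ∈ typeClass n (unc Q)))) * m := by
    intro y
    refine (iidExp_union_le binMass_nonneg (sum_binMass hP)
      (g := fun ω => chan W (ω.2 j) y * ind (seq₃ ω.1 (ω.2 j) y ∈ typeClass n (unc Q)))
      (fun ω => mul_nonneg (chan_nonneg hW _ _) (ind_nonneg _))
      (fun ω => ∃ j', cost r₂ Q ≤ cost r₂ (emp₃ ω.1 (ω.2 j') y)) w).trans ?_
    refine mul_le_mul_of_nonneg_left (min_le_min le_rfl (mul_le_mul_of_nonneg_left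
      (sum_binMass_exists_cost_le hn hP hr₂ y _) (Nat.cast_nonneg M))) ?_
    exact Finset.sum_nonneg fun ω _ => mul_nonneg (binMass_nonneg _)
      (mul_nonneg (chan_nonneg hW _ _) (ind_nonneg _))
  refine (Finset.sum_le_sum fun y _ => h1 y).trans ?_
  -- If `Q` occurs with positive probability at all, then `mUX Q = P` and `Supp W Q`, as `he`
  -- requires; otherwise the whole contribution is zero.
  by_cases h : ∃ y : Fin n → Y, ∃ ω, binMass n M₂ P ω ≠ 0 ∧ chan W (ω.2 j) y ≠ 0 ∧
      seq₃ ω.1 (ω.2 j) y ∈ typeClass n (unc Q)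
  · obtain ⟨y₀, ω, hω, hc, hj⟩ := h
    have hx : ω.2 j ∈ condTypeClass P ω.1 :=
      mem_of_uniformMass_ne_zero (Finset.prod_ne_zero_iff.1 (right_ne_zero_of_mul hω) j
        (Finset.mem_univ j))
    obtain rfl := mUX_eq_of_mem hn hj hx
    have hQ : (typeClass n (unc Q)).Nonempty := ⟨_, hj⟩
    have hs := supp_of_chan_ne_zero hn hj hc
    have hy₀ : y₀ ∈ typeClass n (margY Q) := mem_margY_of_seq₂_mem (seq₂_mem_of_seq₃_mem hj)
    have h2 : ∀ y : Fin n → Y, ∑ ω, binMass n M₂ (mUX Q) ω *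
        (chan W (ω.2 j) y * ind (seq₃ ω.1 (ω.2 j) y ∈ typeClass n (unc Q))) =
        (typeClass n (margY Q)).indicator (fun _ => Real.exp (n * logLik W Q) *
          ((typeClass n (unc Q)).ncard /
        ((typeClass n (margY Q)).ncard * (typeClass n (mUX Q)).ncard))) y := by
      intro y
      by_cases hy : y ∈ typeClass n (margY Q)
      · rw [Set.indicator_of_mem hy, ← sum_binMass_codeword_type hQ hy j, Finset.mul_sum]
        refine Finset.sum_congr rfl fun ω _ => ?_
        by_cases hj : seq₃ ω.1 (ω.2 j) y ∈ typeClass n (unc Q)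
        · rw [chan_eq_exp hW hj hs]; ring
        · rw [ind_not hj]; ring
      · rw [Set.indicator_of_notMem hy]
        refine Finset.sum_eq_zero fun ω _ => ?_
        rw [ind_not fun hj => hy (mem_margY_of_seq₂_mem (seq₂_mem_of_seq₃_mem hj))]
        ring
    -- Summing over the outputs of type `margY Q` cancels the size of that class.
    have h3 : ∑ y : Fin n → Y, (∑ ω, binMass n M₂ (mUX Q) ω *
        (chan W (ω.2 j) y * ind (seq₃ ω.1 (ω.2 j) y ∈ typeClass n (unc Q)))) =
        Real.exp (n * logLik W Q) *
          ((typeClass n (unc Q)).ncard / (typeClass n (mUX Q)).ncard) := by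
      classical
      rw [Finset.sum_congr rfl fun y _ => h2 y]
      simp only [Set.indicator_apply]
      rw [← Finset.sum_filter, Finset.sum_const, nsmul_eq_mul]
      have h4 : ((Finset.univ.filter fun y => y ∈ typeClass n (margY Q)).card : ℝ) =
          (typeClass n (margY Q)).ncard := by
        rw [Set.ncard_eq_toFinset_card']
        congr 2
        ext y; simp
      have h5 : (0 : ℝ) < (typeClass n (margY Q)).ncard := ncard_pos_of_mem hy₀
      rw [h4]
      field_simp
    rw [← Finset.sum_mul, h3]
    have h4 : Real.exp (n * logLik W Q) *
        ((typeClass n (unc Q)).ncard / (typeClass n (mUX Q)).ncard) ≤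
        Real.exp (-(n * divg W Q) + 2 * δ) := by
      refine (mul_le_mul_of_nonneg_left (ratio_le hn hQ) (Real.exp_pos _).le).trans (le_of_eq ?_)
      rw [← Real.exp_add]
      congr 1; rw [divg]; ring
    have h5 : m ≤ Real.exp (-(n * max 0 (cost r₂ Q - r)) + 4 * δ) := by
      rcases le_total (cost r₂ Q - r) 0 with h | h
      · rw [max_eq_left h, mul_zero, neg_zero, zero_add]
        refine (min_le_left _ _).trans ?_
        rw [← Real.exp_zero]
        exact Real.exp_le_exp.2 (by linarith)
      · rw [max_eq_right h]
        refine (min_le_right _ _).trans (le_of_eq ?_)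
        rw [hr, ← Real.exp_add]
        congr 1; ring
    refine (mul_le_mul h4 h5 hm0 (Real.exp_pos _).le).trans ?_
    rw [← Real.exp_add, Real.exp_le_exp]
    have h6 := mul_le_mul_of_nonneg_left (he Q hQ rfl hs) (Nat.cast_nonneg (α := ℝ) n)
    rw [typeExp] at h6
    linarith
  · rw [Finset.sum_eq_zero]
    · exact (Real.exp_pos _).le
    · intro y _
      rw [Finset.sum_eq_zero, zero_mul]
      intro ω _
      by_contra hne
      refine h ⟨y, ω, left_ne_zero_of_mul hne,
        left_ne_zero_of_mul (right_ne_zero_of_mul hne), ?_⟩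
      by_contra hj
      exact (right_ne_zero_of_mul (right_ne_zero_of_mul hne)) (ind_not hj)

/-- The upper bound on the error probability of the optimal bin index decoder. -/
theorem errorProb_le (hn : 0 < n) (hW : ∀ x y, 0 ≤ W x y) (hP : (typeClass n P).Nonempty)
    {r r₂ e : ℝ} (hr : (M : ℝ) = Real.exp (n * r)) (hr₂ : (M₂ : ℝ) = Real.exp (n * r₂))
    {dec : (Fin M → Fin M₂ → Fin n → X) → (Fin n → Y) → Fin M}
    (hdec : IsOptimalBinDecoder W dec)
    (he : ∀ Q : U → X → Y → ℝ, (typeClass n (unc Q)).Nonempty → mUX Q = P → Supp W Q →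
      e ≤ typeExp W r r₂ Q) :
    errorProb P W dec ≤ Real.exp (-(n * e) + 7 * slack U X Y n) := by
  have hM0 : (0 : ℝ) < M := by rw [hr]; exact Real.exp_pos _
  have hM₂0 : (0 : ℝ) < M₂ := by rw [hr₂]; exact Real.exp_pos _
  have hM₂1 : 1 ≤ M₂ := by exact_mod_cast hM₂0
  rw [errorProb_eq_iidExp]
  have h1 : ∀ ω : Fin M → (Fin n → U) × (Fin M₂ → Fin n → X), ((M : ℝ) * (M₂ : ℝ))⁻¹ *
      ∑ w : Fin M, ∑ j : Fin M₂, ∑ y : Fin n → Y, chan W ((ω w).2 j) y *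
        (if dec (fun w => (ω w).2) y = w then 0 else 1) ≤ ((M : ℝ) * (M₂ : ℝ))⁻¹ *
      ∑ w : Fin M, ∑ j : Fin M₂, ∑ Q ∈ jointTypes U X Y n, ∑ y : Fin n → Y,
        (chan W ((ω w).2 j) y * ind (seq₃ (ω w).1 ((ω w).2 j) y ∈ typeClass n (unc Q))) *
        ind (∃ w', w' ≠ w ∧ ∃ j', cost r₂ Q ≤ cost r₂ (emp₃ (ω w').1 ((ω w').2 j') y)) := by
    intro ω
    refine mul_le_mul_of_nonneg_left ?_ (by positivity)
    have h2 : ∀ y : Fin n → Y, ∑ w : Fin M, ∑ j : Fin M₂, chan W ((ω w).2 j) y *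
        (if dec (fun w => (ω w).2) y = w then 0 else 1) ≤
        ∑ w : Fin M, ∑ j : Fin M₂, ∑ Q ∈ jointTypes U X Y n,
        (chan W ((ω w).2 j) y * ind (seq₃ (ω w).1 ((ω w).2 j) y ∈ typeClass n (unc Q))) *
        ind (∃ w', w' ≠ w ∧ ∃ j', cost r₂ Q ≤ cost r₂ (emp₃ (ω w').1 ((ω w').2 j') y)) := by
      intro y
      -- The score is `cost` rather than the likelihood, so the probability of a competitor depends
      -- only on the cost of the transmitted joint type.
      refine (sum_error_le_of_optimal hW hM₂1 hdec (fun w => (ω w).2) y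
        (fun w j => cost r₂ (emp₃ (ω w).1 ((ω w).2 j) y))).trans ?_
      refine Finset.sum_le_sum fun w _ => Finset.sum_le_sum fun j _ => ?_
      have h3 := Finset.single_le_sum (f := fun Q => (chan W ((ω w).2 j) y *
        ind (seq₃ (ω w).1 ((ω w).2 j) y ∈ typeClass n (unc Q))) *
        ind (∃ w', w' ≠ w ∧ ∃ j', cost r₂ Q ≤ cost r₂ (emp₃ (ω w').1 ((ω w').2 j') y)))
        (fun Q _ => mul_nonneg (mul_nonneg (chan_nonneg hW _ _) (ind_nonneg _)) (ind_nonneg _))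
        (emp₃_mem_jointTypes (ω w).1 ((ω w).2 j) y)
      refine le_trans (le_of_eq ?_) h3
      rw [ind_of ((seq₃_mem_iff hn).2 rfl), mul_one]
    have hswap : ∀ F : Fin M → Fin M₂ → (Fin n → Y) → ℝ,
        ∑ w, ∑ j, ∑ y, F w j y = ∑ y, ∑ w, ∑ j, F w j y := by
      intro F
      rw [Finset.sum_congr rfl fun w _ => Finset.sum_comm, Finset.sum_comm]
    rw [hswap]
    refine (Finset.sum_le_sum fun y _ => h2 y).trans (le_of_eq ?_)
    rw [← hswap]
    exact Finset.sum_congr rfl fun w _ => Finset.sum_congr rfl fun j _ => Finset.sum_comm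
  refine (iidExp_mono binMass_nonneg h1).trans ?_
  rw [iidExp_const_mul, iidExp_sum]
  set δ := slack U X Y n with hδ
  have h4 : ∀ w ∈ (Finset.univ : Finset (Fin M)), iidExp (binMass n M₂ P) M (fun ω =>
      ∑ j : Fin M₂, ∑ Q ∈ jointTypes U X Y n, ∑ y : Fin n → Y,
        (chan W ((ω w).2 j) y * ind (seq₃ (ω w).1 ((ω w).2 j) y ∈ typeClass n (unc Q))) *
        ind (∃ w', w' ≠ w ∧ ∃ j', cost r₂ Q ≤ cost r₂ (emp₃ (ω w').1 ((ω w').2 j') y))) ≤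
      M₂ * Real.exp (-(n * e) + 7 * δ) := by
    intro w _
    rw [iidExp_sum]
    have h5 : ∀ j ∈ (Finset.univ : Finset (Fin M₂)), iidExp (binMass n M₂ P) M (fun ω =>
        ∑ Q ∈ jointTypes U X Y n, ∑ y : Fin n → Y,
        (chan W ((ω w).2 j) y * ind (seq₃ (ω w).1 ((ω w).2 j) y ∈ typeClass n (unc Q))) *
        ind (∃ w', w' ≠ w ∧ ∃ j', cost r₂ Q ≤ cost r₂ (emp₃ (ω w').1 ((ω w').2 j') y))) ≤
        Real.exp (-(n * e) + 7 * δ) := by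
      intro j _
      rw [iidExp_sum]
      have h6 : ∀ Q ∈ jointTypes U X Y n, iidExp (binMass n M₂ P) M (fun ω => ∑ y : Fin n → Y,
          (chan W ((ω w).2 j) y * ind (seq₃ (ω w).1 ((ω w).2 j) y ∈ typeClass n (unc Q))) *
          ind (∃ w', w' ≠ w ∧ ∃ j', cost r₂ Q ≤ cost r₂ (emp₃ (ω w').1 ((ω w').2 j') y))) ≤
          Real.exp (-(n * e) + 6 * δ) := by
        intro Q _
        rw [iidExp_sum]
        exact sum_type_error_le hn hW hP hr hr₂ he Q w j
      refine (Finset.sum_le_card_nsmul _ _ _ h6).trans ?_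
      rw [nsmul_eq_mul]
      refine (mul_le_mul_of_nonneg_right card_jointTypes_le (Real.exp_pos _).le).trans
        (le_of_eq ?_)
      rw [← Real.exp_add]
      congr 1; ring
    refine (Finset.sum_le_card_nsmul _ _ _ h5).trans (le_of_eq ?_)
    simp
  refine (mul_le_mul_of_nonneg_left (Finset.sum_le_card_nsmul _ _ _ h4) (by positivity)).trans
    (le_of_eq ?_)
  simp only [Finset.card_univ, Fintype.card_fin, nsmul_eq_mul]
  field_simp

end Upper

/-! ### The lower bound on the error probability -/

section Lower

variable {U X Y : Type*} [Fintype U] [Fintype X] [Fintype Y]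
  [DecidableEq U] [DecidableEq X] [DecidableEq Y]
  {n M M₂ : ℕ} {Q : U → X → Y → ℝ} {P : U × X → ℝ} {W : X → Y → ℝ}

/-- Lets numerical constants be absorbed into multiples of `slack`. -/
theorem one_le_slack (n : ℕ) : 1 ≤ slack U X Y n := by
  have h := log_add_one_nonneg n
  have h1 : (1 : ℝ) ≤ (Fintype.card U + 1) * (Fintype.card X + 1) * (Fintype.card Y + 1) := by
    exact_mod_cast Nat.succ_le_of_lt (by positivity :
      0 < (Fintype.card U + 1) * (Fintype.card X + 1) * (Fintype.card Y + 1))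
  unfold slack
  nlinarith

/-- The number of codewords of a bin that have the joint type `Q` with their cloud center and the
channel output `y`. -/
def typeCount (Q : U → X → Y → ℝ) (y : Fin n → Y) (ω : (Fin n → U) × (Fin M₂ → Fin n → X)) : ℝ :=
  ∑ j, ind (seq₃ ω.1 (ω.2 j) y ∈ typeClass n (unc Q))

/-- The probability that a codeword has the joint type `Q` with its cloud center and the channel
output, given the joint type of the latter two. -/
def codewordProb (n : ℕ) (Q : U → X → Y → ℝ) : ℝ :=
  (typeClass n (unc Q)).ncard * (typeClass n (margU (mUX Q))).ncard /
    ((typeClass n (mUY Q)).ncard * (typeClass n (mUX Q)).ncard)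

/-- The probability that a cloud center has the joint type `Q_{UY}` with the channel output. -/
def centerProb (n : ℕ) (Q : U → X → Y → ℝ) : ℝ :=
  (typeClass n (mUY Q)).ncard /
    ((typeClass n (margY Q)).ncard * (typeClass n (margU (mUX Q))).ncard)

theorem centerProb_mul_codewordProb (hQ : (typeClass n (unc Q)).Nonempty) :
    centerProb n Q * codewordProb n Q = (typeClass n (unc Q)).ncard /
      ((typeClass n (margY Q)).ncard * (typeClass n (mUX Q)).ncard) := by
  have h1 : (0 : ℝ) < (typeClass n (mUY Q)).ncard := ncard_pos_of_mem (mUY_nonempty hQ).some_mem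
  have h2 : (0 : ℝ) < (typeClass n (margU (mUX Q))).ncard :=
    ncard_pos_of_mem (margU_nonempty (mUX_nonempty hQ)).some_mem
  rw [centerProb, codewordProb]
  field_simp

/-- Given a center of the right joint type with `y`, the codewords are `M₂` independent trials with
success probability `codewordProb n Q`, and `iidExp_count_ge` applies. -/
theorem sum_binMass_typeCount_ge (hQ : (typeClass n (unc Q)).Nonempty) {y : Fin n → Y}
    (hy : y ∈ typeClass n (margY Q)) :
    centerProb n Q * (min 1 (M₂ * codewordProb n Q) / 8) ≤ ∑ ω, binMass n M₂ (mUX Q) ω *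
      ind (max 1 (M₂ * codewordProb n Q / 2) ≤ typeCount Q y ω) := by
  rw [sum_binMass_mul, centerProb, ← sum_uniformMass_center hy, Finset.sum_mul]
  refine Finset.sum_le_sum fun u _ => ?_
  rw [mul_assoc]
  refine mul_le_mul_of_nonneg_left ?_ (uniformMass_nonneg _ _)
  by_cases hu : seq₂ u y ∈ typeClass n (mUY Q)
  · rw [ind_of hu, one_mul]
    have h := iidExp_count_ge (k := M₂) (uniformMass_nonneg (condTypeClass (mUX Q) u))
      (sum_uniformMass (condTypeClass_nonempty (mUX_nonempty hQ) (mem_margU_of_seq₂_mem hu)))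
      (J := fun x => ind (seq₃ u x y ∈ typeClass n (unc Q))) (fun _ => ind_eq _)
      (m := M₂ * codewordProb n Q) (by rw [sum_uniformMass_codeword hu, codewordProb])
    refine h.trans (le_of_eq ?_)
    congr 1
  · rw [ind_not hu, zero_mul]
    exact Finset.sum_nonneg fun x _ => mul_nonneg
      (Finset.prod_nonneg fun _ _ => uniformMass_nonneg _ _) (ind_nonneg _)

/-- A wrongly decoded bin contributes its likelihood, whatever the decoder is. -/
theorem sum_error_ge (hW : ∀ x y, 0 ≤ W x y) (hs : Supp W Q)
    (ω : Fin M → (Fin n → U) × (Fin M₂ → Fin n → X)) (y : Fin n → Y) (v : Fin M) {a : ℝ}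
    (ha : 0 ≤ a) :
    Real.exp (n * logLik W Q) * a * max 0 (∑ w, ind (a ≤ typeCount Q y (ω w)) - 1) ≤
      ∑ w, ∑ j, chan W ((ω w).2 j) y * (if v = w then 0 else 1) := by
  set E := Real.exp (n * logLik W Q) with hE
  have hE0 : 0 ≤ E := (Real.exp_pos _).le
  have h1 : ∀ w, E * a * ind (a ≤ typeCount Q y (ω w)) ≤ ∑ j, chan W ((ω w).2 j) y := by
    intro w
    by_cases h : a ≤ typeCount Q y (ω w)
    · rw [ind_of h, mul_one]
      refine (mul_le_mul_of_nonneg_left h hE0).trans ?_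
      rw [typeCount, Finset.mul_sum]
      refine Finset.sum_le_sum fun j _ => ?_
      by_cases hj : seq₃ (ω w).1 ((ω w).2 j) y ∈ typeClass n (unc Q)
      · rw [ind_of hj, mul_one, chan_eq_exp hW hj hs]
      · rw [ind_not hj, mul_zero]
        exact chan_nonneg hW _ _
    · rw [ind_not h, mul_zero]
      exact Finset.sum_nonneg fun _ _ => chan_nonneg hW _ _
  rcases le_total (∑ w, ind (a ≤ typeCount Q y (ω w)) - 1) 0 with h | h
  · rw [max_eq_left h, mul_zero]
    refine Finset.sum_nonneg fun w _ => Finset.sum_nonneg fun j _ =>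
      mul_nonneg (chan_nonneg hW _ _) ?_
    split_ifs <;> norm_num
  · rw [max_eq_right h]
    -- The decision `v` saves at most one rich bin.
    have h2 : ∑ w, ind (a ≤ typeCount Q y (ω w)) - 1 ≤
        ∑ w ∈ Finset.univ.erase v, ind (a ≤ typeCount Q y (ω w)) := by
      rw [← Finset.add_sum_erase _ _ (Finset.mem_univ v)]
      linarith [ind_le_one (a ≤ typeCount Q y (ω v))]
    refine (mul_le_mul_of_nonneg_left h2 (mul_nonneg hE0 ha)).trans ?_
    rw [Finset.mul_sum, ← Finset.add_sum_erase _ (fun w => ∑ j, chan W ((ω w).2 j) y *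
      (if v = w then (0 : ℝ) else 1)) (Finset.mem_univ v)]
    simp only [if_true, mul_zero, Finset.sum_const_zero, zero_add]
    refine Finset.sum_le_sum fun w hw => (h1 w).trans (le_of_eq ?_)
    simp [(Finset.ne_of_mem_erase hw).symm]

/-- The lower bound on the error probability of any bin index decoder. -/
theorem errorProb_ge (hn : 0 < n) (hW : ∀ x y, 0 ≤ W x y) (hM : 2 ≤ M)
    {r r₂ : ℝ} (hr : (M : ℝ) = Real.exp (n * r)) (hr₂ : (M₂ : ℝ) = Real.exp (n * r₂))
    (dec : (Fin M → Fin M₂ → Fin n → X) → (Fin n → Y) → Fin M)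
    (hQ : (typeClass n (unc Q)).Nonempty) (hs : Supp W Q) :
    Real.exp (-(n * typeExp W r r₂ Q) - 13 * slack U X Y n) ≤ errorProb (mUX Q) W dec := by
  classical
  have hM0 : (0 : ℝ) < M := by rw [hr]; exact Real.exp_pos _
  have hM₂0 : (0 : ℝ) < M₂ := by rw [hr₂]; exact Real.exp_pos _
  have hP := mUX_nonempty hQ
  set δ := slack U X Y n with hδ
  have hδ1 : 1 ≤ δ := one_le_slack n
  set p := codewordProb n Q with hp
  set q := centerProb n Q with hq
  have hp0 : 0 ≤ p := by rw [hp, codewordProb]; positivity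
  have hq0 : 0 ≤ q := by rw [hq, centerProb]; positivity
  -- `a` is the number of codewords of type `Q` that makes a bin rich, and `b` below bounds from
  -- below the probability that a bin is rich.
  set a := max 1 (M₂ * p / 2) with ha
  have ha0 : 0 ≤ a := zero_le_one.trans (le_max_left _ _)
  set b := q * (min 1 (M₂ * p) / 8) with hb
  have hm0 : 0 ≤ min 1 (M₂ * p) := le_min zero_le_one (by positivity)
  have hb0 : 0 ≤ b := by positivity
  set E := Real.exp (n * logLik W Q) with hE
  have hE0 : 0 < E := Real.exp_pos _
  set T := (typeClass n (margY Q)).toFinset with hT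
  have hNY : (T.card : ℝ) = (typeClass n (margY Q)).ncard := by
    rw [Set.ncard_eq_toFinset_card']
  have hNY0 : (0 : ℝ) < (typeClass n (margY Q)).ncard :=
    ncard_pos_of_mem (margY_nonempty hQ).some_mem
  have h1 : ((M : ℝ) * M₂)⁻¹ * (T.card * (E * a * ((M * b) * min 1 (M * b) / 12))) ≤
      errorProb (mUX Q) W dec := by
    rw [errorProb_eq_iidExp, iidExp_const_mul]
    refine mul_le_mul_of_nonneg_left ?_ (by positivity)
    have h2 : iidExp (binMass n M₂ (mUX Q)) M (fun ω => ∑ y ∈ T,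
        E * a * max 0 (∑ w, ind (a ≤ typeCount Q y (ω w)) - 1)) ≤
        iidExp (binMass n M₂ (mUX Q)) M (fun ω => ∑ w : Fin M, ∑ j : Fin M₂, ∑ y : Fin n → Y,
          chan W ((ω w).2 j) y * (if dec (fun w => (ω w).2) y = w then 0 else 1)) := by
      refine iidExp_mono binMass_nonneg fun ω => ?_
      have h3 : ∑ w : Fin M, ∑ j : Fin M₂, ∑ y : Fin n → Y,
          chan W ((ω w).2 j) y * (if dec (fun w => (ω w).2) y = w then (0 : ℝ) else 1) =
          ∑ y : Fin n → Y, ∑ w : Fin M, ∑ j : Fin M₂,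
          chan W ((ω w).2 j) y * (if dec (fun w => (ω w).2) y = w then (0 : ℝ) else 1) := by
        rw [Finset.sum_congr rfl fun w _ => Finset.sum_comm, Finset.sum_comm]
      rw [h3]
      have h4 : ∀ y : Fin n → Y, E * a * max 0 (∑ w, ind (a ≤ typeCount Q y (ω w)) - 1) ≤
          ∑ w : Fin M, ∑ j : Fin M₂,
          chan W ((ω w).2 j) y * (if dec (fun w => (ω w).2) y = w then (0 : ℝ) else 1) :=
        fun y => sum_error_ge hW hs ω y _ ha0
      refine (Finset.sum_le_sum_of_subset_of_nonneg (Finset.subset_univ T)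
        fun y _ _ => ?_).trans (Finset.sum_le_sum fun y _ => h4 y)
      exact mul_nonneg (mul_nonneg hE0.le ha0) (le_max_left _ _)
    refine le_trans ?_ h2
    rw [iidExp_sum, ← nsmul_eq_mul]
    refine Finset.card_nsmul_le_sum _ _ _ fun y hy => ?_
    have hy' : y ∈ typeClass n (margY Q) := by simpa [hT] using hy
    rw [iidExp_const_mul]
    refine mul_le_mul_of_nonneg_left ?_ (mul_nonneg hE0.le ha0)
    have h5 := iidExp_excess_ge (μ := binMass n M₂ (mUX Q)) binMass_nonneg (sum_binMass hP)
      (J := fun ω => ind (a ≤ typeCount Q y ω)) (fun _ => ind_eq _) hM rfl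
    refine le_trans ?_ h5
    have h6 : (M : ℝ) * b ≤ M * ∑ ω, binMass n M₂ (mUX Q) ω * ind (a ≤ typeCount Q y ω) :=
      mul_le_mul_of_nonneg_left (sum_binMass_typeCount_ge hQ hy') hM0.le
    have h7 : (0 : ℝ) ≤ M * b := by positivity
    have h8 := mul_le_mul h6 (min_le_min (le_refl (1 : ℝ)) h6) (le_min zero_le_one h7)
      (h7.trans h6)
    linarith
  refine le_trans ?_ h1
  -- Up to a constant, `a * b` recovers the mean number `q * M₂ * p` of such codewords in a bin: for
  -- `M₂ * p ≥ 1` a rich bin has many of them, otherwise one suffices and rarity is in `b`.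
  have hab : q * (M₂ * p) / 16 ≤ a * b := by
    have : M₂ * p / 2 ≤ a * min 1 (M₂ * p) := by
      rcases le_total 1 (M₂ * p) with h | h
      · rw [min_eq_left h, mul_one]; exact le_max_right _ _
      · rw [min_eq_right h]
        have h9 : 1 * (M₂ * p) ≤ a * (M₂ * p) :=
          mul_le_mul_of_nonneg_right (le_max_left _ _) (by positivity)
        have : 0 ≤ M₂ * p := by positivity
        linarith
    have := mul_le_mul_of_nonneg_left this hq0
    rw [hb]
    linarith
  have hMb : Real.exp (-(n * max 0 (cost r₂ Q - r)) - 3 * δ) / 8 ≤ min 1 (M * b) := by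
    have h2 : Real.exp (-(n * cost r₂ Q) - 3 * δ) ≤ q * min 1 (M₂ * p) := by
      rw [mul_min_of_nonneg _ _ hq0, mul_one]
      have hn' : (0 : ℝ) ≤ n := Nat.cast_nonneg n
      refine le_min ?_ ?_
      · refine le_trans (Real.exp_le_exp.2 ?_) (center_ge hn hQ)
        have : n * iU Q ≤ n * cost r₂ Q := mul_le_mul_of_nonneg_left
          (by rw [cost]; linarith [le_max_left 0 (iX Q - r₂)]) hn'
        linarith
      · have h3 := mul_le_mul_of_nonneg_left (joint_ge hn hQ) hM₂0.le
        rw [← centerProb_mul_codewordProb hQ, mul_left_comm, ← hp, ← hq] at h3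
        refine le_trans ?_ h3
        rw [hr₂, ← Real.exp_add, Real.exp_le_exp]
        have : n * (iU Q + (iX Q - r₂)) ≤ n * cost r₂ Q := mul_le_mul_of_nonneg_left
          (by rw [cost]; linarith [le_max_right 0 (iX Q - r₂)]) hn'
        linarith
    refine le_min ?_ ?_
    · have h4 : Real.exp (-(n * max 0 (cost r₂ Q - r)) - 3 * δ) ≤ 1 := by
        rw [← Real.exp_zero, Real.exp_le_exp]
        have : 0 ≤ n * max 0 (cost r₂ Q - r) := mul_nonneg (Nat.cast_nonneg n) (le_max_left _ _)
        linarith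
      linarith
    · have h4 : Real.exp (-(n * max 0 (cost r₂ Q - r)) - 3 * δ) ≤
          M * Real.exp (-(n * cost r₂ Q) - 3 * δ) := by
        rw [hr, ← Real.exp_add, Real.exp_le_exp]
        have : n * (cost r₂ Q - r) ≤ n * max 0 (cost r₂ Q - r) :=
          mul_le_mul_of_nonneg_left (le_max_right _ _) (Nat.cast_nonneg n)
        linarith
      have h5 := mul_le_mul_of_nonneg_left h2 hM0.le
      rw [hb]
      linarith
  have hmain : Real.exp (-(n * divg W Q) - 2 * δ) ≤ E * (T.card * (q * p)) := by
    have h2 := mul_le_mul_of_nonneg_left (ratio_ge hn hQ) hE0.le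
    rw [hq, hp, centerProb_mul_codewordProb hQ, hNY]
    have h3 : (typeClass n (margY Q)).ncard * (((typeClass n (unc Q)).ncard : ℝ) /
        ((typeClass n (margY Q)).ncard * (typeClass n (mUX Q)).ncard)) =
        (typeClass n (unc Q)).ncard / (typeClass n (mUX Q)).ncard := by
      field_simp
    rw [h3]
    refine le_trans (le_of_eq ?_) h2
    rw [hE, ← Real.exp_add]
    congr 1; rw [divg]; ring
  -- `1536 = 12 * 16 * 8`: the constants of `iidExp_excess_ge`, `hab` and `hMb`. With `2 * δ` from
  -- `hmain` and `3 * δ` from `hMb`, this gives the total `13 * δ`.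
  have hconst : Real.exp (-(8 * δ)) ≤ 1 / 1536 := by
    have h2 : (1536 : ℝ) ≤ Real.exp (8 * δ) := by
      have h3 : Real.exp (8 * 1) ≤ Real.exp (8 * δ) := Real.exp_le_exp.2 (by linarith)
      have h4 : Real.exp (8 * 1) = Real.exp 1 ^ 8 := by
        rw [← Real.exp_nat_mul]; norm_num
      have h5 : (2.7 : ℝ) ^ 8 ≤ Real.exp 1 ^ 8 :=
        pow_le_pow_left₀ (by norm_num) (by linarith [Real.exp_one_gt_d9]) 8
      have h6 : (1536 : ℝ) ≤ (2.7 : ℝ) ^ 8 := by norm_num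
      linarith
    rw [Real.exp_neg, ← one_div]
    exact one_div_le_one_div_of_le (by norm_num) h2
  calc Real.exp (-(n * typeExp W r r₂ Q) - 13 * δ)
      = Real.exp (-(n * divg W Q) - 2 * δ) *
        (Real.exp (-(n * max 0 (cost r₂ Q - r)) - 3 * δ) * Real.exp (-(8 * δ))) := by
        rw [← Real.exp_add, ← Real.exp_add]
        congr 1; rw [typeExp]; ring
    _ ≤ (E * (T.card * (q * p))) *
        (Real.exp (-(n * max 0 (cost r₂ Q - r)) - 3 * δ) * (1 / 1536)) := by
        refine mul_le_mul hmain (mul_le_mul_of_nonneg_left hconst (Real.exp_pos _).le)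
          (by positivity) (by positivity)
    _ = (E * (T.card * (q * p))) *
        ((Real.exp (-(n * max 0 (cost r₂ Q - r)) - 3 * δ) / 8) / 192) := by ring
    _ ≤ (E * (T.card * (q * p))) * (min 1 (M * b) / 192) := by
        refine mul_le_mul_of_nonneg_left ?_ (by positivity)
        linarith
    _ = (M₂ : ℝ)⁻¹ * T.card * E * min 1 (M * b) / 12 * (q * (M₂ * p) / 16) := by
        field_simp; ring
    _ ≤ (M₂ : ℝ)⁻¹ * T.card * E * min 1 (M * b) / 12 * (a * b) := by
        refine mul_le_mul_of_nonneg_left hab ?_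
        have : 0 ≤ min 1 (M * b) := le_min zero_le_one (by positivity)
        positivity
    _ = _ := by
        field_simp

end Lower

/-! ### The minimum of the objective -/

section SingleLetter

variable {U X Y : Type*} [Fintype U] [Fintype X] [Fintype Y]
  {Q : U → X → Y → ℝ} {P : U × X → ℝ} {W : X → Y → ℝ}

theorem continuous_ent {A : Type*} [Fintype A] : Continuous (ent : (A → ℝ) → ℝ) :=
  continuous_finsetSum _ fun a _ => Real.continuous_negMulLog.comp (continuous_apply a)

theorem continuous_mUX : Continuous (mUX : (U → X → Y → ℝ) → U × X → ℝ) := by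
  unfold mUX; fun_prop

theorem continuous_mUY : Continuous (mUY : (U → X → Y → ℝ) → U × Y → ℝ) := by
  unfold mUY margUY; fun_prop

theorem continuous_margY : Continuous (margY : (U → X → Y → ℝ) → Y → ℝ) := by
  unfold margY; fun_prop

theorem continuous_unc : Continuous (unc : (U → X → Y → ℝ) → U × X × Y → ℝ) := by
  unfold unc; fun_prop

theorem continuous_margU_mUX : Continuous fun Q : U → X → Y → ℝ => margU (mUX Q) := by
  unfold margU mUX; fun_prop

theorem continuous_iU : Continuous (iU : (U → X → Y → ℝ) → ℝ) :=
  ((continuous_ent.comp continuous_margU_mUX).add (continuous_ent.comp continuous_margY)).sub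
    (continuous_ent.comp continuous_mUY)

theorem continuous_iX : Continuous (iX : (U → X → Y → ℝ) → ℝ) :=
  (((continuous_ent.comp continuous_mUX).add (continuous_ent.comp continuous_mUY)).sub
    (continuous_ent.comp continuous_unc)).sub (continuous_ent.comp continuous_margU_mUX)

theorem continuous_logLik (W : X → Y → ℝ) : Continuous (logLik W : (U → X → Y → ℝ) → ℝ) := by
  unfold logLik unc; fun_prop

theorem continuous_divg (W : X → Y → ℝ) : Continuous (divg W : (U → X → Y → ℝ) → ℝ) :=
  ((continuous_ent.comp continuous_mUX).sub (continuous_ent.comp continuous_unc)).sub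
    (continuous_logLik W)

theorem continuous_typeExp (W : X → Y → ℝ) :
    Continuous fun p : ℝ × ℝ × (U → X → Y → ℝ) => typeExp W p.1 p.2.1 p.2.2 := by
  have h1 := (continuous_divg (U := U) W).comp
    (continuous_snd.comp (continuous_snd (X := ℝ) (Y := ℝ × (U → X → Y → ℝ))))
  have h2 := (continuous_iU (U := U) (X := X) (Y := Y)).comp
    (continuous_snd.comp (continuous_snd (X := ℝ) (Y := ℝ × (U → X → Y → ℝ))))
  have h3 := (continuous_iX (U := U) (X := X) (Y := Y)).comp
    (continuous_snd.comp (continuous_snd (X := ℝ) (Y := ℝ × (U → X → Y → ℝ))))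
  have h4 := continuous_fst.comp (continuous_snd (X := ℝ) (Y := ℝ × (U → X → Y → ℝ)))
  exact h1.add (continuous_const.max
    ((h2.add (continuous_const.max (h3.sub h4))).sub continuous_fst))

/-- A positive entry forces positive marginals, so the logarithm splits; zero entries contribute
nothing. The entropy form makes continuity immediate. -/
theorem mutualInfo_eq_ent {q : U → Y → ℝ} (hq : ∀ u y, 0 ≤ q u y) :
    mutualInfo q = ent (fun u => ∑ y, q u y) + ent (fun y => ∑ u, q u y)
      - ent (fun p : U × Y => q p.1 p.2) := by
  have h : ∀ u y, q u y * Real.log (q u y / ((∑ y', q u y') * ∑ u', q u' y)) =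
      q u y * Real.log (q u y) - q u y * Real.log (∑ y', q u y')
        - q u y * Real.log (∑ u', q u' y) := by
    intro u y
    rcases (hq u y).eq_or_lt with h | h
    · simp [← h]
    · have h1 : 0 < ∑ y', q u y' :=
        h.trans_le (Finset.single_le_sum (fun y' _ => hq u y') (Finset.mem_univ y))
      have h2 : 0 < ∑ u', q u' y :=
        h.trans_le (Finset.single_le_sum (f := fun u' => q u' y) (fun u' _ => hq u' y)
          (Finset.mem_univ u))
      rw [Real.log_div h.ne' (by positivity), Real.log_mul h1.ne' h2.ne']
      ring
  have h3 : ∑ u, ∑ y, q u y * Real.log (∑ u', q u' y) =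
      ∑ y, (∑ u, q u y) * Real.log (∑ u', q u' y) := by
    rw [Finset.sum_comm]
    exact Finset.sum_congr rfl fun y _ => (Finset.sum_mul _ _ _).symm
  simp only [mutualInfo, h, Finset.sum_sub_distrib, ent, Real.negMulLog, Fintype.sum_prod_type, h3,
    ← Finset.sum_mul, neg_mul, Finset.sum_neg_distrib]
  ring

theorem mutualInfo_margUY (hQ : ∀ u x y, 0 ≤ Q u x y) : mutualInfo (margUY Q) = iU Q := by
  rw [mutualInfo_eq_ent (q := margUY Q) fun u y => Finset.sum_nonneg fun x _ => hQ u x y, iU]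
  congr 2
  congr 1
  funext u
  exact Finset.sum_comm

theorem condMutualInfo_eq (hQ : ∀ u x y, 0 ≤ Q u x y) : condMutualInfo Q = iX Q := by
  have h : ∀ u x y, Q u x y * Real.log (Q u x y * (∑ x', ∑ y', Q u x' y') /
      ((∑ y', Q u x y') * ∑ x', Q u x' y)) =
      Q u x y * Real.log (Q u x y) + Q u x y * Real.log (∑ x', ∑ y', Q u x' y')
        - Q u x y * Real.log (∑ y', Q u x y') - Q u x y * Real.log (∑ x', Q u x' y) := by
    intro u x y
    rcases (hQ u x y).eq_or_lt with h | h
    · simp [← h]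
    · have h1 : 0 < ∑ y', Q u x y' :=
        h.trans_le (Finset.single_le_sum (fun y' _ => hQ u x y') (Finset.mem_univ y))
      have h2 : 0 < ∑ x', Q u x' y :=
        h.trans_le (Finset.single_le_sum (f := fun x' => Q u x' y) (fun x' _ => hQ u x' y)
          (Finset.mem_univ x))
      have h3 : 0 < ∑ x', ∑ y', Q u x' y' :=
        h1.trans_le (Finset.single_le_sum (f := fun x' => ∑ y', Q u x' y')
          (fun x' _ => Finset.sum_nonneg fun y' _ => hQ u x' y') (Finset.mem_univ x))
      rw [Real.log_div (by positivity) (by positivity), Real.log_mul h.ne' h3.ne',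
        Real.log_mul h1.ne' h2.ne']
      ring
  have h4 : ∑ u, ∑ x, ∑ y, Q u x y * Real.log (∑ x', Q u x' y) =
      ∑ u, ∑ y, (∑ x, Q u x y) * Real.log (∑ x', Q u x' y) := by
    refine Finset.sum_congr rfl fun u _ => ?_
    rw [Finset.sum_comm]
    exact Finset.sum_congr rfl fun y _ => (Finset.sum_mul _ _ _).symm
  simp only [condMutualInfo, h, Finset.sum_sub_distrib, Finset.sum_add_distrib, iX, ent,
    Real.negMulLog, Fintype.sum_prod_type, h4, unc, mUX, mUY, margU, margUY,
    ← Finset.sum_mul, neg_mul, Finset.sum_neg_distrib]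
  ring

theorem f_of_supp (hs : Supp W Q) : f W (margXY Q) = ((logLik W Q : ℝ) : EReal) := by
  rw [f, if_neg]
  · congr 1
    simp only [logLik, unc, margXY, Fintype.sum_prod_type, Finset.sum_mul]
    exact (Finset.sum_congr rfl fun x _ => Finset.sum_comm).trans Finset.sum_comm
  · rintro ⟨x, y, hne, h0⟩
    exact hne (Finset.sum_eq_zero fun u _ => hs u x y h0)

theorem f_of_not_supp (hQ : ∀ u x y, 0 ≤ Q u x y) (hs : ¬Supp W Q) : f W (margXY Q) = ⊥ := by
  rw [f, if_pos]
  simp only [Supp, not_forall] at hs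
  obtain ⟨u, x, y, h0, hne⟩ := hs
  refine ⟨x, y, fun h => hne ?_, h0⟩
  exact (Finset.sum_eq_zero_iff_of_nonneg fun u _ => hQ u x y).1 h u (Finset.mem_univ u)

/-- The key identity: `iU + iX = ent (mUX Q) + ent (margY Q) - ent (unc Q)`, and `[t]₊ - [-t]₊ = t`.
Among joint distributions with the same output marginal, no larger cost and no smaller score
together mean no larger divergence. -/
theorem divg_eq (W : X → Y → ℝ) (R₂ : ℝ) (Q : U → X → Y → ℝ) :
    divg W Q = cost R₂ Q - (logLik W Q + max 0 (R₂ - iX Q)) + R₂ - ent (margY Q) := by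
  have h : max 0 (iX Q - R₂) - max 0 (R₂ - iX Q) = iX Q - R₂ := by
    rcases le_total (iX Q) R₂ with h | h
    · rw [max_eq_left (by linarith), max_eq_right (by linarith)]; ring
    · rw [max_eq_right (by linarith), max_eq_left (by linarith)]; ring
  rw [divg, cost, iU]
  rw [iX] at h ⊢
  linarith

section Channel

variable {V : U → X → Y → ℝ}

theorem mul_channel_nonneg (hP : ∀ p, 0 ≤ P p) (hV : ∀ u x, V u x ∈ stdSimplex ℝ Y)
    (u : U) (x : X) (y : Y) : 0 ≤ P (u, x) * V u x y := mul_nonneg (hP _) ((hV u x).1 y)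

theorem mUX_mul_channel (hV : ∀ u x, V u x ∈ stdSimplex ℝ Y) :
    mUX (fun u x y => P (u, x) * V u x y) = P := by
  funext p
  simp only [mUX, ← Finset.mul_sum, (hV p.1 p.2).2, mul_one]

theorem condDiv_of_supp (hV : ∀ u x, V u x ∈ stdSimplex ℝ Y)
    (hs : Supp W (fun u x y => P (u, x) * V u x y)) :
    condDiv V W P = ((divg W (fun u x y => P (u, x) * V u x y) : ℝ) : EReal) := by
  rw [condDiv, if_neg]
  · congr 1
    have h : ∀ u x y, P (u, x) * (V u x y * Real.log (V u x y / W x y)) =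
        P (u, x) * V u x y * Real.log (P (u, x) * V u x y)
          - P (u, x) * V u x y * Real.log (P (u, x))
          - P (u, x) * V u x y * Real.log (W x y) := by
      intro u x y
      by_cases h1 : P (u, x) = 0
      · simp [h1]
      by_cases h2 : V u x y = 0
      · simp [h2]
      have h3 : W x y ≠ 0 := fun h3 => mul_ne_zero h1 h2 (hs u x y h3)
      rw [Real.log_div h2 h3, Real.log_mul h1 h2]
      ring
    have h4 : ∀ u x, ∑ y, P (u, x) * V u x y = P (u, x) := fun u x => by
      rw [← Finset.mul_sum, (hV u x).2, mul_one]
    simp only [divg, mUX_mul_channel hV, ent, Real.negMulLog, logLik, unc, Fintype.sum_prod_type,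
      Finset.mul_sum, h, Finset.sum_sub_distrib, ← Finset.sum_mul, h4, neg_mul,
      Finset.sum_neg_distrib]
    ring
  · rintro ⟨u, x, y, h1, h2, h3⟩
    exact mul_ne_zero h1 h2 (hs u x y h3)

theorem condDiv_of_not_supp (hs : ¬Supp W (fun u x y => P (u, x) * V u x y)) :
    condDiv V W P = ⊤ := by
  rw [condDiv, if_pos]
  simp only [Supp, not_forall] at hs
  obtain ⟨u, x, y, h0, hne⟩ := hs
  exact ⟨u, x, y, left_ne_zero_of_mul hne, right_ne_zero_of_mul hne, h0⟩

end Channel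

/-! ### From conditional distributions to joint distributions: `E₁`, `E₂` and `s₀` as optimizations
over `Q`. -/

section Conditionals

/-- A conditional distribution `Q_{X|UY}` of `Q`. -/
theorem exists_cond_X [Nonempty X] (hQ : ∀ u x y, 0 ≤ Q u x y) :
    ∃ T : U → Y → X → ℝ, (∀ u y, T u y ∈ stdSimplex ℝ X) ∧ jointOf (margUY Q) T = Q := by
  classical
  -- Where the marginal vanishes, any point of the simplex will do; a vertex is taken.
  refine ⟨fun u y x => if margUY Q u y = 0 then Pi.single (M := fun _ => ℝ) (Classical.arbitrary X) 1 x
    else Q u x y / margUY Q u y, fun u y => ?_, ?_⟩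
  · by_cases h : margUY Q u y = 0
    · simp only [h, if_true]
      exact single_mem_stdSimplex ℝ _
    · simp only [h, if_false]
      refine ⟨fun x => div_nonneg (hQ u x y) (Finset.sum_nonneg fun x _ => hQ u x y), ?_⟩
      rw [← Finset.sum_div]
      exact div_self h
  · funext u x y
    simp only [jointOf]
    split_ifs with h
    · rw [h, zero_mul]
      exact ((Finset.sum_eq_zero_iff_of_nonneg fun x _ => hQ u x y).1 h x (Finset.mem_univ x)).symm
    · exact mul_div_cancel₀ _ h

/-- A conditional distribution `Q_{U|Y}` of `Q`. -/
theorem exists_cond_U [Nonempty U] (hQ : ∀ u x y, 0 ≤ Q u x y) :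
    ∃ K : Y → U → ℝ, (∀ y, K y ∈ stdSimplex ℝ U) ∧
      (fun u y => margY Q y * K y u) = margUY Q := by
  classical
  have h0 : ∀ u y, 0 ≤ margUY Q u y := fun u y => Finset.sum_nonneg fun x _ => hQ u x y
  have hs : ∀ y, ∑ u, margUY Q u y = margY Q y := fun y => rfl
  refine ⟨fun y u => if margY Q y = 0 then Pi.single (M := fun _ => ℝ) (Classical.arbitrary U) 1 u
    else margUY Q u y / margY Q y, fun y => ?_, ?_⟩
  · by_cases h : margY Q y = 0
    · simp only [h, if_true]
      exact single_mem_stdSimplex ℝ _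
    · simp only [h, if_false]
      refine ⟨fun u => div_nonneg (h0 u y) ?_, ?_⟩
      · rw [← hs]
        exact Finset.sum_nonneg fun u _ => h0 u y
      · rw [← Finset.sum_div, hs]
        exact div_self h
  · funext u y
    beta_reduce
    split_ifs with h
    · rw [h, zero_mul]
      exact ((Finset.sum_eq_zero_iff_of_nonneg fun u _ => h0 u y).1 h u (Finset.mem_univ u)).symm
    · exact mul_div_cancel₀ _ h

theorem jointOf_nonneg {q : U → Y → ℝ} (hq : ∀ u y, 0 ≤ q u y) {T : U → Y → X → ℝ}
    (hT : ∀ u y, T u y ∈ stdSimplex ℝ X) (u : U) (x : X) (y : Y) : 0 ≤ jointOf q T u x y :=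
  mul_nonneg (hq u y) ((hT u y).1 x)

theorem margUY_jointOf {q : U → Y → ℝ} {T : U → Y → X → ℝ}
    (hT : ∀ u y, T u y ∈ stdSimplex ℝ X) : margUY (jointOf q T) = q := by
  funext u y
  simp only [margUY, jointOf, ← Finset.mul_sum, (hT u y).2, mul_one]

theorem mUX_jointOf {q : U → Y → ℝ} {T : U → Y → X → ℝ} (hT : T ∈ S P q) :
    mUX (jointOf q T) = P := funext fun p => hT.2 p.1 p.2

theorem mem_S_of_jointOf_eq {q : U → Y → ℝ} {T : U → Y → X → ℝ}
    (hT : ∀ u y, T u y ∈ stdSimplex ℝ X) (h : mUX (jointOf q T) = P) : T ∈ S P q :=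
  ⟨hT, fun u x => congrFun h (u, x)⟩

theorem margU_eq_of_mUX (h : mUX Q = P) (u : U) : ∑ y, margUY Q u y = margU P u := by
  rw [← h]
  exact Finset.sum_comm

/-- Disintegrating `Q` into `Q_Y`, `Q_{U|Y}` and `Q_{X|UY}` makes it a candidate in both nested
infima. -/
theorem E₂_le [Nonempty U] [Nonempty X] {R₂ : ℝ} {s : EReal} (hQ : ∀ u x y, 0 ≤ Q u x y)
    (hP : mUX Q = P)
    (hs : s ≤ f W (margXY Q) + ((max 0 (R₂ - iX Q) : ℝ) : EReal)) :
    E₂ P W R₂ s (margY Q) ≤ ((cost R₂ Q : ℝ) : EReal) := by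
  obtain ⟨K, hK, hKQ⟩ := exists_cond_U hQ
  obtain ⟨T, hT, hTQ⟩ := exists_cond_X hQ
  refine iInf₂_le_of_le K ⟨hK, fun u => ?_⟩ ?_
  · rw [← margU_eq_of_mUX hP, ← hKQ]
  · rw [hKQ, mutualInfo_margUY hQ, cost, EReal.coe_add]
    refine add_le_add le_rfl ?_
    refine iInf₂_le_of_le T ⟨mem_S_of_jointOf_eq hT (by rw [hTQ, hP]), ?_⟩ ?_
    · rw [hTQ, condMutualInfo_eq hQ]
      exact hs
    · rw [hTQ, condMutualInfo_eq hQ]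

/-- Conversely, each pair of kernels feasible in the nested infima composes to a joint distribution
`Q`, so bounding `cost` over such `Q` is enough. -/
theorem le_E₂ {R₂ b : ℝ} {s : EReal} {q : Y → ℝ} (hq : ∀ y, 0 ≤ q y)
    (h : ∀ Q : U → X → Y → ℝ, (∀ u x y, 0 ≤ Q u x y) → mUX Q = P → margY Q = q →
      s ≤ f W (margXY Q) + ((max 0 (R₂ - iX Q) : ℝ) : EReal) → b ≤ cost R₂ Q) :
    (b : EReal) ≤ E₂ P W R₂ s q := by
  refine le_iInf₂ fun K hK => ?_
  have hq' : ∀ u y, 0 ≤ q y * K y u := fun u y => mul_nonneg (hq y) ((hK.1 y).1 u)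
  set m := mutualInfo (fun u y => q y * K y u) with hm
  have h1 : ((b - m : ℝ) : EReal) ≤ E₁ P W R₂ s (fun u y => q y * K y u) := by
    refine le_iInf₂ fun T hT => ?_
    have hQ := jointOf_nonneg hq' hT.1.1
    have hc := hT.2
    rw [condMutualInfo_eq hQ] at hc ⊢
    have hY : margY (jointOf (fun u y => q y * K y u) T) = q := by
      funext y
      have h2 : margY (jointOf (fun u y => q y * K y u) T) y =
          ∑ u, margUY (jointOf (fun u y => q y * K y u) T) u y := rfl
      rw [h2, margUY_jointOf hT.1.1, ← Finset.mul_sum, (hK.1 y).2, mul_one]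
    have h3 := h _ hQ (mUX_jointOf hT.1) hY hc
    have h4 := mutualInfo_margUY hQ
    rw [margUY_jointOf hT.1.1, ← hm] at h4
    rw [cost, ← h4] at h3
    exact EReal.coe_le_coe_iff.2 (by linarith)
  calc (b : EReal) = (m : EReal) + ((b - m : ℝ) : EReal) := by
        rw [← EReal.coe_add]; congr 1; ring
    _ ≤ _ := add_le_add le_rfl h1

theorem le_s₀ [Nonempty X] {R₂ : ℝ} (hQ : ∀ u x y, 0 ≤ Q u x y) (hP : mUX Q = P)
    (hs : Supp W Q) (hI : iX Q ≤ R₂) :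
    ((R₂ + (logLik W Q - iX Q) : ℝ) : EReal) ≤ s₀ P W R₂ (margUY Q) := by
  obtain ⟨T, hT, hTQ⟩ := exists_cond_X hQ
  rw [s₀, EReal.coe_add]
  refine add_le_add le_rfl ?_
  refine le_iSup₂_of_le T ⟨mem_S_of_jointOf_eq hT (by rw [hTQ, hP]), ?_⟩ ?_
  · rw [hTQ, condMutualInfo_eq hQ]; exact hI
  · rw [hTQ, condMutualInfo_eq hQ, f_of_supp hs, EReal.coe_sub]

/-- The maximum in the definition of `s₀` is attained. -/
theorem s₀_attained {R₂ : ℝ} {q : U → Y → ℝ} (hq : ∀ u y, 0 ≤ q u y)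
    (h : s₀ P W R₂ q ≠ ⊥) :
    ∃ Q : U → X → Y → ℝ, (∀ u x y, 0 ≤ Q u x y) ∧ mUX Q = P ∧ margUY Q = q ∧ Supp W Q ∧
      iX Q ≤ R₂ ∧ s₀ P W R₂ q ≤ ((R₂ + (logLik W Q - iX Q) : ℝ) : EReal) := by
  -- Outside the support of the channel `f` is `⊥`, so only these kernels matter to the supremum. On
  -- this compact set the maximand is real and continuous; if it is empty, `s₀ = ⊥`.
  set 𝒦 : Set (U → Y → X → ℝ) := {T | T ∈ S P q ∧ iX (jointOf q T) ≤ R₂ ∧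
    Supp W (jointOf q T)} with h𝒦
  have hcj : Continuous fun T : U → Y → X → ℝ => jointOf q T := by unfold jointOf; fun_prop
  have hclosed : IsClosed 𝒦 := by
    have h1 : IsClosed {T : U → Y → X → ℝ | ∀ u y, T u y ∈ stdSimplex ℝ X} := by
      simp only [Set.ofPred_forall]
      exact isClosed_iInter fun u => isClosed_iInter fun y =>
        (isClosed_stdSimplex ℝ X).preimage (continuous_apply_apply u y)
    have h2 : IsClosed {T : U → Y → X → ℝ | ∀ u x, ∑ y, q u y * T u y x = P (u, x)} := by
      simp only [Set.ofPred_forall]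
      exact isClosed_iInter fun u => isClosed_iInter fun x =>
        isClosed_eq (by fun_prop) continuous_const
    have h3 : IsClosed {T : U → Y → X → ℝ | iX (jointOf q T) ≤ R₂} :=
      isClosed_le (continuous_iX.comp hcj) continuous_const
    have h4 : IsClosed {T : U → Y → X → ℝ | Supp W (jointOf q T)} := by
      simp only [Supp, Set.ofPred_forall]
      exact isClosed_iInter fun u => isClosed_iInter fun x => isClosed_iInter fun y =>
        isClosed_iInter fun _ => isClosed_eq (by unfold jointOf; fun_prop) continuous_const
    exact (h1.inter h2).inter (h3.inter h4)
  have hcompact : IsCompact 𝒦 := by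
    refine (isCompact_Icc (a := (0 : U → Y → X → ℝ)) (b := 1)).of_isClosed_subset hclosed fun T hT => ?_
    exact ⟨fun u y x => (hT.1.1 u y).1 x, fun u y x => by
      have := Finset.single_le_sum (fun x _ => (hT.1.1 u y).1 x) (Finset.mem_univ x)
      rwa [(hT.1.1 u y).2] at this⟩
  have hval : ∀ T, T ∈ S P q → ¬Supp W (jointOf q T) → f W (margXY (jointOf q T)) -
      ((condMutualInfo (jointOf q T) : ℝ) : EReal) = ⊥ := by
    intro T hT hs
    rw [f_of_not_supp (jointOf_nonneg hq hT.1) hs, EReal.bot_sub]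
  rcases 𝒦.eq_empty_or_nonempty with he | hne
  · exfalso
    apply h
    rw [s₀, EReal.add_eq_bot_iff]
    right
    rw [iSup₂_eq_bot]
    intro T hT
    refine hval T hT.1 fun hs => ?_
    have hc := hT.2
    rw [condMutualInfo_eq (jointOf_nonneg hq hT.1.1)] at hc
    have : T ∈ 𝒦 := ⟨hT.1, hc, hs⟩
    rw [he] at this
    exact this
  · obtain ⟨T₀, hT₀, hmax⟩ := hcompact.exists_isMaxOn hne
      (f := fun T => logLik W (jointOf q T) - iX (jointOf q T))
      (((continuous_logLik W).comp hcj).sub (continuous_iX.comp hcj)).continuousOn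
    refine ⟨jointOf q T₀, jointOf_nonneg hq hT₀.1.1, mUX_jointOf hT₀.1,
      margUY_jointOf hT₀.1.1, hT₀.2.2, hT₀.2.1, ?_⟩
    rw [s₀, EReal.coe_add]
    refine add_le_add le_rfl (iSup₂_le fun T hT => ?_)
    by_cases hs : Supp W (jointOf q T)
    · have hc := hT.2
      rw [condMutualInfo_eq (jointOf_nonneg hq hT.1.1)] at hc ⊢
      rw [f_of_supp hs, ← EReal.coe_sub]
      exact EReal.coe_le_coe_iff.2 (hmax ⟨hT.1, hc, hs⟩)
    · rw [hval T hT.1 hs]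
      exact bot_le

end Conditionals

end SingleLetter

/-! ### Equality of the minima of `objective` and `typeExp`. -/

section Minimum

variable {U X Y : Type*} [Fintype U] [Fintype X] [Fintype Y]
  {Q : U → X → Y → ℝ} {P : U × X → ℝ} {W : X → Y → ℝ}

/-- The joint distributions with a given marginal `Q_{UX}` that are absolutely continuous with
respect to the channel. -/
def admissible (P : U × X → ℝ) (W : X → Y → ℝ) : Set (U → X → Y → ℝ) :=
  {Q | (∀ u x y, 0 ≤ Q u x y) ∧ mUX Q = P ∧ Supp W Q}

theorem isClosed_nonneg_supp (W : X → Y → ℝ) :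
    IsClosed {Q : U → X → Y → ℝ | (∀ u x y, 0 ≤ Q u x y) ∧ Supp W Q} := by
  have h1 : IsClosed {Q : U → X → Y → ℝ | ∀ u x y, 0 ≤ Q u x y} := by
    simp only [Set.ofPred_forall]
    exact isClosed_iInter fun u => isClosed_iInter fun x => isClosed_iInter fun y =>
      isClosed_le continuous_const (by fun_prop)
  have h2 : IsClosed {Q : U → X → Y → ℝ | Supp W Q} := by
    simp only [Supp, Set.ofPred_forall]
    exact isClosed_iInter fun u => isClosed_iInter fun x => isClosed_iInter fun y =>
      isClosed_iInter fun _ => isClosed_eq (by fun_prop) continuous_const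
  exact h1.inter h2

theorem le_mUX (hQ : ∀ u x y, 0 ≤ Q u x y) (u : U) (x : X) (y : Y) : Q u x y ≤ mUX Q (u, x) :=
  Finset.single_le_sum (fun y _ => hQ u x y) (Finset.mem_univ y)

theorem isClosed_admissible (P : U × X → ℝ) (W : X → Y → ℝ) : IsClosed (admissible P W) := by
  have h1 := (isClosed_nonneg_supp (U := U) W).inter
    (isClosed_eq continuous_mUX (continuous_const (y := P)))
  have h2 : admissible P W = {Q : U → X → Y → ℝ | (∀ u x y, 0 ≤ Q u x y) ∧ Supp W Q} ∩
      {Q | mUX Q = P} := Set.ext fun Q =>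
    ⟨fun h => ⟨⟨h.1, h.2.2⟩, h.2.1⟩, fun h => ⟨h.1.1, h.2, h.1.2⟩⟩
  rw [h2]
  exact h1

theorem isCompact_admissible (P : U × X → ℝ) (W : X → Y → ℝ) : IsCompact (admissible P W) := by
  refine (isCompact_Icc (a := (0 : U → X → Y → ℝ)) (b := fun u x _ => P (u, x))).of_isClosed_subset
    (isClosed_admissible P W) fun Q hQ => ⟨fun u x y => hQ.1 u x y, fun u x y => ?_⟩
  have := le_mUX hQ.1 u x y
  rwa [hQ.2.1] at this

theorem continuous_typeExp_right (W : X → Y → ℝ) (R R₂ : ℝ) :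
    Continuous (typeExp W R R₂ : (U → X → Y → ℝ) → ℝ) :=
  (continuous_divg W).add (continuous_const.max ((continuous_iU.add
    (continuous_const.max (continuous_iX.sub continuous_const))).sub continuous_const))

theorem exists_typeExp_min (hP : ∀ p, 0 ≤ P p) (hW : ∀ x, W x ∈ stdSimplex ℝ Y) (R R₂ : ℝ) :
    ∃ Q ∈ admissible P W, ∀ Q' ∈ admissible P W, typeExp W R R₂ Q ≤ typeExp W R R₂ Q' := by
  have hne : (admissible P W).Nonempty :=
    ⟨fun u x y => P (u, x) * W x y,
      mul_channel_nonneg (V := fun _ => W) hP (fun _ x => hW x),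
      mUX_mul_channel (V := fun _ => W) (fun _ x => hW x), fun u x y h => by simp [h]⟩
  obtain ⟨Q, hQ, hmin⟩ := (isCompact_admissible P W).exists_isMinOn hne
    (continuous_typeExp_right W R R₂).continuousOn
  exact ⟨Q, hQ, fun Q' hQ' => hmin hQ'⟩

/-- A channel that produces an admissible joint distribution. -/
theorem exists_channel (hW : ∀ x, W x ∈ stdSimplex ℝ Y) (hQ : Q ∈ admissible P W) :
    ∃ V : U → X → Y → ℝ, (∀ u x, V u x ∈ stdSimplex ℝ Y) ∧
      (fun u x y => P (u, x) * V u x y) = Q ∧ ∀ u x y, W x y = 0 → V u x y = 0 := by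
  classical
  obtain ⟨h0, hP, hs⟩ := hQ
  have hsum : ∀ u x, ∑ y, Q u x y = P (u, x) := fun u x => congrFun hP (u, x)
  -- Taking `W` where `P` vanishes keeps the zeros of `W` at every `(u, x)`; the approximating types
  -- may charge pairs that `P` does not.
  refine ⟨fun u x y => if P (u, x) = 0 then W x y else Q u x y / P (u, x), fun u x => ?_, ?_, ?_⟩
  · by_cases h : P (u, x) = 0
    · simpa only [h, if_true] using hW x
    · simp only [h, if_false]
      refine ⟨fun y => div_nonneg (h0 u x y) ?_, ?_⟩
      · rw [← hsum]
        exact Finset.sum_nonneg fun y _ => h0 u x y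
      · rw [← Finset.sum_div, hsum, div_self h]
  · funext u x y
    beta_reduce
    split_ifs with h
    · rw [h, zero_mul]
      rw [← hsum] at h
      exact ((Finset.sum_eq_zero_iff_of_nonneg fun y _ => h0 u x y).1 h y (Finset.mem_univ y)).symm
    · exact mul_div_cancel₀ _ h
  · intro u x y h
    beta_reduce
    rw [h, hs u x y h]
    simp

/-- The positive part is active only when `iX Q ≤ R₂`, and then `Q` is a candidate in `s₀`;
otherwise the score is just `f`. -/
theorem le_s₁ [Nonempty X] {R₂ : ℝ} (hQ : Q ∈ admissible P W) :
    ((logLik W Q + max 0 (R₂ - iX Q) : ℝ) : EReal) ≤ s₁ P W R₂ Q := by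
  rcases le_total (iX Q) R₂ with h | h
  · refine le_trans ?_ ((le_s₀ hQ.1 hQ.2.1 hQ.2.2 h).trans (le_max_left _ _))
    rw [max_eq_right (by linarith)]
    exact EReal.coe_le_coe_iff.2 (by linarith)
  · refine le_trans ?_ (le_max_right _ _)
    rw [max_eq_left (by linarith), add_zero, f_of_supp hQ.2.2]

/-- Every channel has an objective at least as large as the exponent of some joint type. -/
theorem le_objective [Nonempty X] (hP : ∀ p, 0 ≤ P p) {R R₂ E : ℝ}
    (hE : ∀ Q ∈ admissible P W, E ≤ typeExp W R R₂ Q) {V : U → X → Y → ℝ}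
    (hV : ∀ u x, V u x ∈ stdSimplex ℝ Y) : (E : EReal) ≤ objective P W R R₂ V := by
  rw [objective]
  set Q : U → X → Y → ℝ := fun u x y => P (u, x) * V u x y with hQ
  by_cases hs : Supp W Q
  · have hQa : Q ∈ admissible P W := ⟨mul_channel_nonneg hP hV, mUX_mul_channel hV, hs⟩
    rw [condDiv_of_supp hV hs, ← hQ]
    by_cases hEd : E ≤ divg W Q
    · calc (E : EReal) ≤ (divg W Q : EReal) + 0 := by
            rw [add_zero]; exact EReal.coe_le_coe_iff.2 hEd
        _ ≤ _ := add_le_add le_rfl (le_max_left _ _)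
    push Not at hEd
    have hb : ((E - divg W Q + R : ℝ) : EReal) ≤ E₂ P W R₂ (s₁ P W R₂ Q) (margY Q) := by
      refine le_E₂ (fun y => Finset.sum_nonneg fun u _ => Finset.sum_nonneg fun x _ =>
        hQa.1 u x y) fun Q' h0 hP' hY hsc => ?_
      -- If the competitor `Q'` costs at least as much as `Q`, the bound `hE` for `Q` suffices.
      -- Otherwise its score is at least that of `Q`, so `divg_eq` gives `divg W Q' ≤ divg W Q`, and
      -- `hE` is used for `Q'`.
      have key : E ≤ divg W Q + max 0 (cost R₂ Q' - R) := by
        rcases le_total (cost R₂ Q) (cost R₂ Q') with hc | hc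
        · refine (hE Q hQa).trans ?_
          rw [typeExp]
          exact add_le_add le_rfl (max_le_max le_rfl (by linarith))
        · have hg := (le_s₁ hQa).trans hsc
          have hs' : Supp W Q' := by
            by_contra hns
            rw [f_of_not_supp h0 hns, EReal.bot_add] at hg
            exact absurd hg (not_le.2 (EReal.bot_lt_coe _))
          rw [f_of_supp hs', ← EReal.coe_add, EReal.coe_le_coe_iff] at hg
          refine (hE Q' ⟨h0, hP', hs'⟩).trans ?_
          rw [typeExp]
          refine add_le_add ?_ le_rfl
          rw [divg_eq W R₂ Q, divg_eq W R₂ Q', hY]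
          linarith
      rcases le_total (cost R₂ Q' - R) 0 with h | h
      · rw [max_eq_left h] at key
        linarith
      · rw [max_eq_right h] at key
        linarith
    have h1 : ((E - divg W Q : ℝ) : EReal) ≤
        E₂ P W R₂ (s₁ P W R₂ Q) (margY Q) - (R : EReal) := by
      have h2 := EReal.sub_le_sub hb (le_refl (R : EReal))
      rwa [← EReal.coe_sub, add_sub_cancel_right] at h2
    calc (E : EReal) = (divg W Q : EReal) + ((E - divg W Q : ℝ) : EReal) := by
          rw [← EReal.coe_add]; congr 1; ring
      _ ≤ _ := add_le_add le_rfl (h1.trans (le_max_right _ _))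
  · rw [condDiv_of_not_supp hs, EReal.top_add_of_ne_bot]
    · exact le_top
    · exact ne_of_gt (lt_of_lt_of_le (EReal.bot_lt_coe 0) (le_max_left _ _))

/-- If the threshold is `f`, `Q` itself meets it. If it is `s₀`, a maximizer meets it, with the same
`Q_{UY}` and `I(X;Y|U) ≤ R₂`, hence with cost only `iU Q`. -/
theorem E₂_s₁_le [Nonempty U] [Nonempty X] {R₂ : ℝ} (hQ : Q ∈ admissible P W) :
    E₂ P W R₂ (s₁ P W R₂ Q) (margY Q) ≤ ((cost R₂ Q : ℝ) : EReal) := by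
  have hq : ∀ u y, 0 ≤ margUY Q u y := fun u y => Finset.sum_nonneg fun x _ => hQ.1 u x y
  rcases le_or_gt (s₀ P W R₂ (margUY Q)) (f W (margXY Q)) with h | h
  · refine E₂_le hQ.1 hQ.2.1 ?_
    rw [s₁, max_eq_right h]
    calc f W (margXY Q) = f W (margXY Q) + 0 := (add_zero _).symm
      _ ≤ _ := add_le_add le_rfl (EReal.coe_le_coe_iff.2 (le_max_left _ _))
  · obtain ⟨Q', h0, hP', hUY, hs', hI, hle⟩ := s₀_attained hq (ne_bot_of_gt h)
    have hY : margY Q' = margY Q := by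
      funext y
      have h1 : ∀ Q : U → X → Y → ℝ, margY Q y = ∑ u, margUY Q u y := fun _ => rfl
      rw [h1, h1, hUY]
    have h2 : E₂ P W R₂ (s₁ P W R₂ Q) (margY Q') ≤ ((cost R₂ Q' : ℝ) : EReal) := by
      refine E₂_le h0 hP' ?_
      rw [s₁, max_eq_left h.le, f_of_supp hs', ← EReal.coe_add, max_eq_right (by linarith)]
      refine hle.trans (EReal.coe_le_coe_iff.2 (by linarith))
    rw [hY] at h2
    refine h2.trans (EReal.coe_le_coe_iff.2 ?_)
    have h3 : iU Q' = iU Q := by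
      have h4 : mUY Q' = mUY Q := by
        funext p
        rw [mUY, hUY, mUY]
      rw [iU, iU, hP', hQ.2.1, hY, h4]
    rw [cost, cost, h3, max_eq_left (by linarith)]
    exact add_le_add le_rfl (le_max_left _ _)

theorem objective_le [Nonempty U] [Nonempty X] {R R₂ : ℝ} {V : U → X → Y → ℝ}
    (hV : ∀ u x, V u x ∈ stdSimplex ℝ Y) (hVQ : (fun u x y => P (u, x) * V u x y) = Q)
    (hQ : Q ∈ admissible P W) : objective P W R R₂ V ≤ ((typeExp W R R₂ Q : ℝ) : EReal) := by
  rw [objective, condDiv_of_supp hV (by rw [hVQ]; exact hQ.2.2), hVQ, typeExp, EReal.coe_add]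
  refine add_le_add le_rfl (max_le (EReal.coe_le_coe_iff.2 (le_max_left _ _)) ?_)
  refine (EReal.sub_le_sub (E₂_s₁_le hQ) le_rfl).trans ?_
  rw [← EReal.coe_sub]
  exact EReal.coe_le_coe_iff.2 (le_max_right _ _)

/-- The minimum of the objective is the minimal exponent of the admissible joint distributions. -/
theorem isLeast_objective (hP : P ∈ stdSimplex ℝ (U × X)) (hW : ∀ x, W x ∈ stdSimplex ℝ Y)
    {R R₂ : ℝ} (hQ : Q ∈ admissible P W)
    (hmin : ∀ Q' ∈ admissible P W, typeExp W R R₂ Q ≤ typeExp W R R₂ Q') :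
    IsLeast (objective P W R R₂ '' {V : U → X → Y → ℝ | ∀ u x, V u x ∈ stdSimplex ℝ Y})
      ((typeExp W R R₂ Q : ℝ) : EReal) := by
  have hne : Nonempty (U × X) := by
    by_contra h
    rw [not_nonempty_iff] at h
    have := hP.2
    simp at this
  have : Nonempty U := hne.map Prod.fst
  have : Nonempty X := hne.map Prod.snd
  have hlow : ∀ V : U → X → Y → ℝ, (∀ u x, V u x ∈ stdSimplex ℝ Y) →
      ((typeExp W R R₂ Q : ℝ) : EReal) ≤ objective P W R R₂ V :=
    fun V hV => le_objective hP.1 hmin hV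
  obtain ⟨V, hV, hVQ, -⟩ := exists_channel hW hQ
  refine ⟨⟨V, hV, le_antisymm (objective_le hV hVQ hQ) (hlow V hV)⟩, ?_⟩
  rintro _ ⟨V, hV, rfl⟩
  exact hlow V hV

end Minimum

/-! ### Limits -/

section Limits

variable {U X Y : Type*} [Fintype U] [Fintype X] [Fintype Y] {P : U × X → ℝ} {W : X → Y → ℝ}

/-- A sequence of violating distributions would accumulate at an admissible one, where joint
continuity of `typeExp` in the rates and in `Q` contradicts the strict bound. -/
theorem eventually_le_typeExp {τ : ℕ → U × X → ℝ} (hτ : Tendsto τ atTop (𝓝 P))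
    {r r₂ : ℕ → ℝ} {R R₂ : ℝ} (hr : Tendsto r atTop (𝓝 R)) (hr₂ : Tendsto r₂ atTop (𝓝 R₂))
    {E : ℝ} (hE : ∀ Q ∈ admissible P W, E < typeExp W R R₂ Q) :
    ∀ᶠ k in atTop, ∀ Q ∈ admissible (τ k) W, E ≤ typeExp W (r k) (r₂ k) Q := by
  by_contra hcon
  -- Puts all the violating distributions in one compact box.
  have hbd : ∀ᶠ k in atTop, ∀ p, τ k p ≤ P p + 1 := by
    rw [eventually_all]
    intro p
    have h := (tendsto_pi_nhds.1 hτ) p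
    exact (h.eventually (gt_mem_nhds (by linarith : P p < P p + 1))).mono fun k hk => hk.le
  have hfreq := (Filter.not_eventually.1 hcon).and_eventually hbd
  obtain ⟨φ, hφ, hφp⟩ := Filter.extraction_of_frequently_atTop hfreq
  have hφp' : ∀ j, ∃ Q ∈ admissible (τ (φ j)) W, typeExp W (r (φ j)) (r₂ (φ j)) Q < E := by
    intro j
    have := (hφp j).1
    push Not at this
    exact this
  choose Q hQ hQE using hφp'
  have hmem : ∀ j, Q j ∈ Set.Icc (0 : U → X → Y → ℝ) (fun u x _ => P (u, x) + 1) := by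
    intro j
    refine ⟨fun u x y => (hQ j).1 u x y, fun u x y => ?_⟩
    have h1 := le_mUX (hQ j).1 u x y
    rw [(hQ j).2.1] at h1
    exact h1.trans ((hφp j).2 _)
  obtain ⟨Q₀, -, ψ, hψ, hlim⟩ := isCompact_Icc.tendsto_subseq hmem
  have hφψ : Tendsto (φ ∘ ψ) atTop atTop := hφ.tendsto_atTop.comp hψ.tendsto_atTop
  have hQ₀ : Q₀ ∈ admissible P W := by
    have h1 := (isClosed_nonneg_supp (U := U) W).mem_of_tendsto hlim
      (Eventually.of_forall fun j => ⟨(hQ (ψ j)).1, (hQ (ψ j)).2.2⟩)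
    refine ⟨h1.1, ?_, h1.2⟩
    have h2 := (continuous_mUX.tendsto Q₀).comp hlim
    have h3 : mUX ∘ (Q ∘ ψ) = τ ∘ (φ ∘ ψ) := funext fun j => (hQ (ψ j)).2.1
    rw [h3] at h2
    exact tendsto_nhds_unique h2 (hτ.comp hφψ)
  have hlim2 := ((continuous_typeExp (U := U) W).tendsto (R, R₂, Q₀)).comp
    ((hr.comp hφψ).prodMk_nhds ((hr₂.comp hφψ).prodMk_nhds hlim))
  have := le_of_tendsto hlim2 (Eventually.of_forall fun j => (hQE (ψ j)).le)
  exact absurd (hE Q₀ hQ₀) (not_lt.2 this)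

theorem exists_seq_of_counts {A : Type*} [Fintype A] [DecidableEq A] {n : ℕ} (m : A → ℕ)
    (hm : ∑ i, m i = n) :
    ∃ a : Fin n → A, ∀ i, (Finset.univ.filter (fun t => a t = i)).card = m i := by
  have hcard : Fintype.card (Fin n) = Fintype.card (Σ i, Fin (m i)) := by
    simp [hm]
  let e := Fintype.equivOfCardEq hcard
  refine ⟨fun t => (e t).1, fun i => ?_⟩
  have h : Fintype.card {t // (e t).1 = i} = Fintype.card (Fin (m i)) := by
    refine Fintype.card_congr ((e.subtypeEquiv (q := fun s => s.1 = i) fun t => Iff.rfl).trans ?_)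
    exact Equiv.sigmaSubtype (β := fun i => Fin (m i)) i
  rw [Fintype.card_fin, Fintype.card_subtype] at h
  exact h

/-- Joint types that approximate a joint distribution with a prescribed channel. -/
theorem exists_joint_type [DecidableEq U] [DecidableEq X] [DecidableEq Y] {n : ℕ} (hn : 0 < n)
    {τ : U × X → ℝ} (hτ : (typeClass n τ).Nonempty) {V : U → X → Y → ℝ}
    (hV : ∀ u x, V u x ∈ stdSimplex ℝ Y) (hVW : ∀ u x y, W x y = 0 → V u x y = 0) :
    ∃ Q : U → X → Y → ℝ, (typeClass n (unc Q)).Nonempty ∧ mUX Q = τ ∧ Supp W Q ∧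
      ∀ u x y, |Q u x y - τ (u, x) * V u x y| ≤ (Fintype.card Y + 1) / n := by
  have hn' : (0 : ℝ) < n := by exact_mod_cast hn
  obtain ⟨a, ha⟩ := hτ
  set N : U × X → ℕ := fun p => (Finset.univ.filter (fun t => a t = p)).card with hN
  have hNτ : ∀ p, (N p : ℝ) = n * τ p := ha
  have hNsum : ∑ p, N p = n := by
    have := Finset.card_eq_sum_card_fiberwise (s := (Finset.univ : Finset (Fin n)))
      (t := Finset.univ) (f := a) (fun _ _ => by simp)
    rw [Finset.card_univ, Fintype.card_fin] at this
    exact this.symm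
  -- The counts `N p * V` are rounded down and the at most `card Y` leftover positions of each `p`
  -- go to one output letter of positive probability, which keeps the support. This explains `(card
  -- Y + 1) / n`.
  have hy : ∀ p : U × X, ∃ y, V p.1 p.2 y ≠ 0 := by
    intro p
    by_contra h
    push Not at h
    have := (hV p.1 p.2).2
    simp [h] at this
  choose y₀ hy₀ using hy
  set c : U × X → Y → ℕ := fun p y => ⌊(N p : ℝ) * V p.1 p.2 y⌋₊ with hc
  have hc_le : ∀ p y, (c p y : ℝ) ≤ N p * V p.1 p.2 y := fun p y =>
    Nat.floor_le (mul_nonneg (Nat.cast_nonneg _) ((hV p.1 p.2).1 y))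
  have hc_ge : ∀ p y, N p * V p.1 p.2 y ≤ c p y + 1 := fun p y => (Nat.lt_floor_add_one _).le
  have hVs : ∀ p : U × X, ∑ y, (N p : ℝ) * V p.1 p.2 y = N p := fun p => by
    rw [← Finset.mul_sum, (hV p.1 p.2).2, mul_one]
  have hcN : ∀ p, ∑ y, c p y ≤ N p := by
    intro p
    have h := Finset.sum_le_sum fun y (_ : y ∈ Finset.univ) => hc_le p y
    rw [hVs] at h
    exact_mod_cast h
  have hrest : ∀ p, ((N p - ∑ y, c p y : ℕ) : ℝ) ≤ Fintype.card Y := by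
    intro p
    have h := Finset.sum_le_sum fun y (_ : y ∈ Finset.univ) => hc_ge p y
    rw [hVs, Finset.sum_add_distrib] at h
    rw [Nat.cast_sub (hcN p)]
    push_cast
    simp only [Finset.sum_const, Finset.card_univ, nsmul_eq_mul, mul_one] at h
    linarith
  set m : U × X × Y → ℕ := fun p => c (p.1, p.2.1) p.2.2 +
    if p.2.2 = y₀ (p.1, p.2.1) then N (p.1, p.2.1) - ∑ y, c (p.1, p.2.1) y else 0 with hm
  have hmN : ∀ u x, ∑ y, m (u, x, y) = N (u, x) := by
    intro u x
    simp only [hm, Finset.sum_add_distrib, Finset.sum_ite_eq', Finset.mem_univ, if_true]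
    have := hcN (u, x)
    omega
  have hmn : ∑ p, m p = n := by
    rw [Fintype.sum_prod_type, ← hNsum, Fintype.sum_prod_type]
    refine Finset.sum_congr rfl fun u _ => ?_
    rw [Fintype.sum_prod_type]
    exact Finset.sum_congr rfl fun x _ => hmN u x
  obtain ⟨b, hb⟩ := exists_seq_of_counts m hmn
  refine ⟨fun u x y => (m (u, x, y) : ℝ) / n, ⟨b, fun p => ?_⟩, ?_, ?_, ?_⟩
  · rw [hb, unc, mul_div_cancel₀ _ hn'.ne']
  · funext p
    simp only [mUX]
    rw [← Finset.sum_div, ← Nat.cast_sum, hmN, hNτ, mul_div_cancel_left₀ _ hn'.ne']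
  · intro u x y h
    have h1 : V u x y = 0 := hVW u x y h
    have h2 : y ≠ y₀ (u, x) := by
      rintro rfl
      exact hy₀ (u, x) h1
    simp [hm, hc, h1, h2]
  · intro u x y
    have h1 : τ (u, x) * V u x y = (N (u, x) * V u x y) / n := by
      rw [hNτ]; field_simp
    rw [h1, ← sub_div, abs_div, abs_of_pos hn']
    refine div_le_div_of_nonneg_right ?_ hn'.le
    have h2 := hc_le (u, x) y
    have h3 := hc_ge (u, x) y
    have h4 := hrest (u, x)
    have h5 : (0 : ℝ) ≤ ((N (u, x) - ∑ y, c (u, x) y : ℕ) : ℝ) := Nat.cast_nonneg _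
    have h6 : (0 : ℝ) ≤ Fintype.card Y := Nat.cast_nonneg _
    simp only [hm]
    push_cast
    rw [abs_le]
    dsimp only at h2 h3
    split_ifs with h
    · constructor <;> linarith
    · constructor <;> linarith

theorem tendsto_slack_div {n : ℕ → ℕ} (hn : Tendsto n atTop atTop) :
    Tendsto (fun k => slack U X Y (n k) / n k) atTop (𝓝 0) := by
  have h1 : Tendsto (fun m : ℕ => slack U X Y m / m) atTop (𝓝 0) := by
    have hx : Tendsto (fun m : ℕ => (m : ℝ) + 1) atTop atTop :=
      tendsto_atTop_add_const_right _ _ tendsto_natCast_atTop_atTop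
    have h2 : Tendsto (fun m : ℕ => Real.log ((m : ℝ) + 1) / ((m : ℝ) + 1)) atTop (𝓝 0) :=
      (Real.isLittleO_log_id_atTop.tendsto_div_nhds_zero).comp hx
    have h3 : Tendsto (fun m : ℕ => 1 / (m : ℝ)) atTop (𝓝 0) :=
      tendsto_one_div_atTop_nhds_zero_nat
    have h4 := ((h2.mul (h3.const_add 1)).add h3).const_mul
      (((Fintype.card U : ℝ) + 1) * (Fintype.card X + 1) * (Fintype.card Y + 1))
    simp only [zero_mul, add_zero, mul_zero] at h4
    refine h4.congr' ?_
    filter_upwards [eventually_gt_atTop 0] with m hm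
    have hm' : (0 : ℝ) < m := by exact_mod_cast hm
    rw [slack]
    field_simp
  exact h1.comp hn

end Limits

/-! ### Positivity of the error probability -/

section Positivity

variable {U X Y : Type*} [Fintype U] [Fintype X] [Fintype Y] [DecidableEq U] [DecidableEq X]

theorem uniformMass_pos {A : Type*} [Finite A] {T : Set A} {a : A} (h : a ∈ T) :
    0 < uniformMass T a := by
  rw [uniformMass, Set.indicator_of_mem h]
  exact inv_pos.2 (ncard_pos_of_mem h)

theorem codeProb_nonneg {n M M₂ : ℕ} (P : U × X → ℝ) (u : Fin M → Fin n → U)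
    (x : Fin M → Fin M₂ → Fin n → X) : 0 ≤ codeProb P u x :=
  Finset.prod_nonneg fun _ _ => mul_nonneg (uniformMass_nonneg _ _)
    (Finset.prod_nonneg fun _ _ => uniformMass_nonneg _ _)

/-- The error probability is positive since all codewords coincide with positive probability. -/
theorem errorProb_pos {n M M₂ : ℕ} {P : U × X → ℝ} (hP : (typeClass n P).Nonempty)
    {W : X → Y → ℝ} (hW : ∀ x, W x ∈ stdSimplex ℝ Y) (hM : 2 ≤ M) (hM₂ : 1 ≤ M₂)
    (dec : (Fin M → Fin M₂ → Fin n → X) → (Fin n → Y) → Fin M) : 0 < errorProb P W dec := by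
  obtain ⟨a, ha⟩ := hP
  have hW0 : ∀ x y, 0 ≤ W x y := fun x => (hW x).1
  have hM0 : (0 : ℝ) < M := by exact_mod_cast (by omega : 0 < M)
  have hM₂0 : (0 : ℝ) < M₂ := by exact_mod_cast hM₂
  set u₀ : Fin n → U := fun t => (a t).1 with hu₀
  set x₀ : Fin n → X := fun t => (a t).2 with hx₀
  have hu : u₀ ∈ typeClass n (margU P) :=
    comp_mem_typeClass (fun a : U × X => a.1) (sum_fiber_fst P) ha
  have hx : x₀ ∈ condTypeClass P u₀ := ha
  have hite : ∀ (x : Fin M → Fin M₂ → Fin n → X) (y : Fin n → Y) (w : Fin M),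
      (0 : ℝ) ≤ (if dec x y = w then 0 else 1) := fun x y w => by split_ifs <;> norm_num
  have hterm : ∀ (x : Fin M → Fin M₂ → Fin n → X) (w : Fin M) (j : Fin M₂) (y : Fin n → Y),
      0 ≤ chan W (x w j) y * (if dec x y = w then 0 else 1) := fun x w j y =>
    mul_nonneg (Finset.prod_nonneg fun _ _ => hW0 _ _) (hite x y w)
  have hy : ∀ x, ∃ y, 0 < W x y := by
    intro x
    by_contra h
    push Not at h
    have h1 : ∑ y, W x y ≤ 0 := Finset.sum_nonpos fun y _ => h y
    rw [(hW x).2] at h1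
    linarith
  choose g hg using hy
  set xs : Fin M → Fin M₂ → Fin n → X := fun _ _ => x₀ with hxs
  set y₀ : Fin n → Y := fun t => g (x₀ t) with hy₀
  have : Nontrivial (Fin M) := Fin.nontrivial_iff_two_le.2 hM
  -- With all codewords equal to `x₀`, any bin other than the decoded one could equally have been
  -- sent.
  obtain ⟨w, hw⟩ := exists_ne (dec xs y₀)
  have hin : 0 < ∑ w : Fin M, ∑ j : Fin M₂, ∑ y : Fin n → Y,
      chan W (xs w j) y * (if dec xs y = w then (0 : ℝ) else 1) := by
    refine Finset.sum_pos' (fun w _ => Finset.sum_nonneg fun j _ => Finset.sum_nonneg fun y _ =>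
      hterm _ _ _ _) ⟨w, Finset.mem_univ _, ?_⟩
    refine Finset.sum_pos' (fun j _ => Finset.sum_nonneg fun y _ => hterm _ _ _ _)
      ⟨⟨0, hM₂⟩, Finset.mem_univ _, ?_⟩
    refine Finset.sum_pos' (fun y _ => hterm _ _ _ _) ⟨y₀, Finset.mem_univ _, ?_⟩
    rw [if_neg hw.symm, mul_one]
    exact Finset.prod_pos fun t _ => hg _
  have hnn : ∀ (u : Fin M → Fin n → U) (x : Fin M → Fin M₂ → Fin n → X), 0 ≤ codeProb P u x *
    (((M : ℝ) * (M₂ : ℝ))⁻¹ * ∑ w : Fin M, ∑ j : Fin M₂, ∑ y : Fin n → Y,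
      chan W (x w j) y * (if dec x y = w then 0 else 1)) := fun u x =>
    mul_nonneg (codeProb_nonneg _ _ _) (mul_nonneg (by positivity)
      (Finset.sum_nonneg fun w _ => Finset.sum_nonneg fun j _ => Finset.sum_nonneg fun y _ =>
        hterm _ _ _ _))
  refine Finset.sum_pos' (fun u _ => Finset.sum_nonneg fun x _ => hnn u x)
    ⟨fun _ => u₀, Finset.mem_univ _, Finset.sum_pos' (fun x _ => hnn _ x)
      ⟨xs, Finset.mem_univ _, ?_⟩⟩
  refine mul_pos (Finset.prod_pos fun w _ => mul_pos (uniformMass_pos hu) (Finset.prod_pos fun j _ =>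
    uniformMass_pos hx)) (mul_pos (by positivity) hin)

end Positivity

end

end BinDecoding

/-- The hierarchical ensemble with `P_{UX} = PUX` and `P_{Y|X} = W`. Along the blocklengths
`n k → ∞` the type classes are those of joint types `τ k → PUX` of length `n k`; if `PUX` is itself
such a type, `τ k = PUX` is allowed. There are `M k = e^{n (R + o(1))} ≥ 2` bins, where
`R = R₁ - R₂`, of `M₂ k = e^{n (R₂ + o(1))}` codewords each. -/
theorem theorem2 {U X Y : Type*} [Fintype U] [Fintype X] [Fintype Y]
    [DecidableEq U] [DecidableEq X]
    (PUX : U × X → ℝ) (hPUX : PUX ∈ stdSimplex ℝ (U × X))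
    (W : X → Y → ℝ) (hW : ∀ x, W x ∈ stdSimplex ℝ Y)
    (R₁ R₂ : ℝ) (hR₂ : 0 ≤ R₂) (hR : R₂ ≤ R₁)
    (n : ℕ → ℕ) (hn : Tendsto n atTop atTop)
    (τ : ℕ → U × X → ℝ) (hτ : ∀ k, (BinDecoding.typeClass (n k) (τ k)).Nonempty)
    (hτlim : Tendsto τ atTop (𝓝 PUX))
    (M M₂ : ℕ → ℕ) (hM : ∀ k, 2 ≤ M k) (hM₂ : ∀ k, 1 ≤ M₂ k)
    (hMR : Tendsto (fun k => Real.log (M k) / n k) atTop (𝓝 (R₁ - R₂)))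
    (hM₂R : Tendsto (fun k => Real.log (M₂ k) / n k) atTop (𝓝 R₂))
    (dec : ∀ k, (Fin (M k) → Fin (M₂ k) → Fin (n k) → X) → (Fin (n k) → Y) → Fin (M k))
    (hdec : ∀ k, BinDecoding.IsOptimalBinDecoder W (dec k)) :
    (∀ k, 0 < BinDecoding.errorProb (τ k) W (dec k)) ∧
    ∃ E : ℝ,
      IsLeast (BinDecoding.objective PUX W (R₁ - R₂) R₂ ''
        {V : U → X → Y → ℝ | ∀ u x, V u x ∈ stdSimplex ℝ Y}) (E : EReal) ∧
      Tendsto (fun k => -Real.log (BinDecoding.errorProb (τ k) W (dec k)) / n k) atTop (𝓝 E) := by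
  classical
  have hpos : ∀ k, 0 < BinDecoding.errorProb (τ k) W (dec k) := fun k =>
    BinDecoding.errorProb_pos (hτ k) hW (hM k) (hM₂ k) (dec k)
  refine ⟨hpos, ?_⟩
  have hW0 : ∀ x y, 0 ≤ W x y := fun x => (hW x).1
  obtain ⟨Q, hQ, hmin⟩ := BinDecoding.exists_typeExp_min hPUX.1 hW (R₁ - R₂) R₂
  refine ⟨_, BinDecoding.isLeast_objective hPUX hW hQ hmin, ?_⟩
  have hn0 : ∀ᶠ k in atTop, 0 < n k := hn.eventually_gt_atTop 0
  have hrate : ∀ (m k : ℕ), 1 ≤ m → 0 < n k →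
      (m : ℝ) = Real.exp (n k * (Real.log m / n k)) := by
    intro m k hm hk
    have hk' : (n k : ℝ) ≠ 0 := by exact_mod_cast hk.ne'
    rw [mul_div_cancel₀ _ hk', Real.exp_log (by exact_mod_cast hm)]
  have hslack := BinDecoding.tendsto_slack_div (U := U) (X := X) (Y := Y) hn
  -- Joint types compatible with `τ k` and converging to the minimizer `Q`, to be fed into
  -- `errorProb_ge`. For `n k = 0` the value is irrelevant.
  have htypes : ∀ k, ∃ Q' : U → X → Y → ℝ, 0 < n k →
      (BinDecoding.typeClass (n k) (BinDecoding.unc Q')).Nonempty ∧ BinDecoding.mUX Q' = τ k ∧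
      BinDecoding.Supp W Q' ∧ dist Q' Q ≤ (Fintype.card Y + 1) / n k + dist (τ k) PUX := by
    obtain ⟨V, hV, hVQ, hVW⟩ := BinDecoding.exists_channel hW hQ
    intro k
    by_cases hk : 0 < n k
    · obtain ⟨Q', h1, h2, h3, h4⟩ := BinDecoding.exists_joint_type hk (hτ k) hV hVW
      refine ⟨Q', fun _ => ⟨h1, h2, h3, ?_⟩⟩
      have hnn : (0 : ℝ) ≤ (Fintype.card Y + 1) / n k + dist (τ k) PUX := by positivity
      refine (dist_pi_le_iff hnn).2 fun u => (dist_pi_le_iff hnn).2 fun x =>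
        (dist_pi_le_iff hnn).2 fun y => ?_
      have h5 : Q u x y = PUX (u, x) * V u x y := by rw [← hVQ]
      have h6 := dist_le_pi_dist (τ k) PUX (u, x)
      rw [Real.dist_eq] at h6 ⊢
      have hV1 : |V u x y| ≤ 1 := by
        rw [abs_of_nonneg ((hV u x).1 y), ← (hV u x).2]
        exact Finset.single_le_sum (fun y _ => (hV u x).1 y) (Finset.mem_univ y)
      have h7 : Q' u x y - Q u x y = (Q' u x y - τ k (u, x) * V u x y) +
          (τ k (u, x) - PUX (u, x)) * V u x y := by rw [h5]; ring
      rw [h7]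
      refine (abs_add_le _ _).trans (add_le_add (h4 u x y) ?_)
      rw [abs_mul]
      calc |τ k (u, x) - PUX (u, x)| * |V u x y| ≤ |τ k (u, x) - PUX (u, x)| * 1 :=
            mul_le_mul_of_nonneg_left hV1 (abs_nonneg _)
        _ ≤ _ := by rw [mul_one]; exact h6
    · exact ⟨Q, fun h => absurd h hk⟩
  choose Qs hQs using htypes
  have hQslim : Tendsto Qs atTop (𝓝 Q) := by
    rw [tendsto_iff_dist_tendsto_zero]
    have h1 : Tendsto (fun k => ((Fintype.card Y : ℝ) + 1) / n k + dist (τ k) PUX) atTop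
        (𝓝 (0 + 0)) :=
      (tendsto_const_nhds.div_atTop (tendsto_natCast_atTop_atTop.comp hn)).add
        (tendsto_iff_dist_tendsto_zero.1 hτlim)
    rw [add_zero] at h1
    refine squeeze_zero' (Eventually.of_forall fun _ => dist_nonneg) ?_ h1
    filter_upwards [hn0] with k hk using (hQs k hk).2.2.2
  refine tendsto_order.2 ⟨fun e he => ?_, fun e he => ?_⟩
  -- The gap between `e` and `e'` absorbs `7 * slack / n`; the strict inequality below the minimum
  -- is what the compactness argument needs.
  · obtain ⟨e', he', hE'⟩ := exists_between he
    have h1 := BinDecoding.eventually_le_typeExp hτlim hMR hM₂R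
      (fun Q' hQ' => lt_of_lt_of_le hE' (hmin Q' hQ'))
    have h2 : Tendsto (fun k => e' - 7 * (BinDecoding.slack U X Y (n k) / n k)) atTop
        (𝓝 (e' - 7 * 0)) := tendsto_const_nhds.sub (hslack.const_mul 7)
    filter_upwards [h1, hn0, h2.eventually (lt_mem_nhds (by linarith : e < e' - 7 * 0))]
      with k hk1 hk hk2
    have hk' : (0 : ℝ) < n k := by exact_mod_cast hk
    have h3 := BinDecoding.errorProb_le hk hW0 (hτ k) (hrate (M k) k (by linarith [hM k]) hk)
      (hrate (M₂ k) k (hM₂ k) hk) (hdec k) (e := e') (fun Q' hne hUX hs => by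
        refine hk1 Q' ⟨fun u x y => ?_, hUX, hs⟩
        obtain ⟨a, ha⟩ := hne
        have h4 : (n k : ℝ) * Q' u x y = _ := (ha (u, x, y)).symm
        have h5 : 0 ≤ (n k : ℝ) * Q' u x y := by rw [h4]; exact Nat.cast_nonneg _
        exact nonneg_of_mul_nonneg_right h5 hk')
    have h4 := Real.log_le_log (hpos k) h3
    rw [Real.log_exp] at h4
    refine hk2.trans_le ?_
    rw [le_div_iff₀ hk', sub_mul, mul_assoc, div_mul_cancel₀ _ hk'.ne']
    linarith
  · have h1 : Tendsto (fun k => BinDecoding.typeExp W (Real.log (M k) / n k)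
        (Real.log (M₂ k) / n k) (Qs k) + 13 * (BinDecoding.slack U X Y (n k) / n k)) atTop
        (𝓝 (BinDecoding.typeExp W (R₁ - R₂) R₂ Q + 13 * 0)) :=
      (((BinDecoding.continuous_typeExp (U := U) W).tendsto (R₁ - R₂, R₂, Q)).comp
        (hMR.prodMk_nhds (hM₂R.prodMk_nhds hQslim))).add (hslack.const_mul 13)
    filter_upwards [h1.eventually (gt_mem_nhds (by linarith :
      BinDecoding.typeExp W (R₁ - R₂) R₂ Q + 13 * 0 < e)), hn0] with k hk1 hk
    have hk' : (0 : ℝ) < n k := by exact_mod_cast hk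
    obtain ⟨hne, hUX, hs, -⟩ := hQs k hk
    have h3 := BinDecoding.errorProb_ge hk hW0 (hM k) (hrate (M k) k (by linarith [hM k]) hk)
      (hrate (M₂ k) k (hM₂ k) hk) (dec k) hne hs
    rw [hUX] at h3
    have h4 := Real.log_le_log (Real.exp_pos _) h3
    rw [Real.log_exp] at h4
    refine lt_of_le_of_lt ?_ hk1
    rw [div_le_iff₀ hk', add_mul, mul_assoc, div_mul_cancel₀ _ hk'.ne']
    linarith
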